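/- **Theorem.** For a multilinear polynomial $p(x)=\sum_{I\subseteq[n]}\widehat p(I)\prod_{i\in I}x_i$ write $\|p\|_1=\sum_I|\widehat p(I)|$, and let $\partial_i p(x)=\sum_{J\not\ni i}\widehat p(J\cup\{i\})\prod_{j\in J}x_j$. A distribution $\mathcal D$ on $\{1,-1\}^n$ is a *$t$-wise MRF with dependency graph $G$ and factorization polynomial $\psi$* if $\Pr_{Z\sim\mathcal D}[Z=x]\propto\exp(\psi(x))$, where $\psi$ is the multilinear polynomial that satisfies $\psi(x)=\sum_{I\in\mathcal S}\psi_I(x)$ on $\{1,-1\}^n$, $\mathcal S$ is a collection of cliques of size at most $t$ of the graph $G$ on $[n]$, and each $\psi_I$ depends only on the variables in $I$. There are a single online algorithm and an absolute constant $C$ such that the following holds for all integers $n,t\ge 1$, all reals $\lambda\ge 0$ and $\epsilon,\rho\in(0,1/2)$, and every integer $$N\;\ge\;\frac{(2t)^{Ct}\,e^{C\lambda t}}{\epsilon^4}\cdot n^{4t}\cdot\log\frac{n}{\rho\,\epsilon}.$$ Given $n,t,\lambda,\epsilon,\rho,N$ and a stream $Z^1,\dots,Z^N\in\{1,-1\}^n$,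 the algorithm outputs a graph $H$ on $[n]$ and a multilinear polynomial $\phi$ (as a list of monomials with coefficients) that are the dependency graph and the factorization polynomial of a $t$-wise MRF $\mathcal D'$. If $\mathcal D$ is any $t$-wise MRF on $\{1,-1\}^n$ with some dependency graph $G$ and a factorization polynomial $\psi$ with $\max_i\|\partial_i\psi\|_1\le\lambda$, and $Z^1,\dots,Z^N$ are independent samples from $\mathcal D$, then with probability at least $1-\rho$ $$\forall x\in\{1,-1\}^n:\quad (1-\epsilon)\Pr_{Z\sim\mathcal D'}[Z=x]\;\le\;\Pr_{Z\sim\mathcal D}[Z=x]\;\le\;(1+\epsilon)\Pr_{Z\sim\mathcal D'}[Z=x].$$ For every stream, the running time is at most $C\,N\,n^t$. The algorithm is online: it reads each sample once, in order, and processes it in at most $C\,n^t$ steps, with a working memory that is independent of $N$. Here an algorithm is a program for a random access machine that has word registers and real registers with indirect addressing, and unit-cost operations: $+,-,\times,\div$ on words and on reals, $\exp,\log,\sqrt{\cdot}$ on reals, and comparisons. All words used, including all addresses, are at most $(2tn)^{Ct}$. -/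

import Mathlib

open MeasureTheory

/-! ### Multilinear polynomials and Markov random fields on the cube `{1,-1}ⁿ` -/

/-- The cube `{1,-1}ⁿ` (the units of `ℤ` are `1` and `-1`). -/
abbrev Cube (n : ℕ) : Type := Fin n → ℤˣ

/-- Points of `{1,-1}` are measurable, so every subset of the cube is. -/
instance : MeasurableSingletonClass ℤˣ :=
  ⟨fun a => ⟨{(a : ℤ)}, measurableSet_singleton _, by ext b; simp [Units.ext_iff]⟩⟩

/-- A real multilinear polynomial in `n` variables, given by its coefficients:
`p I` is the coefficient of the monomial `∏ i ∈ I, x i`. -/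
abbrev MultilinearPoly (n : ℕ) : Type := Finset (Fin n) → ℝ

namespace MultilinearPoly

variable {n : ℕ}

/-- The value of the polynomial at a point of the cube. -/
noncomputable def eval (p : MultilinearPoly n) (x : Cube n) : ℝ :=
  ∑ I : Finset (Fin n), p I * ∏ i ∈ I, (((x i : ℤˣ) : ℤ) : ℝ)

/-- The sum of the absolute values of the coefficients. -/
noncomputable def l1Norm (p : MultilinearPoly n) : ℝ := ∑ I : Finset (Fin n), |p I|

/-- The partial derivative with respect to the variable `x i`: the coefficient of a monomial `J`
is that of `J ∪ {i}` in `p` if `i ∉ J`, and zero otherwise. -/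
noncomputable def partialDeriv (i : Fin n) (p : MultilinearPoly n) : MultilinearPoly n :=
  fun J => if i ∈ J then 0 else p (insert i J)

end MultilinearPoly

/-- `D` is a binary `t`-wise Markov random field with dependency graph `G` and factorization
polynomial `ψ`: the probability of `x` is proportional to `exp (∑ I ∈ S, ψ_I x)`, where `S` is a
collection of cliques of `G` with at most `t` vertices and `ψ_I` depends only on the variables in
`I`, and `ψ` is the multilinear polynomial with `ψ x = ∑ I ∈ S, ψ_I x` on the cube. -/
def IsMRF {n : ℕ} (t : ℕ) (G : SimpleGraph (Fin n)) (ψ : MultilinearPoly n)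
    (D : PMF (Cube n)) : Prop :=
  ∃ (S : Finset (Finset (Fin n))) (ψI : Finset (Fin n) → Cube n → ℝ),
    (∀ I ∈ S, G.IsClique (I : Set (Fin n)) ∧ I.card ≤ t) ∧
    (∀ I ∈ S, DependsOn (ψI I) (I : Set (Fin n))) ∧
    (∀ x, ψ.eval x = ∑ I ∈ S, ψI I x) ∧
    ∃ c : ℝ, 0 < c ∧ ∀ x, (D x).toReal = c * Real.exp (ψ.eval x)

/-! ### A real random access machine with a step count

The machine has arrays of natural numbers (machine words) and arrays of real numbers, both with
indirect addressing.  Array names are constants of the program, indices are computed.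
Every arithmetic operation, memory access, comparison and assignment costs one step. -/

namespace RealRAM

/-- The memory: `nats a i` and `reals a i` are the `i`-th cells of the `a`-th arrays. -/
structure State where
  nats : ℕ → ℕ → ℕ
  reals : ℕ → ℕ → ℝ

/-- Word-valued expressions.  Subtraction is truncated, division rounds down. -/
inductive NExpr where
  | lit (c : ℕ)
  | get (a : ℕ) (i : NExpr)
  | add (e f : NExpr)
  | sub (e f : NExpr)
  | mul (e f : NExpr)
  | div (e f : NExpr)

namespace NExpr

/-- The value of an expression. -/
def eval (s : State) : NExpr → ℕ
  | lit c => c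
  | get a i => s.nats a (i.eval s)
  | add e f => e.eval s + f.eval s
  | sub e f => e.eval s - f.eval s
  | mul e f => e.eval s * f.eval s
  | div e f => e.eval s / f.eval s

/-- The number of operations needed to evaluate an expression. -/
def cost : NExpr → ℕ
  | lit _ => 1
  | get _ i => i.cost + 1
  | add e f => e.cost + f.cost + 1
  | sub e f => e.cost + f.cost + 1
  | mul e f => e.cost + f.cost + 1
  | div e f => e.cost + f.cost + 1

/-- All words that occur in the evaluation (addresses included) are at most `W`. -/
def Fits (W : ℕ) (s : State) : NExpr → Prop
  | lit c => c ≤ W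
  | get a i => i.Fits W s ∧ s.nats a (i.eval s) ≤ W
  | add e f => e.Fits W s ∧ f.Fits W s ∧ e.eval s + f.eval s ≤ W
  | sub e f => e.Fits W s ∧ f.Fits W s
  | mul e f => e.Fits W s ∧ f.Fits W s ∧ e.eval s * f.eval s ≤ W
  | div e f => e.Fits W s ∧ f.Fits W s

end NExpr

/-- Real-valued expressions.  The only real constants are the natural numbers. -/
inductive RExpr where
  | ofNat (e : NExpr)
  | get (a : ℕ) (i : NExpr)
  | add (e f : RExpr)
  | sub (e f : RExpr)
  | mul (e f : RExpr)
  | div (e f : RExpr)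
  | exp (e : RExpr)
  | log (e : RExpr)
  | sqrt (e : RExpr)

namespace RExpr

/-- The value of an expression. -/
noncomputable def eval (s : State) : RExpr → ℝ
  | ofNat e => (e.eval s : ℝ)
  | get a i => s.reals a (i.eval s)
  | add e f => e.eval s + f.eval s
  | sub e f => e.eval s - f.eval s
  | mul e f => e.eval s * f.eval s
  | div e f => e.eval s / f.eval s
  | exp e => Real.exp (e.eval s)
  | log e => Real.log (e.eval s)
  | sqrt e => Real.sqrt (e.eval s)

/-- The number of operations needed to evaluate an expression. -/
def cost : RExpr → ℕ
  | ofNat e => e.cost + 1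
  | get _ i => i.cost + 1
  | add e f => e.cost + f.cost + 1
  | sub e f => e.cost + f.cost + 1
  | mul e f => e.cost + f.cost + 1
  | div e f => e.cost + f.cost + 1
  | exp e => e.cost + 1
  | log e => e.cost + 1
  | sqrt e => e.cost + 1

/-- All words that occur in the evaluation (addresses included) are at most `W`. -/
def Fits (W : ℕ) (s : State) : RExpr → Prop
  | ofNat e => e.Fits W s
  | get _ i => i.Fits W s
  | add e f => e.Fits W s ∧ f.Fits W s
  | sub e f => e.Fits W s ∧ f.Fits W s
  | mul e f => e.Fits W s ∧ f.Fits W s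
  | div e f => e.Fits W s ∧ f.Fits W s
  | exp e => e.Fits W s
  | log e => e.Fits W s
  | sqrt e => e.Fits W s

end RExpr

/-- Tests. -/
inductive Test where
  | natLE (e f : NExpr)
  | realLE (e f : RExpr)

namespace Test

/-- The test succeeds. -/
def Holds (s : State) : Test → Prop
  | natLE e f => e.eval s ≤ f.eval s
  | realLE e f => e.eval s ≤ f.eval s

/-- The number of operations needed to evaluate a test. -/
def cost : Test → ℕ
  | natLE e f => e.cost + f.cost + 1
  | realLE e f => e.cost + f.cost + 1

/-- All words that occur in the evaluation (addresses included) are at most `W`. -/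
def Fits (W : ℕ) (s : State) : Test → Prop
  | natLE e f => e.Fits W s ∧ f.Fits W s
  | realLE e f => e.Fits W s ∧ f.Fits W s

end Test

namespace State

/-- Overwrite one word cell. -/
def setNat (s : State) (a i v : ℕ) : State :=
  { s with nats := Function.update s.nats a (Function.update (s.nats a) i v) }

/-- Overwrite one real cell. -/
noncomputable def setReal (s : State) (a i : ℕ) (v : ℝ) : State :=
  { s with reals := Function.update s.reals a (Function.update (s.reals a) i v) }

end State

/-- Programs. -/
inductive Prog where
  | skip
  | setNat (a : ℕ) (i e : NExpr)
  | setReal (a : ℕ) (i : NExpr) (e : RExpr)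
  | seq (p q : Prog)
  | ite (b : Test) (p q : Prog)
  | while (b : Test) (p : Prog)

/-- `Exec W p s k s'`: on a machine whose words are the numbers `0, …, W`, the program `p` started
in state `s` halts in state `s'` after `k` steps.  (A program that would produce a larger word, or
that does not halt, has no execution.) -/
inductive Exec (W : ℕ) : Prog → State → ℕ → State → Prop where
  | skip (s : State) : Exec W Prog.skip s 1 s
  | setNat (s : State) (a : ℕ) (i e : NExpr) (hi : i.Fits W s) (he : e.Fits W s) :
      Exec W (Prog.setNat a i e) s (i.cost + e.cost + 1) (s.setNat a (i.eval s) (e.eval s))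
  | setReal (s : State) (a : ℕ) (i : NExpr) (e : RExpr) (hi : i.Fits W s) (he : e.Fits W s) :
      Exec W (Prog.setReal a i e) s (i.cost + e.cost + 1) (s.setReal a (i.eval s) (e.eval s))
  | seq {p q : Prog} {s s' s'' : State} {k l : ℕ} (hp : Exec W p s k s')
      (hq : Exec W q s' l s'') : Exec W (Prog.seq p q) s (k + l) s''
  | iteTrue {b : Test} {p q : Prog} {s s' : State} {k : ℕ} (hf : b.Fits W s) (hb : b.Holds s)
      (hp : Exec W p s k s') : Exec W (Prog.ite b p q) s (b.cost + k) s'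
  | iteFalse {b : Test} {p q : Prog} {s s' : State} {k : ℕ} (hf : b.Fits W s) (hb : ¬ b.Holds s)
      (hq : Exec W q s k s') : Exec W (Prog.ite b p q) s (b.cost + k) s'
  | whileTrue {b : Test} {p : Prog} {s s' s'' : State} {k l : ℕ} (hf : b.Fits W s)
      (hb : b.Holds s) (hp : Exec W p s k s') (hw : Exec W (Prog.while b p) s' l s'') :
      Exec W (Prog.while b p) s (b.cost + k + l) s''
  | whileFalse {b : Test} {p : Prog} {s : State} (hf : b.Fits W s) (hb : ¬ b.Holds s) :
      Exec W (Prog.while b p) s b.cost s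

/-- Executions are deterministic: the step count and the final state are determined. -/
theorem Exec.unique {W : ℕ} {p : Prog} {s s₁ : State} {k₁ : ℕ} (h₁ : Exec W p s k₁ s₁) :
    ∀ {k₂ : ℕ} {s₂ : State}, Exec W p s k₂ s₂ → k₁ = k₂ ∧ s₁ = s₂ := by
  induction h₁ with
  | skip s => intro _ _ h; cases h; exact ⟨rfl, rfl⟩
  | setNat s a i e hi he => intro _ _ h; cases h; exact ⟨rfl, rfl⟩
  | setReal s a i e hi he => intro _ _ h; cases h; exact ⟨rfl, rfl⟩
  | seq _ _ ih₁ ih₂ =>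
    intro _ _ h
    cases h with
    | seq hp hq =>
      obtain ⟨rfl, rfl⟩ := ih₁ hp
      obtain ⟨rfl, rfl⟩ := ih₂ hq
      exact ⟨rfl, rfl⟩
  | iteTrue hf hb _ ih =>
    intro _ _ h
    cases h with
    | iteTrue _ _ hp => obtain ⟨rfl, rfl⟩ := ih hp; exact ⟨rfl, rfl⟩
    | iteFalse _ hb' _ => exact absurd hb hb'
  | iteFalse hf hb _ ih =>
    intro _ _ h
    cases h with
    | iteTrue _ hb' _ => exact absurd hb' hb
    | iteFalse _ _ hp => obtain ⟨rfl, rfl⟩ := ih hp; exact ⟨rfl, rfl⟩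
  | whileTrue hf hb _ _ ih₁ ih₂ =>
    intro _ _ h
    cases h with
    | whileTrue _ _ hp hw =>
      obtain ⟨rfl, rfl⟩ := ih₁ hp
      obtain ⟨rfl, rfl⟩ := ih₂ hw
      exact ⟨rfl, rfl⟩
    | whileFalse _ hb' => exact absurd hb hb'
  | whileFalse hf hb =>
    intro _ _ h
    cases h with
    | whileTrue _ hb' _ _ => exact absurd hb' hb
    | whileFalse _ _ => exact ⟨rfl, rfl⟩

/-- An online algorithm: a program run before the first sample, a program run once for each
sample as it arrives, and a program run after the last sample. -/
structure OnlineAlgorithm where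
  init : Prog
  step : Prog
  finish : Prog

/-- The initial memory: word array `0` holds `n, t`, real array `0` holds `λ, ε, ρ, N`, and all
other cells are zero. -/
noncomputable def inputState (n t : ℕ) (lam ε ρ : ℝ) (N : ℕ) : State where
  nats a i := if a = 0 then (if i = 0 then n else if i = 1 then t else 0) else 0
  reals a i := if a = 0 then
      (if i = 0 then lam else if i = 1 then ε else if i = 2 then ρ else if i = 3 then (N : ℝ)
        else 0)
    else 0

/-- Place a sample in real array `1`, overwriting the preceding one. -/
noncomputable def State.load {n : ℕ} (s : State) (x : Cube n) : State where
  nats := s.nats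
  reals := Function.update s.reals 1
    (fun i => if h : i < n then (((x ⟨i, h⟩ : ℤˣ) : ℤ) : ℝ) else 0)

/-- The online algorithm `A`, on the parameters `n, t, λ, ε, ρ, N` and the stream of samples
`Z 0, …, Z (N-1)`, halts with final memory `out`; each sample is processed in at most `perSample`
steps, the whole run takes at most `total` steps, and all words used, in particular all
addresses, are at most `W`. -/
def OnlineAlgorithm.Runs (A : OnlineAlgorithm) (W perSample total : ℕ) {n : ℕ} (t : ℕ)
    (lam ε ρ : ℝ) {N : ℕ} (Z : Fin N → Cube n) (out : State) : Prop :=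
  ∃ (s : ℕ → State) (c : ℕ → ℕ) (c₀ c₁ : ℕ),
    Exec W A.init (inputState n t lam ε ρ N) c₀ (s 0) ∧
    (∀ j : Fin N, Exec W A.step ((s j).load (Z j)) (c j) (s (j + 1)) ∧ c j ≤ perSample) ∧
    Exec W A.finish (s N) c₁ out ∧
    c₀ + (∑ j ∈ Finset.range N, c j) + c₁ ≤ total

/-- The `k`-th output monomial: word array `2` holds, for each `k`, a row of `n` flags that mark
the variables occurring in it. -/
def outputMonomial (n : ℕ) (s : State) (k : ℕ) : Finset (Fin n) :=
  Finset.univ.filter fun i => s.nats 2 (k * n + i) ≠ 0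

/-- The output polynomial, written by the algorithm as a list of terms: cell `0` of word array `1`
holds the number of terms, and real array `2` holds their coefficients. -/
noncomputable def outputPoly (n : ℕ) (s : State) : MultilinearPoly n := fun I =>
  ∑ k ∈ (Finset.range (s.nats 1 0)).filter (fun k => outputMonomial n s k = I), s.reals 2 k

/-- The output graph: word array `3` holds an `n × n` array of flags that mark the edges. -/
def outputGraph (n : ℕ) (s : State) : SimpleGraph (Fin n) :=
  SimpleGraph.fromRel fun i j => s.nats 3 (i * n + j) ≠ 0

end RealRAM

/-! Given the other coordinates, the coordinate `i` of the field equals `1` with probability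
`logistic (2 * ∂ᵢψ)`, and `∂ᵢψ` has degree at most `t - 1` and coefficient norm at most `λ`. So for
each vertex one has to learn a generalized linear model whose features are monomials. This is done
online by multiplicative weights over the experts `±` monomial, scaled by `2λ`. The vector fed to
the experts is the monomial values times the gradient `logistic (prediction) - (x_i + 1) / 2`.

For every stream, `hedge_regret` bounds the sum of the excess losses `gradient * (prediction - 2 *
∂ᵢψ)`. The conditional mean of each excess is at least `exp (-2λ) / 4` times the mean square of
`prediction - 2 * ∂ᵢψ`: the observed value may be replaced by its conditional mean
(`IsMRF.sum_logistic_sub`), and the logistic function is strongly monotone on bounded intervals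
(`logistic_strongly_monotone`, `le_sum_vertexExcess`). An Azuma inequality (`azuma_trajectory`)
links the observed sum to the conditional means. By convexity the averaged predictor is then close
to `2 * ∂ᵢψ` in mean under the sampled distribution (`sum_abs_vertexPoly_sub_le`).

Closeness in mean must become closeness of coefficients. Flipping one sign changes a probability by
at most the factor `exp (2λ)`, so an `L¹` bound passes to iterated derivatives at this price for
each derivative. The derivative along `I` is the coefficient of `I` plus terms from strict
supersets, and a geometric weighting by degree absorbs the latter
(`MultilinearPoly.l1Norm_le_of_sum_abs_le`). A coefficient of `ψ` is then estimated by averaging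
over the vertices of its monomial (`sum_abs_learnedPoly_sub_le`). The constant coefficient is never
seen, but it cancels in the normalization (`gibbs_le_of_abs_sub_le`), and a uniform error `ε / 4` of
the exponent gives the multiplicative guarantee. The final error is proportional to the square root
of a mean square of order `N ^ (-1/2)`, hence to `N ^ (-1/4)`; this is the source of `n ^ (4t) / ε ^
4`.

For the running time, the monomials for a vertex are indexed by the `t - 1` digits of a number in
base `n`. One digit value means "no variable" and the other `n - 1` are the variables other than the
vertex, so there are exactly `n ^ (t - 1)` indices. The monomial `m` is the monomial `m / n` times
one variable or `1`, so all values are tabulated in constant time each, and a sample costs `O(n ^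
t)`. The correctness of the programs is proved with loop invariants that carry the step count and
the word bound along. -/

/-! ### Monomials and sign flips on the cube -/

namespace Cube

variable {n : ℕ}

/-- The point `x` with the sign of the coordinate `j` changed. -/
def negAt (j : Fin n) (x : Cube n) : Cube n := Function.update x j (-x j)

/-- The value of the monomial `∏ i ∈ I, x i`. -/
noncomputable def mono (I : Finset (Fin n)) (x : Cube n) : ℝ :=
  ∏ i ∈ I, (((x i : ℤˣ) : ℤ) : ℝ)

theorem negAt_apply_self (j : Fin n) (x : Cube n) : negAt j x j = -x j := by simp [negAt]

theorem negAt_apply_of_ne {i j : Fin n} (h : i ≠ j) (x : Cube n) : negAt j x i = x i := by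
  simp [negAt, h]

theorem negAt_negAt (j : Fin n) (x : Cube n) : negAt j (negAt j x) = x := by simp [negAt]

theorem sum_negAt (j : Fin n) (g : Cube n → ℝ) : ∑ x, g (negAt j x) = ∑ x, g x :=
  Equiv.sum_comp (Function.Involutive.toPerm (negAt j) (negAt_negAt j)) g

theorem sum_eq_zero_of_negAt (j : Fin n) {g : Cube n → ℝ} (h : ∀ x, g (negAt j x) = -g x) :
    ∑ x, g x = 0 := by
  have := sum_negAt j g
  simp only [h, Finset.sum_neg_distrib] at this
  linarith

theorem coe_eq_one_or (a : ℤˣ) : ((a : ℤ) : ℝ) = 1 ∨ ((a : ℤ) : ℝ) = -1 := by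
  rcases Int.units_eq_one_or a with rfl | rfl <;> simp

theorem coe_mul_self (a : ℤˣ) : ((a : ℤ) : ℝ) * ((a : ℤ) : ℝ) = 1 := by
  rcases coe_eq_one_or a with h | h <;> rw [h] <;> norm_num

theorem mono_eq_prod_univ (I : Finset (Fin n)) (x : Cube n) :
    mono I x = ∏ i, if i ∈ I then (((x i : ℤˣ) : ℤ) : ℝ) else 1 := by
  simp [mono, Finset.prod_ite_mem]

theorem mono_empty (x : Cube n) : mono ∅ x = 1 := by simp [mono]

theorem mono_singleton (i : Fin n) (x : Cube n) : mono {i} x = ((x i : ℤ) : ℝ) := by simp [mono]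

theorem mono_insert {i : Fin n} {I : Finset (Fin n)} (h : i ∉ I) (x : Cube n) :
    mono (insert i I) x = ((x i : ℤ) : ℝ) * mono I x := by
  simp [mono, Finset.prod_insert h]

theorem mono_symmDiff (I J : Finset (Fin n)) (x : Cube n) :
    mono (symmDiff I J) x = mono I x * mono J x := by
  simp only [mono_eq_prod_univ, ← Finset.prod_mul_distrib]
  refine Finset.prod_congr rfl fun i _ => ?_
  by_cases hI : i ∈ I <;> by_cases hJ : i ∈ J <;>
    simp [Finset.mem_symmDiff, hI, hJ, coe_mul_self]

theorem mono_mul_self (I : Finset (Fin n)) (x : Cube n) : mono I x * mono I x = 1 := by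
  rw [← mono_symmDiff, symmDiff_self]; exact mono_empty x

theorem abs_mono (I : Finset (Fin n)) (x : Cube n) : |mono I x| = 1 := by
  have h := mono_mul_self I x
  rw [← abs_mul_abs_self] at h
  nlinarith [abs_nonneg (mono I x)]

theorem mono_negAt_of_notMem {j : Fin n} {I : Finset (Fin n)} (h : j ∉ I) (x : Cube n) :
    mono I (negAt j x) = mono I x := by
  refine Finset.prod_congr rfl fun i hi => ?_
  rw [negAt_apply_of_ne (fun e : i = j => h (e ▸ hi))]

theorem mono_negAt_of_mem {j : Fin n} {I : Finset (Fin n)} (h : j ∈ I) (x : Cube n) :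
    mono I (negAt j x) = -mono I x := by
  rw [← Finset.insert_erase h, mono_insert (Finset.notMem_erase j I),
    mono_insert (Finset.notMem_erase j I), mono_negAt_of_notMem (Finset.notMem_erase j I),
    negAt_apply_self]
  push_cast
  ring

end Cube

open Cube

namespace MultilinearPoly

variable {n : ℕ}

theorem eval_eq (p : MultilinearPoly n) (x : Cube n) : p.eval x = ∑ I, p I * mono I x := rfl

theorem abs_eval_le (p : MultilinearPoly n) (x : Cube n) : |p.eval x| ≤ p.l1Norm := by
  refine (Finset.abs_sum_le_sum_abs _ _).trans (Finset.sum_le_sum fun I _ => ?_)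
  rw [abs_mul]
  exact (congrArg (|p I| * ·) (abs_mono I x)).le.trans (mul_one _).le

theorem sum_mono_mul_mono (I J : Finset (Fin n)) :
    ∑ x : Cube n, mono I x * mono J x = if I = J then 2 ^ n else 0 := by
  split_ifs with h
  · subst h
    simp [mono_mul_self, Fintype.card_pi]
  · simp only [← mono_symmDiff]
    obtain ⟨j, hj⟩ : (symmDiff I J).Nonempty := by
      rw [Finset.nonempty_iff_ne_empty]
      exact fun e => h (symmDiff_eq_bot.1 e)
    exact sum_eq_zero_of_negAt j fun x => mono_negAt_of_mem hj x

theorem sum_eval_mul_mono (p : MultilinearPoly n) (J : Finset (Fin n)) :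
    ∑ x, p.eval x * mono J x = 2 ^ n * p J := by
  simp only [eval_eq, Finset.sum_mul]
  rw [Finset.sum_comm]
  simp only [mul_assoc, ← Finset.mul_sum, sum_mono_mul_mono]
  simp [mul_comm]

theorem mono_mul_partialDeriv_eval (p : MultilinearPoly n) (i : Fin n) (x : Cube n) :
    ((x i : ℤ) : ℝ) * (p.partialDeriv i).eval x = ∑ I, if i ∈ I then p I * mono I x else 0 := by
  rw [eval_eq, ← Finset.sum_filter, Finset.mul_sum, ← Finset.sum_filter_add_sum_filter_not
    Finset.univ (fun I => i ∈ I)]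
  have h0 : ∑ I ∈ Finset.univ.filter (fun I => i ∈ I),
      ((x i : ℤ) : ℝ) * (p.partialDeriv i I * mono I x) = 0 := by
    refine Finset.sum_eq_zero fun I hI => ?_
    simp [partialDeriv, (Finset.mem_filter.1 hI).2]
  rw [h0, zero_add]
  refine Finset.sum_bij' (fun I _ => insert i I) (fun I _ => I.erase i) ?_ ?_ ?_ ?_ ?_
  · intro I _; simp
  · intro I _; simp
  · intro I hI
    exact Finset.erase_insert (Finset.mem_filter.1 hI).2
  · intro I hI
    exact Finset.insert_erase (Finset.mem_filter.1 hI).2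
  · intro I hI
    have hI := (Finset.mem_filter.1 hI).2
    rw [mono_insert hI]
    simp only [partialDeriv, hI, if_false]
    ring

theorem eval_sub_eval_negAt (p : MultilinearPoly n) (i : Fin n) (x : Cube n) :
    p.eval x - p.eval (negAt i x) = 2 * (((x i : ℤ) : ℝ) * (p.partialDeriv i).eval x) := by
  rw [mono_mul_partialDeriv_eval, eval_eq, eval_eq, ← Finset.sum_sub_distrib, Finset.mul_sum]
  refine Finset.sum_congr rfl fun I _ => ?_
  split_ifs with h
  · rw [mono_negAt_of_mem h]; ring
  · rw [mono_negAt_of_notMem h]; ring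

/-- A derivative is a combination of two neighbouring values of `p`; this is what lets bounds in
mean pass from `p` to its derivatives. -/
theorem partialDeriv_eval (p : MultilinearPoly n) (i : Fin n) (x : Cube n) :
    (p.partialDeriv i).eval x = ((x i : ℤ) : ℝ) * ((p.eval x - p.eval (negAt i x)) / 2) := by
  rw [eval_sub_eval_negAt, mul_div_cancel_left₀ _ two_ne_zero, ← mul_assoc, coe_mul_self, one_mul]

theorem partialDeriv_eval_negAt (p : MultilinearPoly n) (i : Fin n) (x : Cube n) :
    (p.partialDeriv i).eval (negAt i x) = (p.partialDeriv i).eval x := by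
  rw [partialDeriv_eval, partialDeriv_eval, negAt_negAt, negAt_apply_self]
  push_cast
  ring

/-- The iterated derivative with respect to all the variables in `I`. -/
noncomputable def derivSet (I : Finset (Fin n)) (p : MultilinearPoly n) : MultilinearPoly n :=
  fun J => if Disjoint I J then p (I ∪ J) else 0

theorem derivSet_empty (p : MultilinearPoly n) : p.derivSet ∅ = p := by
  funext J; simp [derivSet]

theorem derivSet_insert {I : Finset (Fin n)} {j : Fin n} (hj : j ∉ I) (p : MultilinearPoly n) :
    p.derivSet (insert j I) = (p.derivSet I).partialDeriv j := by
  funext J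
  by_cases h : j ∈ J
  · simp [derivSet, partialDeriv, h]
  · simp [derivSet, partialDeriv, h, hj]

/-- If `w` changes by at most the factor `δ` under sign flips, then a weighted `L¹` bound for `p`
gives one for its derivatives. -/
theorem sum_abs_derivSet_le {w : Cube n → ℝ} {δ κ : ℝ} (hw : ∀ x, 0 ≤ w x) (hδ : 1 ≤ δ)
    (hflip : ∀ j x, w (negAt j x) ≤ δ * w x) (p : MultilinearPoly n)
    (hp : ∑ x, w x * |p.eval x| ≤ κ) (I : Finset (Fin n)) :
    ∑ x, w x * |(p.derivSet I).eval x| ≤ δ ^ I.card * κ := by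
  induction I using Finset.induction_on with
  | empty => simpa [derivSet_empty] using hp
  | insert j I hj ih =>
    rw [derivSet_insert hj, Finset.card_insert_of_notMem hj, pow_succ]
    set q := p.derivSet I
    have h1 : ∀ x, w x * |(q.partialDeriv j).eval x|
        ≤ (w x * |q.eval x| + w x * |q.eval (negAt j x)|) / 2 := by
      intro x
      rw [partialDeriv_eval, abs_mul, abs_div, abs_two]
      have : |((x j : ℤ) : ℝ)| = 1 := by rcases coe_eq_one_or (x j) with h | h <;> rw [h] <;> simp
      rw [this, one_mul, ← mul_add, mul_div_assoc]
      exact mul_le_mul_of_nonneg_left (by linarith [abs_sub (q.eval x) (q.eval (negAt j x))]) (hw x)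
    have h2 : ∑ x, w x * |q.eval (negAt j x)| ≤ δ * ∑ x, w x * |q.eval x| := by
      rw [← sum_negAt j (fun x => w x * |q.eval (negAt j x)|), Finset.mul_sum]
      refine Finset.sum_le_sum fun x _ => ?_
      rw [negAt_negAt, ← mul_assoc]
      exact mul_le_mul_of_nonneg_right (hflip j x) (abs_nonneg _)
    have h3 : 0 ≤ ∑ x, w x * |q.eval x| :=
      Finset.sum_nonneg fun x _ => mul_nonneg (hw x) (abs_nonneg _)
    calc ∑ x, w x * |(q.partialDeriv j).eval x|
        ≤ ∑ x, (w x * |q.eval x| + w x * |q.eval (negAt j x)|) / 2 :=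
          Finset.sum_le_sum fun x _ => h1 x
      _ = (∑ x, w x * |q.eval x| + ∑ x, w x * |q.eval (negAt j x)|) / 2 := by
          rw [← Finset.sum_add_distrib, Finset.sum_div]
      _ ≤ δ * ∑ x, w x * |q.eval x| := by nlinarith
      _ ≤ δ * (δ ^ I.card * κ) := by gcongr
      _ = δ ^ I.card * δ * κ := by ring

/-- The supersets of `I` are the disjoint unions with `I`. The summand for `I` itself is split off
because it is the coefficient to be bounded. -/
theorem derivSet_eval_eq (p : MultilinearPoly n) (I : Finset (Fin n)) (x : Cube n) :
    (p.derivSet I).eval x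
      = p I + ∑ J ∈ Finset.univ.filter (fun J => I ⊂ J), p J * mono (J \ I) x := by
  have h : (p.derivSet I).eval x = ∑ J ∈ Finset.univ.filter (fun J => I ⊆ J), p J * mono (J \ I) x := by
    rw [eval_eq, ← Finset.sum_filter_add_sum_filter_not Finset.univ (fun J => Disjoint I J)]
    rw [Finset.sum_eq_zero (s := Finset.univ.filter fun J => ¬ Disjoint I J), add_zero]
    · refine Finset.sum_bij' (fun J _ => I ∪ J) (fun J _ => J \ I) ?_ ?_ ?_ ?_ ?_
      · intro J _; simp
      · intro J _; simp [Finset.disjoint_sdiff]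
      · intro J hJ
        exact Finset.union_sdiff_cancel_left (Finset.mem_filter.1 hJ).2
      · intro J hJ
        exact Finset.union_sdiff_of_subset (Finset.mem_filter.1 hJ).2
      · intro J hJ
        have hJ := (Finset.mem_filter.1 hJ).2
        rw [Finset.union_sdiff_cancel_left hJ]
        simp [derivSet, hJ]
    · intro J hJ
      simp [derivSet, (Finset.mem_filter.1 hJ).2]
  rw [h]
  have h2 : Finset.univ.filter (fun J => I ⊆ J)
      = insert I (Finset.univ.filter (fun J => I ⊂ J)) := by
    ext J
    simp only [Finset.mem_filter, Finset.mem_univ, true_and, Finset.mem_insert]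
    constructor
    · intro h
      rcases eq_or_ssubset_of_subset h with h | h
      · exact Or.inl h.symm
      · exact Or.inr h
    · rintro (rfl | h)
      · exact subset_rfl
      · exact h.subset
  rw [h2, Finset.sum_insert (by simp), Finset.sdiff_self, mono_empty, mul_one]

/-- At every point the derivative along `I` differs from the coefficient of `I` by at most the
coefficients of the strict supersets; averaging against the probability weight `w` gives the bound.
-/
theorem abs_coeff_le {w : Cube n → ℝ} {δ κ : ℝ} (hw : ∀ x, 0 ≤ w x) (hw1 : ∑ x, w x = 1)
    (hδ : 1 ≤ δ) (hflip : ∀ j x, w (negAt j x) ≤ δ * w x) (p : MultilinearPoly n)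
    (hp : ∑ x, w x * |p.eval x| ≤ κ) (I : Finset (Fin n)) :
    |p I| ≤ δ ^ I.card * κ + ∑ J ∈ Finset.univ.filter (fun J => I ⊂ J), |p J| := by
  have h := sum_abs_derivSet_le hw hδ hflip p hp I
  have h1 : ∀ x, |p I| - ∑ J ∈ Finset.univ.filter (fun J => I ⊂ J), |p J|
      ≤ |(p.derivSet I).eval x| := by
    intro x
    have h2 : |∑ J ∈ Finset.univ.filter (fun J => I ⊂ J), p J * mono (J \ I) x|
        ≤ ∑ J ∈ Finset.univ.filter (fun J => I ⊂ J), |p J| := by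
      refine (Finset.abs_sum_le_sum_abs _ _).trans (Finset.sum_le_sum fun J _ => ?_)
      rw [abs_mul, abs_mono, mul_one]
    have h3 := abs_sub (((p.derivSet I).eval x))
      (∑ J ∈ Finset.univ.filter (fun J => I ⊂ J), p J * mono (J \ I) x)
    rw [derivSet_eval_eq] at h3 ⊢
    rw [add_sub_cancel_right] at h3
    linarith
  have h4 : ∑ x, w x * (|p I| - ∑ J ∈ Finset.univ.filter (fun J => I ⊂ J), |p J|)
      ≤ ∑ x, w x * |(p.derivSet I).eval x| :=
    Finset.sum_le_sum fun x _ => mul_le_mul_of_nonneg_left (h1 x) (hw x)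
  rw [← Finset.sum_mul, hw1, one_mul] at h4
  linarith

/-- An `L¹` bound for a low-degree polynomial, with respect to a weight that is stable under sign
flips, bounds the sum of the absolute values of its coefficients. -/
theorem l1Norm_le_of_sum_abs_le {w : Cube n → ℝ} {δ κ : ℝ} (hw : ∀ x, 0 ≤ w x)
    (hw1 : ∑ x, w x = 1) (hδ : 1 ≤ δ) (hflip : ∀ j x, w (negAt j x) ≤ δ * w x)
    (p : MultilinearPoly n) (hp : ∑ x, w x * |p.eval x| ≤ κ) (t : ℕ)
    (F : Finset (Finset (Fin n))) (hF : ∀ I, p I ≠ 0 → I ∈ F)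
    (hFt : ∀ I ∈ F, I.card + 1 ≤ t) :
    p.l1Norm ≤ 3 * F.card * ((2 * t) ^ (t - 1) * δ ^ (t - 1) * κ) := by
  have hκ : 0 ≤ κ := le_trans (Finset.sum_nonneg fun x _ => mul_nonneg (hw x) (abs_nonneg _)) hp
  have hl1 : p.l1Norm = ∑ I ∈ F, |p I| := by
    refine (Finset.sum_subset (Finset.subset_univ F) fun I _ hI => ?_).symm
    by_contra h
    exact hI (hF I fun e => h (by simp [e]))
  rcases F.eq_empty_or_nonempty with rfl | ⟨I₀, hI₀⟩
  · rw [hl1]; simp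
  have ht : 1 ≤ t := le_trans (by omega) (hFt I₀ hI₀)
  have htR : (1 : ℝ) ≤ t := by exact_mod_cast ht
  -- Weighting degree `d` by `s ^ d` makes a coefficient of `J` outweigh everything that it
  -- contributes to the bounds for its strict subsets.
  set s : ℝ := 2 * t with hs
  have hs1 : 1 ≤ s := by linarith
  have hs0 : 0 < s := by linarith
  -- the weighted sum of the coefficients
  set T := ∑ I ∈ F, s ^ I.card * |p I| with hT
  have hT0 : 0 ≤ T := Finset.sum_nonneg fun I _ => by positivity
  have h1 : T ≤ ∑ I ∈ F, s ^ I.card * (δ ^ I.card * κ)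
      + ∑ I ∈ F, ∑ J ∈ F.filter (fun J => I ⊂ J), s ^ I.card * |p J| := by
    rw [← Finset.sum_add_distrib]
    refine Finset.sum_le_sum fun I hI => ?_
    rw [← Finset.mul_sum, ← mul_add]
    refine mul_le_mul_of_nonneg_left ?_ (by positivity)
    refine (abs_coeff_le hw hw1 hδ hflip p hp I).trans (add_le_add_right (le_of_eq ?_) _)
    refine (Finset.sum_subset (Finset.filter_subset_filter _ (Finset.subset_univ F)) ?_).symm
    intro J hJ hJ'
    by_contra h
    exact hJ' (Finset.mem_filter.2 ⟨hF J fun e => h (by simp [e]), (Finset.mem_filter.1 hJ).2⟩)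
  have h2 : ∑ I ∈ F, s ^ I.card * (δ ^ I.card * κ)
      ≤ F.card * (s ^ (t - 1) * δ ^ (t - 1) * κ) := by
    rw [← nsmul_eq_mul]
    refine Finset.sum_le_card_nsmul _ _ _ fun I hI => ?_
    have hc : I.card ≤ t - 1 := by have := hFt I hI; omega
    rw [← mul_assoc]
    refine mul_le_mul_of_nonneg_right ?_ hκ
    exact mul_le_mul (pow_le_pow_right₀ hs1 hc) (pow_le_pow_right₀ hδ hc) (by positivity)
      (by positivity)
  -- For fixed `J`, the weights of its strict subsets sum to `(s + 1) ^ |J| - s ^ |J|`. As `|J| < t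
  -- = s / 2`, this is at most `(exp (1/2) - 1) * s ^ |J|`, and `exp (1/2) ≤ 33/20`. The factor
  -- `13/20 < 2/3` lets `T` be absorbed at the price of a factor `3`.
  have h3 : ∑ I ∈ F, ∑ J ∈ F.filter (fun J => I ⊂ J), s ^ I.card * |p J|
      ≤ 13 / 20 * T := by
    have hcomm : ∑ I ∈ F, ∑ J ∈ F.filter (fun J => I ⊂ J), s ^ I.card * |p J|
        = ∑ J ∈ F, ∑ I ∈ F.filter (fun I => I ⊂ J), s ^ I.card * |p J| := by
      simp only [Finset.sum_filter]
      exact Finset.sum_comm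
    rw [hcomm, hT, Finset.mul_sum]
    refine Finset.sum_le_sum fun J hJ => ?_
    rw [← Finset.sum_mul, ← mul_assoc]
    refine mul_le_mul_of_nonneg_right ?_ (abs_nonneg _)
    have h4 : ∑ I ∈ F.filter (fun I => I ⊂ J), s ^ I.card ≤ ∑ I ∈ J.ssubsets, s ^ I.card :=
      Finset.sum_le_sum_of_subset_of_nonneg
        (fun I hI => Finset.mem_ssubsets.2 (Finset.mem_filter.1 hI).2) fun _ _ _ => by positivity
    have h5 : ∑ I ∈ J.powerset, s ^ I.card = (s + 1) ^ J.card := by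
      simpa using Finset.sum_pow_mul_eq_add_pow s 1 J
    have h6 : ∑ I ∈ J.ssubsets, s ^ I.card + s ^ J.card = ∑ I ∈ J.powerset, s ^ I.card := by
      rw [Finset.ssubsets]
      exact Finset.sum_erase_add _ _ (Finset.mem_powerset_self J)
    have h7 : (s + 1) ^ J.card ≤ s ^ J.card * (33 / 20) := by
      have e : (s + 1) ^ J.card = s ^ J.card * (1 + 1 / s) ^ J.card := by
        rw [← mul_pow]; congr 1; field_simp
      rw [e]
      refine mul_le_mul_of_nonneg_left ?_ (by positivity)
      have a1 : (1 + 1 / s) ^ J.card ≤ Real.exp (1 / s) ^ J.card := by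
        refine pow_le_pow_left₀ (by positivity) ?_ _
        linarith [Real.add_one_le_exp (1 / s)]
      rw [← Real.exp_nat_mul] at a1
      have a2 : (J.card : ℝ) * (1 / s) ≤ 1 / 2 := by
        rw [mul_one_div, div_le_iff₀ hs0, hs]
        have : ((J.card + 1 : ℕ) : ℝ) ≤ t := by exact_mod_cast hFt J hJ
        push_cast at this
        linarith
      have a3 : Real.exp (1 / 2) ≤ 33 / 20 := by
        have b1 : Real.exp (1 / 2) ^ 2 = Real.exp 1 := by rw [← Real.exp_nat_mul]; norm_num
        have b2 := Real.exp_one_lt_d9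
        nlinarith [Real.exp_pos (1 / 2)]
      exact a1.trans ((Real.exp_le_exp.2 a2).trans a3)
    linarith
  have h8 : T ≤ 3 * (F.card * (s ^ (t - 1) * δ ^ (t - 1) * κ)) := by linarith
  have h9 : p.l1Norm ≤ T := by
    rw [hl1]
    refine Finset.sum_le_sum fun I _ => ?_
    exact le_mul_of_one_le_left (abs_nonneg _) (one_le_pow₀ hs1)
  calc p.l1Norm ≤ T := h9
    _ ≤ _ := h8
    _ = _ := by ring

end MultilinearPoly

/-! ### Markov random fields -/

section MRF

variable {n t : ℕ} {G : SimpleGraph (Fin n)} {ψ : MultilinearPoly n} {D : PMF (Cube n)}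

/-- The definition constrains only the values of `ψ`, so the coefficient is recovered by
orthogonality. Every clique `I` misses some `j ∈ J`; flipping `j` fixes `ψ_I` and negates the
monomial. -/
theorem IsMRF.coeff_eq_zero (h : IsMRF t G ψ D) {J : Finset (Fin n)} (hJ : t < J.card) :
    ψ J = 0 := by
  obtain ⟨S, ψI, hS, hdep, hψ, -⟩ := h
  have h1 : ∑ x, ψ.eval x * mono J x = 0 := by
    simp only [hψ, Finset.sum_mul]
    rw [Finset.sum_comm]
    refine Finset.sum_eq_zero fun I hI => ?_
    obtain ⟨j, hjJ, hjI⟩ : ∃ j ∈ J, j ∉ I := by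
      by_contra! hc
      exact absurd (Finset.card_le_card fun j hj => hc j hj) (by have := (hS I hI).2; omega)
    refine sum_eq_zero_of_negAt j fun x => ?_
    rw [mono_negAt_of_mem hjJ, hdep I hI fun i hi =>
      negAt_apply_of_ne (fun e => hjI (by rw [← e]; exact hi)) x]
    ring
  rw [MultilinearPoly.sum_eval_mul_mono] at h1
  exact (mul_eq_zero.1 h1).resolve_left (by positivity)

theorem PMF.sum_toReal_eq_one {α : Type*} [Fintype α] (D : PMF α) :
    ∑ x, (D x).toReal = 1 := by
  rw [← ENNReal.toReal_sum fun x _ => D.apply_ne_top x, ← tsum_fintype (L := .unconditional α), D.tsum_coe,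
    ENNReal.toReal_one]

/-- A flip changes the exponent by `2 * x_j * ∂ⱼψ`, up to sign. This is the stability that the
passage from `L¹` bounds to coefficients needs. -/
theorem IsMRF.negAt_le (h : IsMRF t G ψ D) {lam : ℝ}
    (hlam : ∀ i : Fin n, (ψ.partialDeriv i).l1Norm ≤ lam) (j : Fin n) (x : Cube n) :
    (D (negAt j x)).toReal ≤ Real.exp (2 * lam) * (D x).toReal := by
  obtain ⟨S, ψI, hS, hdep, hψ, c, hc, hD⟩ := h
  have h1 := ψ.eval_sub_eval_negAt j x
  have h2 := ((ψ.partialDeriv j).abs_eval_le x).trans (hlam j)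
  rw [hD, hD, mul_left_comm, ← Real.exp_add]
  refine mul_le_mul_of_nonneg_left (Real.exp_le_exp.2 ?_) hc.le
  rcases coe_eq_one_or (x j) with h | h <;> rw [h] at h1 <;>
    linarith [abs_le.1 h2]

/-- The logistic function. -/
noncomputable def logistic (z : ℝ) : ℝ := 1 / (1 + Real.exp (-z))

/-- Given the other coordinates, the coordinate `i` of a Markov random field is `1` with
probability `logistic (2 * ∂ᵢψ)`. -/
theorem IsMRF.sum_logistic_sub (h : IsMRF t G ψ D) (i : Fin n) {u : Cube n → ℝ}
    (hu : ∀ x, u (negAt i x) = u x) :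
    ∑ x, (D x).toReal * ((logistic (2 * (ψ.partialDeriv i).eval x)
      - (((x i : ℤ) : ℝ) + 1) / 2) * u x) = 0 := by
  obtain ⟨S, ψI, hS, hdep, hψ, c, hc, hD⟩ := h
  -- The terms of `x` and of its flip cancel: `u` and the derivative agree at both points, and the
  -- ratio of the probabilities is `exp (2 * x_i * ∂ᵢψ)`.
  refine sum_eq_zero_of_negAt i fun x => ?_
  have h1 := ψ.eval_sub_eval_negAt i x
  rw [hD, hD, hu, ψ.partialDeriv_eval_negAt, negAt_apply_self]
  set d := (ψ.partialDeriv i).eval x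
  have h2 : ψ.eval (negAt i x) = ψ.eval x - 2 * (((x i : ℤ) : ℝ) * d) := by linarith
  rw [h2, Real.exp_sub]
  push_cast
  have hp := Real.exp_pos (ψ.eval x)
  have h3 : Real.exp (-(2 * d)) = (Real.exp (2 * d))⁻¹ := Real.exp_neg _
  have hq := Real.exp_pos (2 * d)
  rcases coe_eq_one_or (x i) with h | h <;> rw [h] <;> simp only [logistic]
  · rw [one_mul, h3]
    field_simp
    ring
  · rw [show 2 * (-1 * d) = -(2 * d) by ring, h3]
    field_simp
    ring

end MRF

/-! ### Multiplicative weights -/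

section Hedge

/-- The sum of the weights of the experts `±m`, `m < M`, after the cumulative losses `± L m`. -/
noncomputable def hedgePotential (M : ℕ) (η : ℝ) (L : ℕ → ℝ) : ℝ :=
  ∑ m ∈ Finset.range M, (Real.exp (-(η * L m)) + Real.exp (η * L m))

/-- The difference of the probabilities of the experts `m` and `-m`. -/
noncomputable def hedgeWeight (M : ℕ) (η : ℝ) (L : ℕ → ℝ) (m : ℕ) : ℝ :=
  (Real.exp (-(η * L m)) - Real.exp (η * L m)) / hedgePotential M η L

theorem hedgePotential_pos {M : ℕ} (hM : 0 < M) (η : ℝ) (L : ℕ → ℝ) : 0 < hedgePotential M η L :=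
  Finset.sum_pos (fun m _ => add_pos (Real.exp_pos _) (Real.exp_pos _)) ⟨0, by simpa using hM⟩

theorem sum_abs_hedgeWeight_le {M : ℕ} (hM : 0 < M) (η : ℝ) (L : ℕ → ℝ) :
    ∑ m ∈ Finset.range M, |hedgeWeight M η L m| ≤ 1 := by
  have hp := hedgePotential_pos hM η L
  simp only [hedgeWeight, abs_div, abs_of_pos hp]
  rw [← Finset.sum_div, div_le_one hp]
  refine Finset.sum_le_sum fun m _ => (abs_sub _ _).trans ?_
  rw [Real.abs_exp, Real.abs_exp]

theorem exp_le_one_add_add_sq {x : ℝ} (hx : |x| ≤ 1) : Real.exp x ≤ 1 + x + x ^ 2 := by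
  have := Real.abs_exp_sub_one_sub_id_le hx
  linarith [(abs_le.1 this).2]

/-- Apply `exp x ≤ 1 + x + x ^ 2` to both experts `±m`. The linear terms combine to the loss of the
weighted prediction, and the quadratic ones are at most `η ^ 2` times the potential. -/
theorem hedgePotential_update_le {M : ℕ} (hM : 0 < M) {η g : ℝ} (hη : 0 ≤ η) (hη1 : η ≤ 1)
    (hg : |g| ≤ 1) {f L : ℕ → ℝ} (hf : ∀ m < M, |f m| ≤ 1) :
    hedgePotential M η (fun m => L m + g * f m) ≤ hedgePotential M η L *
      Real.exp (η ^ 2 - η * (g * ∑ m ∈ Finset.range M, hedgeWeight M η L m * f m)) := by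
  have hp := hedgePotential_pos hM η L
  have h1 : hedgePotential M η (fun m => L m + g * f m) ≤ ∑ m ∈ Finset.range M,
      ((1 + η ^ 2) * (Real.exp (-(η * L m)) + Real.exp (η * L m))
        - η * (g * ((Real.exp (-(η * L m)) - Real.exp (η * L m)) * f m))) := by
    refine Finset.sum_le_sum fun m hm => ?_
    have hgf : |g * f m| ≤ 1 := by
      rw [abs_mul]; exact mul_le_one₀ hg (abs_nonneg _) (hf m (Finset.mem_range.1 hm))
    have hx : |η * (g * f m)| ≤ 1 := by
      rw [abs_mul, abs_of_nonneg hη]; exact mul_le_one₀ hη1 (abs_nonneg _) hgf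
    have hsq : (η * (g * f m)) ^ 2 ≤ η ^ 2 := by
      rw [mul_pow]
      exact mul_le_of_le_one_right (sq_nonneg _) ((sq_le_one_iff_abs_le_one _).2 hgf)
    have e1 := exp_le_one_add_add_sq hx
    have e2 := exp_le_one_add_add_sq (x := -(η * (g * f m))) (by rwa [abs_neg])
    rw [show -(η * (L m + g * f m)) = -(η * L m) + -(η * (g * f m)) by ring,
      show η * (L m + g * f m) = η * L m + η * (g * f m) by ring, Real.exp_add, Real.exp_add]
    have p1 := Real.exp_pos (-(η * L m))
    have p2 := Real.exp_pos (η * L m)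
    have q1 : Real.exp (-(η * L m)) * Real.exp (-(η * (g * f m)))
        ≤ Real.exp (-(η * L m)) * (1 + -(η * (g * f m)) + η ^ 2) :=
      mul_le_mul_of_nonneg_left (by linarith) p1.le
    have q2 : Real.exp (η * L m) * Real.exp (η * (g * f m))
        ≤ Real.exp (η * L m) * (1 + η * (g * f m) + η ^ 2) :=
      mul_le_mul_of_nonneg_left (by linarith) p2.le
    linarith
  rw [Finset.sum_sub_distrib, ← Finset.mul_sum, ← Finset.mul_sum, ← Finset.mul_sum] at h1
  have h2 : ∑ m ∈ Finset.range M, (Real.exp (-(η * L m)) - Real.exp (η * L m)) * f m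
      = hedgePotential M η L * ∑ m ∈ Finset.range M, hedgeWeight M η L m * f m := by
    rw [Finset.mul_sum]
    refine Finset.sum_congr rfl fun m _ => ?_
    rw [hedgeWeight]
    field_simp
  rw [h2] at h1
  have h3 := Real.add_one_le_exp
    (η ^ 2 - η * (g * ∑ m ∈ Finset.range M, hedgeWeight M η L m * f m))
  refine h1.trans (le_trans (le_of_eq ?_) (mul_le_mul_of_nonneg_left h3 hp.le))
  rw [← hedgePotential]
  ring

/-- The regret bound of the multiplicative weights method, against a linear comparator. -/
theorem hedge_regret {M N : ℕ} (hM : 0 < M) {η B : ℝ} (hη : 0 < η) (hη1 : η ≤ 1)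
    {g : ℕ → ℝ} {f L : ℕ → ℕ → ℝ} (hg : ∀ j < N, |g j| ≤ 1) (hf : ∀ j < N, ∀ m < M, |f j m| ≤ 1)
    (hL0 : ∀ m, L 0 m = 0) (hL : ∀ j < N, ∀ m < M, L (j + 1) m = L j m + g j * f j m)
    {c : ℕ → ℝ} (hc : ∑ m ∈ Finset.range M, |c m| ≤ B) :
    ∑ j ∈ Finset.range N, g j * (B * ∑ m ∈ Finset.range M, hedgeWeight M η (L j) m * f j m
      - ∑ m ∈ Finset.range M, c m * f j m) ≤ B * (Real.log (2 * M) / η + N * η) := by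
  set S : ℕ → ℝ := fun k => ∑ j ∈ Finset.range k,
    g j * ∑ m ∈ Finset.range M, hedgeWeight M η (L j) m * f j m with hS
  have hB : 0 ≤ B := le_trans (Finset.sum_nonneg fun m _ => abs_nonneg _) hc
  have hM' : (0 : ℝ) < M := by exact_mod_cast hM
  have h1 : ∀ k ≤ N, hedgePotential M η (L k) ≤ 2 * M * Real.exp (k * η ^ 2 - η * S k) := by
    intro k
    induction k with
    | zero =>
      intro _
      simp only [hedgePotential, hL0, hS]
      simp
      linarith
    | succ k ih =>
      intro hk
      have e : hedgePotential M η (L (k + 1))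
          = hedgePotential M η (fun m => L k m + g k * f k m) := by
        refine Finset.sum_congr rfl fun m hm => ?_
        rw [hL k (by omega) m (Finset.mem_range.1 hm)]
      rw [e]
      refine (hedgePotential_update_le hM hη.le hη1 (hg k (by omega)) (hf k (by omega))).trans ?_
      refine (mul_le_mul_of_nonneg_right (ih (by omega)) (Real.exp_pos _).le).trans (le_of_eq ?_)
      rw [mul_assoc, ← Real.exp_add, hS]
      simp only [Finset.sum_range_succ]
      congr 2
      push_cast
      ring
  -- One of the two experts `±m` contributes `exp (η * |L N m|)` to the final potential, which `h1`
  -- bounds from above.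
  have h2 : ∀ m < M, η * |L N m| ≤ Real.log (2 * M) + N * η ^ 2 - η * S N := by
    intro m hm
    have a1 : Real.exp (η * |L N m|) ≤ hedgePotential M η (L N) := by
      refine le_trans ?_ (Finset.single_le_sum
        (f := fun m => Real.exp (-(η * L N m)) + Real.exp (η * L N m))
        (fun m _ => (add_pos (Real.exp_pos _) (Real.exp_pos _)).le) (Finset.mem_range.2 hm))
      rcases abs_cases (L N m) with ⟨h, -⟩ | ⟨h, -⟩ <;> rw [h]
      · linarith [Real.exp_pos (-(η * L N m))]
      · rw [mul_neg]; linarith [Real.exp_pos (η * L N m)]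
    have a2 := a1.trans (h1 N le_rfl)
    rw [show 2 * (M : ℝ) = Real.exp (Real.log (2 * M)) by rw [Real.exp_log (by positivity)],
      ← Real.exp_add, Real.exp_le_exp] at a2
    linarith
  set A := (Real.log (2 * M) + N * η ^ 2 - η * S N) / η with hA
  have h3 : ∀ m < M, |L N m| ≤ A := fun m hm => by
    rw [hA, le_div_iff₀ hη, mul_comm]; exact h2 m hm
  have hA0 : 0 ≤ A := (abs_nonneg _).trans (h3 0 hM)
  have h4 : ∀ k ≤ N, ∀ m < M, L k m = ∑ j ∈ Finset.range k, g j * f j m := by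
    intro k
    induction k with
    | zero => intro _ m _; simp [hL0]
    | succ k ih =>
      intro hk m hm
      rw [Finset.sum_range_succ, hL k (by omega) m hm, ih (by omega) m hm]
  have h5 : ∑ j ∈ Finset.range N, g j * (B * ∑ m ∈ Finset.range M, hedgeWeight M η (L j) m * f j m
      - ∑ m ∈ Finset.range M, c m * f j m) = B * S N - ∑ m ∈ Finset.range M, c m * L N m := by
    have : ∑ m ∈ Finset.range M, c m * L N m
        = ∑ j ∈ Finset.range N, g j * ∑ m ∈ Finset.range M, c m * f j m := by
      rw [Finset.sum_congr rfl fun m hm =>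
        congrArg (c m * ·) (h4 N le_rfl m (Finset.mem_range.1 hm))]
      simp only [Finset.mul_sum]
      rw [Finset.sum_comm]
      exact Finset.sum_congr rfl fun _ _ => Finset.sum_congr rfl fun _ _ => by ring
    rw [this, hS, Finset.mul_sum, ← Finset.sum_sub_distrib]
    exact Finset.sum_congr rfl fun _ _ => by ring
  -- Both signs are among the experts, so the uniform bound on the cumulative losses handles every
  -- comparator of norm at most `B` by Hölder's inequality.
  have h6 : -∑ m ∈ Finset.range M, c m * L N m ≤ B * A := by
    rw [← Finset.sum_neg_distrib]
    calc ∑ m ∈ Finset.range M, -(c m * L N m) ≤ ∑ m ∈ Finset.range M, |c m| * A := by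
          refine Finset.sum_le_sum fun m hm => ?_
          refine (neg_le_abs _).trans ?_
          rw [abs_mul]
          exact mul_le_mul_of_nonneg_left (h3 m (Finset.mem_range.1 hm)) (abs_nonneg _)
      _ ≤ B * A := by
          rw [← Finset.sum_mul]; exact mul_le_mul_of_nonneg_right hc hA0
  rw [h5]
  have h7 : A = Real.log (2 * M) / η + N * η - S N := by rw [hA]; field_simp
  rw [h7] at h6
  linarith

end Hedge

/-! ### Concentration for state machines driven by independent inputs -/

section Trajectory

variable {S α : Type*}

/-- The state after the first `j` inputs. -/
def trajectory (step : S → α → S) (s₀ : S) {N : ℕ} (Z : Fin N → α) : ℕ → S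
  | 0 => s₀
  | j + 1 => if h : j < N then step (trajectory step s₀ Z j) (Z ⟨j, h⟩)
      else trajectory step s₀ Z j

theorem trajectory_succ (step : S → α → S) (s₀ : S) {N : ℕ} (Z : Fin N → α) (j : Fin N) :
    trajectory step s₀ Z (j + 1) = step (trajectory step s₀ Z j) (Z j) := by
  simp [trajectory]

theorem trajectory_cons (step : S → α → S) (s₀ : S) {N : ℕ} (z : α) (Z : Fin N → α) (j : ℕ) :
    trajectory step s₀ (Fin.cons z Z : Fin (N + 1) → α) (j + 1)
      = trajectory step (step s₀ z) Z j := by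
  induction j with
  | zero => simp [trajectory]
  | succ j ih =>
    rw [trajectory, ih, trajectory]
    by_cases h : j < N
    · rw [dif_pos (by omega), dif_pos h]
      congr 1
    · rw [dif_neg (by omega), dif_neg h]

/-- The supermartingale argument, with expectations as finite sums. The first input is peeled off
instead of the last, so the induction runs over all initial states. -/
theorem sum_prod_mul_exp_le [Fintype α] {w : α → ℝ} (hw : ∀ a, 0 ≤ w a) (step : S → α → S)
    {X : S → α → ℝ} {c : ℝ} (hX : ∀ s, ∑ a, w a * Real.exp (X s a) ≤ c) (N : ℕ) (s₀ : S) :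
    ∑ Z : Fin N → α, (∏ j, w (Z j)) *
      Real.exp (∑ j : Fin N, X (trajectory step s₀ Z j) (Z j)) ≤ c ^ N := by
  induction N generalizing s₀ with
  | zero => simp
  | succ N ih =>
    have hc : 0 ≤ c := le_trans (Finset.sum_nonneg fun a _ =>
      mul_nonneg (hw a) (Real.exp_pos _).le) (hX s₀)
    rw [← (Fin.consEquiv fun _ => α).sum_comp, Fintype.sum_prod_type]
    have h1 : ∀ (z : α) (Z : Fin N → α),
        (∏ j, w ((Fin.cons z Z : Fin (N + 1) → α) j)) * Real.exp (∑ j : Fin (N + 1),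
          X (trajectory step s₀ (Fin.cons z Z : Fin (N + 1) → α) j)
            ((Fin.cons z Z : Fin (N + 1) → α) j))
        = w z * Real.exp (X s₀ z) * ((∏ j, w (Z j)) *
          Real.exp (∑ j : Fin N, X (trajectory step (step s₀ z) Z j) (Z j))) := by
      intro z Z
      rw [Fin.prod_univ_succ, Fin.sum_univ_succ]
      simp only [Fin.cons_zero, Fin.cons_succ, Fin.val_succ, trajectory_cons, Real.exp_add]
      simp only [Fin.val_zero, trajectory]
      ring
    calc _ = ∑ z, ∑ Z : Fin N → α, w z * Real.exp (X s₀ z) * ((∏ j, w (Z j)) *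
          Real.exp (∑ j : Fin N, X (trajectory step (step s₀ z) Z j) (Z j))) :=
          Finset.sum_congr rfl fun z _ => Finset.sum_congr rfl fun Z _ => h1 z Z
      _ ≤ ∑ z, w z * Real.exp (X s₀ z) * c ^ N := by
          refine Finset.sum_le_sum fun z _ => ?_
          rw [← Finset.mul_sum]
          exact mul_le_mul_of_nonneg_left (ih _) (mul_nonneg (hw z) (Real.exp_pos _).le)
      _ ≤ c ^ (N + 1) := by
          rw [← Finset.sum_mul, pow_succ']
          exact mul_le_mul_of_nonneg_right (hX s₀) (by positivity)

/-- An Azuma inequality: the sum of the deviations of bounded functions of the state and the next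
input from their conditional means exceeds `2 * B * √(N * ℓ)` with probability at most
`exp (-ℓ)`. -/
theorem azuma_trajectory [Fintype α] {w : α → ℝ} (hw : ∀ a, 0 ≤ w a) (hw1 : ∑ a, w a = 1)
    (step : S → α → S) (s₀ : S) {Q : S → α → ℝ} {B ℓ : ℝ} (hB : 0 < B) (hQ : ∀ s a, |Q s a| ≤ B)
    {N : ℕ} (hℓ : 0 ≤ ℓ) (hN : 0 < N) (hℓN : ℓ ≤ N) :
    ∑ Z : Fin N → α, (∏ j, w (Z j)) *
      (if 4 * B * √(N * ℓ) ≤ ∑ j : Fin N, (∑ a, w a * Q (trajectory step s₀ Z j) a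
        - Q (trajectory step s₀ Z j) (Z j)) then 1 else 0) ≤ Real.exp (-ℓ) := by
  have hN' : (0 : ℝ) < N := by exact_mod_cast hN
  set r := √(N * ℓ) with hr
  have hr2 : r ^ 2 = N * ℓ := Real.sq_sqrt (by positivity)
  have hr0 : 0 ≤ r := Real.sqrt_nonneg _
  have hrN : r ≤ N := by
    refine abs_le_of_sq_le_sq' ?_ hN'.le |>.2
    rw [hr2, sq]; exact mul_le_mul_of_nonneg_left hℓN hN'.le
  -- Centred deviations are at most `2 * B`. With this `θ`, the exponential moments multiply to at
  -- most `exp ℓ` and the threshold contributes `exp (-2 * ℓ)`; `ℓ ≤ N` is what allows the quadratic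
  -- bound on `exp`.
  set θ := r / (N * (2 * B)) with hθ
  have hθ0 : 0 ≤ θ := by positivity
  have hθB : θ * (2 * B) = r / N := by rw [hθ]; field_simp
  have hθB1 : θ * (2 * B) ≤ 1 := by rw [hθB]; exact (div_le_one hN').2 hrN
  set X : S → α → ℝ := fun s a => θ * (∑ a, w a * Q s a - Q s a) with hX
  have hmean : ∀ s, |∑ a, w a * Q s a| ≤ B := by
    intro s
    refine (Finset.abs_sum_le_sum_abs _ _).trans ?_
    calc ∑ a, |w a * Q s a| ≤ ∑ a, w a * B := by
          refine Finset.sum_le_sum fun a _ => ?_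
          rw [abs_mul, abs_of_nonneg (hw a)]
          exact mul_le_mul_of_nonneg_left (hQ s a) (hw a)
      _ = B := by rw [← Finset.sum_mul, hw1, one_mul]
  have hXb : ∀ s a, |X s a| ≤ θ * (2 * B) := by
    intro s a
    rw [hX, abs_mul, abs_of_nonneg hθ0]
    refine mul_le_mul_of_nonneg_left ?_ hθ0
    refine (abs_sub _ _).trans ?_
    linarith [hmean s, hQ s a]
  have hXs : ∀ s, ∑ a, w a * Real.exp (X s a) ≤ Real.exp ((θ * (2 * B)) ^ 2) := by
    intro s
    have hm : ∑ a, w a * X s a = 0 := by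
      have : ∀ a, w a * X s a = θ * (w a * ∑ a, w a * Q s a - w a * Q s a) := fun a => by
        rw [hX]; ring
      simp only [this]
      rw [← Finset.mul_sum, Finset.sum_sub_distrib, ← Finset.sum_mul, hw1]
      ring
    calc ∑ a, w a * Real.exp (X s a) ≤ ∑ a, (w a * (1 + (θ * (2 * B)) ^ 2) + w a * X s a) := by
          refine Finset.sum_le_sum fun a _ => ?_
          rw [← mul_add]
          refine mul_le_mul_of_nonneg_left ?_ (hw a)
          have h1 := exp_le_one_add_add_sq ((hXb s a).trans hθB1)
          have h2 : X s a ^ 2 ≤ (θ * (2 * B)) ^ 2 := sq_le_sq' (abs_le.1 (hXb s a)).1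
            (abs_le.1 (hXb s a)).2
          linarith
      _ = 1 + (θ * (2 * B)) ^ 2 := by
          rw [Finset.sum_add_distrib, hm, ← Finset.sum_mul, hw1]; ring
      _ ≤ _ := by linarith [Real.add_one_le_exp ((θ * (2 * B)) ^ 2)]
  have h1 := sum_prod_mul_exp_le hw step hXs N s₀
  have h2 : ∀ Z : Fin N → α, (∏ j, w (Z j)) *
      (if 4 * B * r ≤ ∑ j : Fin N, (∑ a, w a * Q (trajectory step s₀ Z j) a
        - Q (trajectory step s₀ Z j) (Z j)) then 1 else 0)
      ≤ Real.exp (-(θ * (4 * B * r))) * ((∏ j, w (Z j)) *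
        Real.exp (∑ j : Fin N, X (trajectory step s₀ Z j) (Z j))) := by
    intro Z
    rw [mul_left_comm]
    refine mul_le_mul_of_nonneg_left ?_ (Finset.prod_nonneg fun j _ => hw _)
    split_ifs with h
    · rw [← Real.exp_add, hX, ← Finset.mul_sum]
      refine Real.one_le_exp ?_
      have := mul_le_mul_of_nonneg_left h hθ0
      linarith
    · positivity
  refine (Finset.sum_le_sum fun Z _ => h2 Z).trans ?_
  rw [← Finset.mul_sum]
  refine (mul_le_mul_of_nonneg_left h1 (Real.exp_pos _).le).trans ?_
  rw [← Real.exp_nat_mul, ← Real.exp_add, Real.exp_le_exp, hθB]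
  have e1 : θ * (4 * B * r) = 2 * ℓ := by
    rw [show θ * (4 * B * r) = θ * (2 * B) * (2 * r) by ring, hθB,
      show r / N * (2 * r) = 2 * r ^ 2 / N by ring, hr2]
    field_simp
  have e2 : (N : ℝ) * (r / N) ^ 2 = ℓ := by
    rw [div_pow, hr2]; field_simp
  rw [e1, e2]
  linarith

end Trajectory

/-! ### The monomials indexed by tuples of digits -/

section TupleSet

variable {n : ℕ}

/-- The variable selected by the digit `d` when the variable `i` is excluded: `0` selects none,
`i` selects the variable `0`, and every other digit selects itself. -/
def digitSet (i : Fin n) (d : ℕ) : Finset (Fin n) :=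
  Finset.univ.filter fun j => d ≠ 0 ∧ (j : ℕ) = if d = i then 0 else d

/-- The set of the variables that are selected by an odd number of the `q` lowest digits of `m` in
base `n`. -/
def tupleSet (i : Fin n) : ℕ → ℕ → Finset (Fin n)
  | 0, _ => ∅
  | q + 1, m => symmDiff (digitSet i (m % n)) (tupleSet i q (m / n))

theorem digitSet_zero (i : Fin n) : digitSet i 0 = ∅ := by simp [digitSet]

theorem notMem_digitSet (i : Fin n) (d : ℕ) : i ∉ digitSet i d := by
  simp only [digitSet, Finset.mem_filter, Finset.mem_univ, true_and, not_and]
  intro h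
  split_ifs <;> omega

theorem digitSet_eq_singleton {i j : Fin n} {d : ℕ} (hd : d ≠ 0)
    (hj : (j : ℕ) = if d = i then 0 else d) : digitSet i d = {j} := by
  ext k
  simp only [digitSet, Finset.mem_filter, Finset.mem_univ, true_and, Finset.mem_singleton,
    Fin.ext_iff, hj]
  tauto

theorem card_digitSet_le (i : Fin n) (d : ℕ) : (digitSet i d).card ≤ 1 := by
  refine Finset.card_le_one.2 fun a ha b hb => ?_
  simp only [digitSet, Finset.mem_filter, Finset.mem_univ, true_and] at ha hb
  exact Fin.ext (ha.2.trans hb.2.symm)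

theorem notMem_tupleSet (i : Fin n) (q m : ℕ) : i ∉ tupleSet i q m := by
  induction q generalizing m with
  | zero => simp [tupleSet]
  | succ q ih => simp [tupleSet, Finset.mem_symmDiff, notMem_digitSet, ih]

theorem card_tupleSet_le (i : Fin n) (q m : ℕ) : (tupleSet i q m).card ≤ q := by
  induction q generalizing m with
  | zero => simp [tupleSet]
  | succ q ih =>
    rw [tupleSet]
    have h : symmDiff (digitSet i (m % n)) (tupleSet i q (m / n))
        ⊆ digitSet i (m % n) ∪ tupleSet i q (m / n) := by
      intro a ha
      rw [Finset.mem_symmDiff] at ha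
      rw [Finset.mem_union]
      tauto
    have := (Finset.card_le_card h).trans (Finset.card_union_le _ _)
    have := card_digitSet_le i (m % n)
    have := ih (m / n)
    omega

/-- The extra leading digit is `0` and selects nothing. -/
theorem tupleSet_succ_of_lt (i : Fin n) {q m : ℕ} (h : m < n ^ q) :
    tupleSet i (q + 1) m = tupleSet i q m := by
  induction q generalizing m with
  | zero =>
    have : m = 0 := by simpa using h
    subst this
    simp [tupleSet, digitSet_zero]
  | succ q ih =>
    rw [tupleSet, ih (Nat.div_lt_of_lt_mul (by rwa [← pow_succ'])), tupleSet]

/-- If `I` needs all the digits, the lowest one encodes some element and the others encode the rest;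
a smaller set is padded with a leading zero. -/
theorem exists_tupleSet_eq (i : Fin n) (q : ℕ) {I : Finset (Fin n)} (hi : i ∉ I)
    (hI : I.card ≤ q) : ∃ m < n ^ q, tupleSet i q m = I := by
  have hn : 0 < n := i.pos
  induction q generalizing I with
  | zero => exact ⟨0, by simp, by simp [tupleSet, Finset.card_eq_zero.1 (Nat.le_zero.1 hI)]⟩
  | succ q ih =>
    rcases Nat.lt_or_ge q I.card with hq | hq
    · obtain ⟨j, hj⟩ := Finset.card_pos.1 (show 0 < I.card by omega)
      obtain ⟨m, hm, hmI⟩ := ih (I := I.erase j) (fun h => hi (Finset.mem_of_mem_erase h))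
        (by rw [Finset.card_erase_of_mem hj]; omega)
      have hij : (j : ℕ) ≠ i := fun h => hi (Fin.ext h ▸ hj)
      -- The digit `0` is reserved for "no variable", so the variable `0` borrows the digit `i`,
      -- which is free because `i` is excluded.
      obtain ⟨d, hdn, hd0, hd⟩ : ∃ d < n, d ≠ 0 ∧ (j : ℕ) = if d = i then 0 else d := by
        by_cases h0 : (j : ℕ) = 0
        · exact ⟨i, i.2, by omega, by simp [h0]⟩
        · exact ⟨j, j.2, h0, by simp [hij]⟩
      refine ⟨d + n * m, ?_, ?_⟩
      · have : n * (m + 1) ≤ n * n ^ q := Nat.mul_le_mul_left _ hm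
        rw [pow_succ']
        rw [mul_add] at this
        omega
      · rw [tupleSet, Nat.add_mul_mod_self_left, Nat.mod_eq_of_lt hdn, Nat.add_mul_div_left _ _ hn,
          Nat.div_eq_of_lt hdn, zero_add, hmI, digitSet_eq_singleton hd0 hd]
        ext k
        by_cases hk : k = j
        · subst hk; simp [Finset.mem_symmDiff, hj]
        · simp [Finset.mem_symmDiff, hk]
    · obtain ⟨m, hm, hmI⟩ := ih hi hq
      exact ⟨m, hm.trans_le (Nat.pow_le_pow_right hn (Nat.le_succ q)), by
        rw [tupleSet_succ_of_lt i hm, hmI]⟩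

theorem mono_tupleSet_negAt (i : Fin n) (q m : ℕ) (x : Cube n) :
    mono (tupleSet i q m) (negAt i x) = mono (tupleSet i q m) x :=
  mono_negAt_of_notMem (notMem_tupleSet i q m) x

/-- The recursion stays at the same `q`, so a single table of `n ^ q` values can be filled in
increasing order of `m`. -/
theorem mono_tupleSet_eq (i : Fin n) {q m : ℕ} (hm : m < n ^ q) (x : Cube n) :
    mono (tupleSet i q m) x = mono (digitSet i (m % n)) x * mono (tupleSet i q (m / n)) x := by
  rw [← mono_symmDiff, ← tupleSet, tupleSet_succ_of_lt i hm]

/-- A low-degree polynomial that does not involve `x i` is a combination of the monomials indexed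
by tuples. -/
theorem exists_tuple_coeff (i : Fin n) (q : ℕ) (p : MultilinearPoly n)
    (hp : ∀ I, p I ≠ 0 → i ∉ I ∧ I.card ≤ q) :
    ∃ c : ℕ → ℝ, ∑ m ∈ Finset.range (n ^ q), |c m| ≤ p.l1Norm ∧
      ∀ x, ∑ m ∈ Finset.range (n ^ q), c m * mono (tupleSet i q m) x = p.eval x := by
  classical
  have h : ∀ I, ∃ m, m < n ^ q ∧ (p I ≠ 0 → tupleSet i q m = I) := by
    intro I
    by_cases hI : p I = 0
    · exact ⟨0, Nat.pow_pos i.pos, fun h => absurd hI h⟩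
    · obtain ⟨m, hm, e⟩ := exists_tupleSet_eq i q (hp I hI).1 (hp I hI).2
      exact ⟨m, hm, fun _ => e⟩
  choose idx hidx hidx' using h
  -- Sets with zero coefficient share the default index `0`; summing over all sets with a given
  -- index makes such collisions harmless.
  refine ⟨fun m => ∑ I, if idx I = m then p I else 0, ?_, fun x => ?_⟩
  · calc ∑ m ∈ Finset.range (n ^ q), |∑ I, if idx I = m then p I else 0|
        ≤ ∑ m ∈ Finset.range (n ^ q), ∑ I, if idx I = m then |p I| else 0 := by
          refine Finset.sum_le_sum fun m _ => (Finset.abs_sum_le_sum_abs _ _).trans (le_of_eq ?_)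
          exact Finset.sum_congr rfl fun I _ => by split_ifs <;> simp
      _ = p.l1Norm := by
          rw [Finset.sum_comm, MultilinearPoly.l1Norm]
          exact Finset.sum_congr rfl fun I _ => by simp [hidx]
  · simp only [Finset.sum_mul, ite_mul, zero_mul]
    rw [Finset.sum_comm, MultilinearPoly.eval_eq]
    refine Finset.sum_congr rfl fun I _ => ?_
    rw [Finset.sum_ite_eq, if_pos (Finset.mem_range.2 (hidx I))]
    by_cases hI : p I = 0
    · simp [hI]
    · rw [hidx' I hI]

end TupleSet

/-! ### The logistic function -/

section Logistic

theorem logistic_pos (z : ℝ) : 0 < logistic z := by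
  have := Real.exp_pos (-z)
  exact one_div_pos.2 (by linarith)

theorem logistic_lt_one (z : ℝ) : logistic z < 1 := by
  have := Real.exp_pos (-z)
  exact (div_lt_one (by linarith)).2 (by linarith)

theorem hasDerivAt_logistic (z : ℝ) :
    HasDerivAt logistic (Real.exp (-z) / (1 + Real.exp (-z)) ^ 2) z := by
  have e : logistic = (fun y => 1 + Real.exp (-y))⁻¹ := by
    funext y; simp [logistic]
  have h1 : HasDerivAt (fun y => 1 + Real.exp (-y)) (Real.exp (-z) * -1) z :=
    ((hasDerivAt_neg z).exp).const_add 1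
  have h2 := h1.inv (by have := Real.exp_pos (-z); positivity)
  rw [← e, mul_neg_one, neg_neg] at h2
  exact h2

/-- The derivative of the logistic function is at least `exp (-R) / 4` on `[-R, R]`; the mean value
inequality does the rest. -/
theorem logistic_strongly_monotone {R a b : ℝ} (ha : |a| ≤ R) (hb : |b| ≤ R) :
    Real.exp (-R) / 4 * (a - b) ^ 2 ≤ (logistic a - logistic b) * (a - b) := by
  have hd : ∀ z ∈ Set.Icc (-R) R, Real.exp (-R) / 4 ≤ deriv logistic z := by
    intro z hz
    rw [(hasDerivAt_logistic z).deriv]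
    have h1 : Real.exp (-R) ≤ Real.exp (-z) := Real.exp_le_exp.2 (by linarith [hz.2])
    have h2 : Real.exp (-R) * Real.exp (-z) ≤ 1 := by
      rw [← Real.exp_add]; exact Real.exp_le_one_iff.2 (by linarith [hz.1])
    have h3 := Real.exp_pos (-R)
    set u := Real.exp (-z)
    set r := Real.exp (-R)
    have hu : 0 < u := h3.trans_le h1
    rw [div_le_div_iff₀ (by norm_num) (by positivity)]
    have h4 : r ≤ 1 := Real.exp_le_one_iff.2 (by linarith [hz.1, hz.2])
    -- `r * (1 + u) ^ 2 = r + 2 * r * u + r * u ^ 2 ≤ 4 * u`, from `r ≤ u`, `r ≤ 1` and `r * u ≤ 1`.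
    nlinarith [mul_nonneg hu.le (sub_nonneg.2 h2), mul_nonneg hu.le (sub_nonneg.2 h4)]
  have key : ∀ a b, |a| ≤ R → |b| ≤ R → b ≤ a →
      Real.exp (-R) / 4 * (a - b) ≤ logistic a - logistic b := by
    intro a b ha hb hab
    have hcont : Continuous logistic :=
      continuous_iff_continuousAt.2 fun z => (hasDerivAt_logistic z).continuousAt
    refine Convex.mul_sub_le_image_sub_of_le_deriv (convex_Icc (-R) R) hcont.continuousOn
      (fun z _ => (hasDerivAt_logistic z).differentiableAt.differentiableWithinAt)
      (fun z hz => hd z (interior_subset hz)) b (abs_le.1 hb) a (abs_le.1 ha) hab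
  rcases le_total b a with h | h
  · nlinarith [key a b ha hb h]
  · nlinarith [key b a hb ha h]

end Logistic

/-! ### The estimator -/

section Estimator

variable {n : ℕ}

/-- The prediction, at the point `x`, of the current combination of monomials. -/
noncomputable def vertexPred (q : ℕ) (η lam : ℝ) (i : Fin n) (L : ℕ → ℝ) (x : Cube n) : ℝ :=
  2 * lam * ∑ m ∈ Finset.range (n ^ q), hedgeWeight (n ^ q) η L m * mono (tupleSet i q m) x

/-- The difference of the predicted and the observed value at the vertex `i`. -/
noncomputable def vertexGrad (q : ℕ) (η lam : ℝ) (i : Fin n) (L : ℕ → ℝ) (x : Cube n) : ℝ :=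
  logistic (vertexPred q η lam i L x) - (((x i : ℤ) : ℝ) + 1) / 2

/-- The update of the cumulative losses of the monomials for the vertex `i`. -/
noncomputable def vertexStep (q : ℕ) (η lam : ℝ) (i : Fin n) (L : ℕ → ℝ) (x : Cube n) : ℕ → ℝ :=
  fun m => L m + vertexGrad q η lam i L x * mono (tupleSet i q m) x

/-- The cumulative losses after the first `j` samples. -/
noncomputable def lossTable (q : ℕ) (η lam : ℝ) {N : ℕ} (Z : Fin N → Cube n) (j : ℕ) (i : Fin n) :
    ℕ → ℝ :=
  trajectory (vertexStep q η lam i) 0 Z j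

/-- The sum of the weights of the monomials over the first `j` samples. -/
noncomputable def weightSum (q : ℕ) (η lam : ℝ) {N : ℕ} (Z : Fin N → Cube n) (j : ℕ) (i : Fin n)
    (m : ℕ) : ℝ :=
  ∑ k ∈ Finset.range j, hedgeWeight (n ^ q) η (lossTable q η lam Z k i) m

/-- The estimate of the polynomial `2 * ∂ᵢψ`. -/
noncomputable def vertexPoly (q : ℕ) (η lam : ℝ) {N : ℕ} (Z : Fin N → Cube n) (i : Fin n) :
    MultilinearPoly n := fun I =>
  ∑ m ∈ Finset.range (n ^ q),
    if tupleSet i q m = I then 2 * lam * weightSum q η lam Z N i m / N else 0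

/-- The learned factorization polynomial. -/
noncomputable def learnedPoly (q : ℕ) (η lam : ℝ) {N : ℕ} (Z : Fin N → Cube n) :
    MultilinearPoly n := fun I =>
  ∑ i, ∑ m ∈ Finset.range (n ^ q),
    if insert i (tupleSet i q m) = I then
      lam * weightSum q η lam Z N i m / N / ((insert i (tupleSet i q m)).card : ℝ) else 0

variable {q : ℕ} {η lam : ℝ} {N : ℕ}

theorem abs_vertexPred_le (hlam : 0 ≤ lam) (i : Fin n) (L : ℕ → ℝ) (x : Cube n) :
    |vertexPred q η lam i L x| ≤ 2 * lam := by
  rw [vertexPred, abs_mul, abs_of_nonneg (by positivity : 0 ≤ 2 * lam)]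
  refine mul_le_of_le_one_right (by positivity) ?_
  refine (Finset.abs_sum_le_sum_abs _ _).trans ?_
  simp only [abs_mul, abs_mono, mul_one]
  exact sum_abs_hedgeWeight_le (Nat.pow_pos i.pos) η L

theorem vertexPred_negAt (i : Fin n) (L : ℕ → ℝ) (x : Cube n) :
    vertexPred q η lam i L (negAt i x) = vertexPred q η lam i L x := by
  simp only [vertexPred, mono_tupleSet_negAt]

theorem abs_vertexGrad_le (i : Fin n) (L : ℕ → ℝ) (x : Cube n) :
    |vertexGrad q η lam i L x| ≤ 1 := by
  have h1 := logistic_pos (vertexPred q η lam i L x)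
  have h2 := logistic_lt_one (vertexPred q η lam i L x)
  rw [vertexGrad, abs_le]
  rcases coe_eq_one_or (x i) with h | h <;> rw [h] <;> constructor <;> linarith

/-- Predictions are linear in the weights, so averaging the weights over time averages the
predictions. -/
theorem vertexPoly_eval (Z : Fin N → Cube n) (i : Fin n) (x : Cube n) :
    (vertexPoly q η lam Z i).eval x
      = (∑ j : Fin N, vertexPred q η lam i (lossTable q η lam Z j i) x) / N := by
  have h1 : (vertexPoly q η lam Z i).eval x = ∑ m ∈ Finset.range (n ^ q),
      2 * lam * weightSum q η lam Z N i m / N * mono (tupleSet i q m) x := by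
    rw [MultilinearPoly.eval_eq]
    simp only [vertexPoly, Finset.sum_mul, ite_mul, zero_mul]
    rw [Finset.sum_comm]
    exact Finset.sum_congr rfl fun m _ => by simp
  rw [h1]
  simp only [weightSum, vertexPred]
  rw [← Finset.sum_range (fun j => 2 * lam * ∑ m ∈ Finset.range (n ^ q),
    hedgeWeight (n ^ q) η (lossTable q η lam Z j i) m * mono (tupleSet i q m) x), Finset.sum_div]
  simp only [Finset.mul_sum, Finset.sum_div, Finset.sum_mul]
  rw [Finset.sum_comm]
  exact Finset.sum_congr rfl fun _ _ => Finset.sum_congr rfl fun _ _ => by ring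

/-- The excess loss of the prediction with state `L` at the point `x`. -/
noncomputable def vertexExcess (q : ℕ) (η lam : ℝ) (i : Fin n) (p : MultilinearPoly n) (L : ℕ → ℝ)
    (x : Cube n) : ℝ :=
  vertexGrad q η lam i L x * (vertexPred q η lam i L x - 2 * p.eval x)

/-- The natural bound is `4 * lam`; the added `1` keeps it positive for `lam = 0`, as the Azuma
inequality requires. -/
theorem abs_vertexExcess_le (hlam : 0 ≤ lam) (i : Fin n) {p : MultilinearPoly n}
    (hp : p.l1Norm ≤ lam) (L : ℕ → ℝ) (x : Cube n) :
    |vertexExcess q η lam i p L x| ≤ 4 * (lam + 1) := by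
  rw [vertexExcess, abs_mul]
  have h1 := abs_vertexGrad_le (q := q) (η := η) (lam := lam) i L x
  have h2 := abs_vertexPred_le (q := q) (η := η) hlam i L x
  have h3 := (p.abs_eval_le x).trans hp
  have h4 : |vertexPred q η lam i L x - 2 * p.eval x| ≤ 4 * (lam + 1) := by
    refine (abs_sub _ _).trans ?_
    rw [abs_mul, abs_two]
    linarith
  calc _ ≤ 1 * (4 * (lam + 1)) := mul_le_mul h1 h4 (abs_nonneg _) zero_le_one
    _ = _ := one_mul _

variable {t : ℕ} {G : SimpleGraph (Fin n)} {ψ : MultilinearPoly n} {D : PMF (Cube n)}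

theorem IsMRF.partialDeriv_support (h : IsMRF t G ψ D) (i : Fin n) (I : Finset (Fin n))
    (hI : ψ.partialDeriv i I ≠ 0) : i ∉ I ∧ I.card ≤ t - 1 := by
  have hi : i ∉ I := fun hi => hI (by simp [MultilinearPoly.partialDeriv, hi])
  refine ⟨hi, ?_⟩
  by_contra hc
  refine hI ?_
  simp only [MultilinearPoly.partialDeriv, hi, if_false]
  exact h.coeff_eq_zero (by rw [Finset.card_insert_of_notMem hi]; omega)

/-- The regret bound with `2 * ∂ᵢψ`, written in the monomials of the algorithm, as the comparator.
It holds for every stream; no randomness enters. -/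
theorem sum_vertexExcess_le (h : IsMRF t G ψ D) (hη : 0 < η) (hη1 : η ≤ 1) (i : Fin n)
    (hp : (ψ.partialDeriv i).l1Norm ≤ lam) (Z : Fin N → Cube n) :
    ∑ j : Fin N, vertexExcess (t - 1) η lam i (ψ.partialDeriv i)
        (lossTable (t - 1) η lam Z j i) (Z j)
      ≤ 2 * lam * (Real.log (2 * (n ^ (t - 1) : ℕ)) / η + N * η) := by
  obtain ⟨c, hc, hc'⟩ := exists_tuple_coeff i (t - 1) (ψ.partialDeriv i) (h.partialDeriv_support i)
  have key := hedge_regret (M := n ^ (t - 1)) (N := N) (Nat.pow_pos i.pos) hη hη1 (B := 2 * lam)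
    (g := fun j => if hj : j < N then
      vertexGrad (t - 1) η lam i (lossTable (t - 1) η lam Z j i) (Z ⟨j, hj⟩) else 0)
    (f := fun j m => if hj : j < N then mono (tupleSet i (t - 1) m) (Z ⟨j, hj⟩) else 0)
    (L := fun j => lossTable (t - 1) η lam Z j i) (c := fun m => 2 * c m)
    (by intro j hj; simp only [hj, dif_pos]; exact abs_vertexGrad_le _ _ _)
    (by intro j hj m _; simp only [hj, dif_pos]; exact (abs_mono _ _).le)
    (by intro m; simp [lossTable, trajectory])
    (by
      intro j hj m _
      have := trajectory_succ (vertexStep (t - 1) η lam i) 0 Z ⟨j, hj⟩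
      simp only [hj, dif_pos, lossTable]
      simp only at this
      rw [this]
      rfl)
    (by simp only [abs_mul, abs_two, ← Finset.mul_sum]; linarith)
  refine le_trans (le_of_eq ?_) key
  rw [Finset.sum_range]
  refine Finset.sum_congr rfl fun j _ => ?_
  simp only [j.2, dif_pos, vertexExcess, vertexPred, Fin.eta]
  rw [← hc' (Z j), Finset.mul_sum (a := (2 : ℝ))]
  simp only [mul_assoc]

/-- The factor `prediction - 2 * ∂ᵢψ` does not involve `x i`, so in the mean the observed value can
be replaced by `logistic (2 * ∂ᵢψ)`. Strong monotonicity then applies pointwise. -/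
theorem le_sum_vertexExcess (h : IsMRF t G ψ D) (hlam : 0 ≤ lam) (i : Fin n)
    (hp : (ψ.partialDeriv i).l1Norm ≤ lam) (L : ℕ → ℝ) :
    Real.exp (-(2 * lam)) / 4 * ∑ x, (D x).toReal *
        (vertexPred q η lam i L x - 2 * (ψ.partialDeriv i).eval x) ^ 2
      ≤ ∑ x, (D x).toReal * vertexExcess q η lam i (ψ.partialDeriv i) L x := by
  have h1 := h.sum_logistic_sub i
    (u := fun x => vertexPred q η lam i L x - 2 * (ψ.partialDeriv i).eval x)
    (fun x => by simp only [vertexPred_negAt, MultilinearPoly.partialDeriv_eval_negAt])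
  rw [Finset.mul_sum, ← sub_zero (∑ x, (D x).toReal * vertexExcess _ _ _ _ _ _ _), ← h1,
    ← Finset.sum_sub_distrib]
  refine Finset.sum_le_sum fun x _ => ?_
  have h2 := (MultilinearPoly.abs_eval_le _ x).trans hp
  have h3 := logistic_strongly_monotone (R := 2 * lam)
    (abs_vertexPred_le (q := q) (η := η) hlam i L x)
    (b := 2 * (ψ.partialDeriv i).eval x) (by rw [abs_mul, abs_two]; linarith)
  rw [mul_left_comm, ← mul_sub]
  refine mul_le_mul_of_nonneg_left (h3.trans (le_of_eq ?_)) ENNReal.toReal_nonneg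
  rw [vertexExcess, vertexGrad]
  ring

/-- If the excess losses do not deviate too much from their conditional means, the estimate of
`2 * ∂ᵢψ` is close to it in the mean. -/
theorem sum_abs_vertexPoly_sub_le (h : IsMRF t G ψ D) (hlam : 0 ≤ lam) (hη : 0 < η) (hη1 : η ≤ 1)
    (i : Fin n) (hp : (ψ.partialDeriv i).l1Norm ≤ lam) (Z : Fin N → Cube n) (hN : 0 < N) {δ : ℝ}
    (hδ : ∑ j : Fin N, (∑ x, (D x).toReal * vertexExcess (t - 1) η lam i (ψ.partialDeriv i)
        (lossTable (t - 1) η lam Z j i) x - vertexExcess (t - 1) η lam i (ψ.partialDeriv i)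
        (lossTable (t - 1) η lam Z j i) (Z j)) ≤ δ) :
    ∑ x, (D x).toReal *
      |(vertexPoly (t - 1) η lam Z i - (2 : ℝ) • ψ.partialDeriv i : MultilinearPoly n).eval x| ≤
      √(4 * Real.exp (2 * lam) *
        (2 * lam * (Real.log (2 * (n ^ (t - 1) : ℕ)) / η + N * η) + δ) / N) := by
  have hN' : (0 : ℝ) < N := by exact_mod_cast hN
  have hsum := PMF.sum_toReal_eq_one D
  set r : Fin N → Cube n → ℝ := fun j x => vertexPred (t - 1) η lam i
    (lossTable (t - 1) η lam Z j i) x - 2 * (ψ.partialDeriv i).eval x with hr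
  have h1 : ∀ x, (vertexPoly (t - 1) η lam Z i - (2 : ℝ) • ψ.partialDeriv i : MultilinearPoly n).eval x
      = (∑ j, r j x) / N := by
    intro x
    rw [Finset.sum_sub_distrib, sub_div, ← vertexPoly_eval]
    simp only [MultilinearPoly.eval_eq, Pi.sub_apply, Pi.smul_apply, sub_mul,
      Finset.sum_sub_distrib, smul_eq_mul]
    congr 1
    simp only [Finset.sum_const, Finset.card_univ, Fintype.card_fin, nsmul_eq_mul]
    rw [mul_div_cancel_left₀ _ hN'.ne', Finset.mul_sum]
    exact Finset.sum_congr rfl fun _ _ => by ring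
  simp only [h1]
  refine Real.le_sqrt_of_sq_le ?_
  -- Jensen's inequality over the points `x`, followed by Cauchy–Schwarz over the samples.
  calc (∑ x, (D x).toReal * |(∑ j, r j x) / N|) ^ 2
      ≤ ∑ x, (D x).toReal * |(∑ j, r j x) / N| ^ 2 :=
        Real.pow_arith_mean_le_arith_mean_pow_of_even _ _ _ (fun _ _ => ENNReal.toReal_nonneg)
          hsum even_two
    _ ≤ ∑ x, (D x).toReal * ((∑ j, r j x ^ 2) / N) := by
        refine Finset.sum_le_sum fun x _ => mul_le_mul_of_nonneg_left ?_ ENNReal.toReal_nonneg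
        rw [sq_abs, div_pow, div_le_div_iff₀ (by positivity) hN']
        have := sq_sum_le_card_mul_sum_sq (s := Finset.univ) (f := fun j => r j x)
        rw [Finset.card_univ, Fintype.card_fin] at this
        nlinarith
    _ = (∑ j, ∑ x, (D x).toReal * r j x ^ 2) / N := by
        rw [Finset.sum_comm, Finset.sum_div]
        refine Finset.sum_congr rfl fun x _ => ?_
        rw [← Finset.mul_sum, mul_div_assoc]
    _ ≤ _ := by
        refine div_le_div_of_nonneg_right ?_ hN'.le
        have h2 : ∀ j, ∑ x, (D x).toReal * r j x ^ 2 ≤ 4 * Real.exp (2 * lam) * ∑ x,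
            (D x).toReal * vertexExcess (t - 1) η lam i (ψ.partialDeriv i)
              (lossTable (t - 1) η lam Z j i) x := by
          intro j
          have := le_sum_vertexExcess (q := t - 1) (η := η) h hlam i hp
            (lossTable (t - 1) η lam Z j i)
          rw [Real.exp_neg] at this
          have he := Real.exp_pos (2 * lam)
          have := mul_le_mul_of_nonneg_left this (by positivity : 0 ≤ 4 * Real.exp (2 * lam))
          refine le_trans (le_of_eq ?_) this
          rw [← mul_assoc]
          field_simp
          rfl
        refine (Finset.sum_le_sum fun j _ => h2 j).trans ?_
        rw [← Finset.mul_sum]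
        refine mul_le_mul_of_nonneg_left ?_ (by positivity)
        have h3 := sum_vertexExcess_le (N := N) h hη hη1 i hp Z
        rw [Finset.sum_sub_distrib] at hδ
        linarith

/-- For each `i ∈ I`, the coefficient of `I` in `ψ` is that of `I \ {i}` in `∂ᵢψ`, and `learnedPoly`
averages the estimates over `i ∈ I`. Each pair of a vertex `i` and a set `I ∋ i` is charged to a
different coefficient of the `i`-th error. -/
theorem sum_abs_learnedPoly_sub_le (Z : Fin N → Cube n) (ψ : MultilinearPoly n) :
    ∑ I ∈ Finset.univ.filter (fun I : Finset (Fin n) => I.Nonempty),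
      |learnedPoly q η lam Z I - ψ I|
      ≤ (∑ i, (vertexPoly q η lam Z i - (2 : ℝ) • ψ.partialDeriv i : MultilinearPoly n).l1Norm) / 2 := by
  set R : Fin n → MultilinearPoly n := fun i => vertexPoly q η lam Z i - (2 : ℝ) • ψ.partialDeriv i with hR
  have h1 : ∀ I : Finset (Fin n), I.Nonempty → learnedPoly q η lam Z I - ψ I
      = ∑ i ∈ I, R i (I.erase i) / 2 / (I.card : ℝ) := by
    intro I hI
    have hc : (I.card : ℝ) ≠ 0 := by exact_mod_cast hI.card_pos.ne'
    have e1 : ψ I = ∑ i ∈ I, ψ.partialDeriv i (I.erase i) / (I.card : ℝ) := by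
      have : ∀ i ∈ I, ψ.partialDeriv i (I.erase i) / (I.card : ℝ) = ψ I / (I.card : ℝ) := by
        intro i hi
        simp [MultilinearPoly.partialDeriv, Finset.insert_erase hi]
      rw [Finset.sum_congr rfl this, Finset.sum_const, nsmul_eq_mul]
      field_simp
    have e2 : learnedPoly q η lam Z I
        = ∑ i ∈ I, vertexPoly q η lam Z i (I.erase i) / 2 / (I.card : ℝ) := by
      rw [learnedPoly, ← Finset.sum_subset (Finset.subset_univ I)]
      · refine Finset.sum_congr rfl fun i hi => ?_
        simp only [vertexPoly, Finset.sum_div]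
        refine Finset.sum_congr rfl fun m _ => ?_
        have e3 : insert i (tupleSet i q m) = I ↔ tupleSet i q m = I.erase i := by
          constructor
          · rintro rfl; rw [Finset.erase_insert (notMem_tupleSet i q m)]
          · intro e; rw [e, Finset.insert_erase hi]
        by_cases e4 : insert i (tupleSet i q m) = I
        · rw [if_pos e4, if_pos (e3.1 e4), e4]; ring
        · rw [if_neg e4, if_neg (fun e => e4 (e3.2 e))]; simp
      · intro i _ hi
        refine Finset.sum_eq_zero fun m _ => if_neg ?_
        rintro rfl
        exact hi (Finset.mem_insert_self _ _)
    rw [e1, e2, ← Finset.sum_sub_distrib]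
    refine Finset.sum_congr rfl fun i _ => ?_
    simp only [hR, Pi.sub_apply, Pi.smul_apply, smul_eq_mul]
    ring
  calc ∑ I ∈ Finset.univ.filter (fun I : Finset (Fin n) => I.Nonempty),
      |learnedPoly q η lam Z I - ψ I|
      ≤ ∑ I ∈ Finset.univ.filter (fun I : Finset (Fin n) => I.Nonempty),
        ∑ i ∈ I, |R i (I.erase i)| / 2 := by
        refine Finset.sum_le_sum fun I hI => ?_
        have hI := (Finset.mem_filter.1 hI).2
        rw [h1 I hI]
        refine (Finset.abs_sum_le_sum_abs _ _).trans (Finset.sum_le_sum fun i _ => ?_)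
        have hc : (1 : ℝ) ≤ I.card := by exact_mod_cast hI.card_pos
        rw [abs_div, abs_div, abs_two, Nat.abs_cast]
        exact div_le_self (by positivity) hc
    _ ≤ ∑ I : Finset (Fin n), ∑ i, if i ∈ I then |R i (I.erase i)| / 2 else 0 := by
        refine (Finset.sum_le_sum_of_subset_of_nonneg (Finset.filter_subset _ _)
          fun I _ _ => Finset.sum_nonneg fun i _ => by positivity).trans (le_of_eq ?_)
        exact Finset.sum_congr rfl fun I _ => by rw [Finset.sum_ite_mem, Finset.univ_inter]
    _ ≤ (∑ i, (R i).l1Norm) / 2 := by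
        rw [Finset.sum_comm, Finset.sum_div]
        refine Finset.sum_le_sum fun i _ => ?_
        rw [← Finset.sum_filter, ← Finset.sum_div]
        refine div_le_div_of_nonneg_right ?_ two_pos.le
        rw [← Finset.sum_image (f := fun J => |R i J|) (g := fun I : Finset (Fin n) => I.erase i)]
        · exact Finset.sum_le_sum_of_subset_of_nonneg (Finset.subset_univ _)
            fun _ _ _ => abs_nonneg _
        · intro I hI J hJ e
          rw [← Finset.insert_erase (Finset.mem_filter.1 (Finset.mem_coe.1 hI)).2, show I.erase i = J.erase i from e,
            Finset.insert_erase (Finset.mem_filter.1 (Finset.mem_coe.1 hJ)).2]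

end Estimator

/-! ### Accuracy of the estimator -/

section Accuracy

variable {n t N : ℕ} {G : SimpleGraph (Fin n)} {ψ : MultilinearPoly n} {D : PMF (Cube n)}

/-- Gibbs distributions whose exponents agree up to a constant and an error `τ` have ratio at most
`exp (2 * τ)`. -/
theorem gibbs_le_of_abs_sub_le {α : Type*} [Fintype α] {P P' : α → ℝ} (hP1 : ∑ x, P x = 1)
    (hP'1 : ∑ x, P' x = 1) {f f' : α → ℝ} {c c' : ℝ} (hc : 0 < c) (hc' : 0 < c')
    (hP : ∀ x, P x = c * Real.exp (f x)) (hP' : ∀ x, P' x = c' * Real.exp (f' x)) {a τ : ℝ}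
    (h : ∀ x, |f' x - f x - a| ≤ τ) (x : α) :
    P x ≤ Real.exp (2 * τ) * P' x := by
  set k := c * Real.exp (-a) / c' with hk
  have hk0 : 0 < k := by positivity
  have hkc : k * c' = c * Real.exp (-a) := by rw [hk]; field_simp
  have h1 : ∀ y, k * Real.exp (-τ) * P' y ≤ P y := by
    intro y
    rw [hP, hP', show k * Real.exp (-τ) * (c' * Real.exp (f' y))
      = k * c' * (Real.exp (-τ) * Real.exp (f' y)) by ring, hkc, mul_assoc, ← Real.exp_add,
      ← Real.exp_add]
    refine mul_le_mul_of_nonneg_left (Real.exp_le_exp.2 ?_) hc.le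
    linarith [(abs_le.1 (h y)).2]
  have h2 : P x ≤ k * Real.exp τ * P' x := by
    rw [hP, hP', show k * Real.exp τ * (c' * Real.exp (f' x))
      = k * c' * (Real.exp τ * Real.exp (f' x)) by ring, hkc, mul_assoc, ← Real.exp_add,
      ← Real.exp_add]
    refine mul_le_mul_of_nonneg_left (Real.exp_le_exp.2 ?_) hc.le
    linarith [(abs_le.1 (h x)).1]
  -- Summing the pointwise bound over the whole space compares the normalizations, which costs the
  -- second factor `exp τ`.
  have h3 : k * Real.exp (-τ) ≤ 1 := by
    have := Finset.sum_le_sum fun y (_ : y ∈ Finset.univ) => h1 y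
    rwa [← Finset.mul_sum, hP1, hP'1, mul_one] at this
  have h4 : k ≤ Real.exp τ := by
    rw [Real.exp_neg, ← div_eq_mul_inv, div_le_one (Real.exp_pos _)] at h3
    exact h3
  have h5 : 0 ≤ P' x := by rw [hP']; positivity
  refine h2.trans (mul_le_mul_of_nonneg_right ?_ h5)
  rw [two_mul, Real.exp_add]
  exact mul_le_mul_of_nonneg_right h4 (Real.exp_pos _).le

theorem learnedPoly_empty (q : ℕ) (η lam : ℝ) (Z : Fin N → Cube n) :
    learnedPoly q η lam Z ∅ = 0 := by
  simp [learnedPoly]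

/-- The step size of the multiplicative weights method. -/
noncomputable def learningRate (n t N : ℕ) : ℝ :=
  √(Real.log (2 * (n ^ (t - 1) : ℕ)) / N)

/-- The estimate and the target are both supported on the at most `n ^ (t - 1)` monomials that
tuples produce, and the sampled distribution is stable under flips with factor `exp (2 * lam)`. -/
theorem l1Norm_vertexPoly_sub_le (h : IsMRF t G ψ D) {η lam : ℝ} (hlam : 0 ≤ lam) (ht : 1 ≤ t)
    (hψ : ∀ i : Fin n, (ψ.partialDeriv i).l1Norm ≤ lam) (i : Fin n) (Z : Fin N → Cube n) {κ : ℝ}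
    (hκ : ∑ x, (D x).toReal * |(vertexPoly (t - 1) η lam Z i
      - (2 : ℝ) • ψ.partialDeriv i : MultilinearPoly n).eval x| ≤ κ) :
    (vertexPoly (t - 1) η lam Z i - (2 : ℝ) • ψ.partialDeriv i : MultilinearPoly n).l1Norm
      ≤ 3 * (n : ℝ) ^ (t - 1) * ((2 * t) ^ (t - 1) * Real.exp (2 * lam) ^ (t - 1) * κ) := by
  classical
  have hκ0 : 0 ≤ κ := le_trans (Finset.sum_nonneg fun x _ =>
    mul_nonneg ENNReal.toReal_nonneg (abs_nonneg _)) hκ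
  refine (MultilinearPoly.l1Norm_le_of_sum_abs_le (fun x => ENNReal.toReal_nonneg)
    (PMF.sum_toReal_eq_one D) (Real.one_le_exp (by positivity)) (fun j x => h.negAt_le hψ j x) _ hκ t
    ((Finset.range (n ^ (t - 1))).image (tupleSet i (t - 1))) ?_ ?_).trans ?_
  · intro I hI
    rw [Finset.mem_image]
    by_cases h1 : vertexPoly (t - 1) η lam Z i I = 0
    · have h2 : ψ.partialDeriv i I ≠ 0 := by
        intro h2
        exact hI (by simp [h1, h2])
      obtain ⟨m, hm, e⟩ := exists_tupleSet_eq i (t - 1) (h.partialDeriv_support i I h2).1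
        (h.partialDeriv_support i I h2).2
      exact ⟨m, Finset.mem_range.2 hm, e⟩
    · obtain ⟨m, hm, e⟩ := Finset.exists_ne_zero_of_sum_ne_zero h1
      exact ⟨m, hm, by by_contra h2; exact e (if_neg h2)⟩
  · intro I hI
    obtain ⟨m, -, rfl⟩ := Finset.mem_image.1 hI
    have := card_tupleSet_le i (t - 1) m
    omega
  · refine mul_le_mul_of_nonneg_right (mul_le_mul_of_nonneg_left ?_ (by norm_num))
      (by positivity)
    have := Finset.card_image_le (s := Finset.range (n ^ (t - 1))) (f := tupleSet i (t - 1))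
    rw [Finset.card_range] at this
    exact_mod_cast this

/-- The numerical estimate behind the number of samples. -/
theorem error_le_of_sample_size {n t : ℕ} {N lam ε ℓ l : ℝ} (hn : 1 ≤ n) (ht : 1 ≤ t)
    (hlam : 0 ≤ lam) (hε : 0 < ε) (hε1 : ε < 1 / 2) (hℓ : 0 < ℓ) (hl0 : 0 < l) (hl : l ≤ t * ℓ)
    (hN : (2 * (t : ℝ)) ^ (29 * t) * Real.exp (29 * lam * t) / ε ^ 4 * (n : ℝ) ^ (4 * t) * ℓ ≤ N) :
    t * ℓ ≤ N ∧
    3 / 2 * (n : ℝ) ^ t * ((2 * t) ^ (t - 1) * Real.exp (2 * lam) ^ (t - 1) *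
      √(4 * Real.exp (2 * lam) *
        (2 * lam * (l / √(l / N) + N * √(l / N)) + 4 * (4 * (lam + 1)) * √(N * ℓ)) / N))
      ≤ ε / 4 := by
  have htR : (1 : ℝ) ≤ t := by exact_mod_cast ht
  have hnR : (1 : ℝ) ≤ n := by exact_mod_cast hn
  set s : ℝ := 2 * t with hs
  have hs2 : 2 ≤ s := by linarith
  have hs1 : 1 ≤ s := by linarith
  have hs0 : 0 < s := by linarith
  -- `K` collects the factors of the squared error apart from `n`, `ε` and `N`. As this square is
  -- proportional to `√(t * ℓ / N)`, the sample size has to contain `K ^ 2`, which has `s ^ (28 *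
  -- t)`; the further factor `t ≤ s ^ t` leads to the exponent `29 * t`.
  set K : ℝ := s ^ (14 * t) * Real.exp (4 * lam * t) with hK
  have hK0 : 0 < K := by positivity
  have hlt : 0 ≤ lam * t := by positivity
  -- the sample size in the form that is used
  have h1 : t * ℓ * ((n : ℝ) ^ (2 * t) * K / ε ^ 2) ^ 2 ≤ N := by
    refine le_trans ?_ hN
    have e1 : t * ℓ * ((n : ℝ) ^ (2 * t) * K / ε ^ 2) ^ 2
        = (t * (s ^ (28 * t) * Real.exp (8 * lam * t))) / ε ^ 4 * (n : ℝ) ^ (4 * t) * ℓ := by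
      rw [hK, div_pow, mul_pow, mul_pow, ← pow_mul, ← pow_mul, ← pow_mul, ← Real.exp_nat_mul,
        show 2 * t * 2 = 4 * t by ring, show 14 * t * 2 = 28 * t by ring]
      push_cast
      rw [show 2 * (4 * lam * t) = 8 * lam * t by ring]
      ring
    rw [e1]
    refine mul_le_mul_of_nonneg_right (mul_le_mul_of_nonneg_right
      (div_le_div_of_nonneg_right ?_ (by positivity)) (by positivity)) hℓ.le
    rw [← mul_assoc]
    refine mul_le_mul ?_ (Real.exp_le_exp.2 (by nlinarith)) (Real.exp_pos _).le (by positivity)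
    rw [show 29 * t = t + 28 * t by ring, pow_add]
    refine mul_le_mul_of_nonneg_right ?_ (by positivity)
    calc (t : ℝ) ≤ s := by linarith
      _ ≤ s ^ t := le_self_pow₀ hs1 (by omega)
  have hKe : 1 ≤ (n : ℝ) ^ (2 * t) * K / ε ^ 2 := by
    rw [le_div_iff₀ (by positivity), one_mul]
    have a1 : ε ^ 2 ≤ 1 := pow_le_one₀ hε.le (by linarith)
    have a2 : 1 ≤ K := one_le_mul_of_one_le_of_one_le (one_le_pow₀ hs1)
      (Real.one_le_exp (by positivity))
    exact a1.trans (one_le_mul_of_one_le_of_one_le (one_le_pow₀ hnR) a2)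
  have htℓ : 0 < t * ℓ := by positivity
  have h2 : t * ℓ ≤ N := by
    refine le_trans ?_ h1
    exact le_mul_of_one_le_right htℓ.le (one_le_pow₀ hKe)
  refine ⟨h2, ?_⟩
  have hN0 : 0 < N := htℓ.trans_le h2
  set r := √(t * ℓ / N) with hr
  have hr1 : r ≤ ε ^ 2 / ((n : ℝ) ^ (2 * t) * K) := by
    refine Real.sqrt_le_iff.2 ⟨by positivity, ?_⟩
    rw [div_le_iff₀ hN0]
    calc t * ℓ = t * ℓ * ((n : ℝ) ^ (2 * t) * K / ε ^ 2) ^ 2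
          * (ε ^ 2 / ((n : ℝ) ^ (2 * t) * K)) ^ 2 := by field_simp
      _ ≤ N * (ε ^ 2 / ((n : ℝ) ^ (2 * t) * K)) ^ 2 :=
        mul_le_mul_of_nonneg_right h1 (by positivity)
      _ = _ := by ring
  have hr0 : 0 ≤ r := Real.sqrt_nonneg _
  -- the regret and the deviation
  have h3 : (2 * lam * (l / √(l / N) + N * √(l / N)) + 4 * (4 * (lam + 1)) * √(N * ℓ)) / N
      ≤ 20 * (lam + 1) * r := by
    -- The step size balances the two terms of the regret.
    have b1 : l / √(l / N) = N * √(l / N) := by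
      have hp : 0 < √(l / N) := Real.sqrt_pos.2 (by positivity)
      rw [div_eq_iff hp.ne', mul_assoc, Real.mul_self_sqrt (by positivity)]
      field_simp
    have b2 : √(N * ℓ) = N * √(ℓ / N) := by
      rw [show N * ℓ = N ^ 2 * (ℓ / N) by field_simp, Real.sqrt_mul (by positivity),
        Real.sqrt_sq hN0.le]
    have b3 : √(l / N) ≤ r := Real.sqrt_le_sqrt (div_le_div_of_nonneg_right hl hN0.le)
    have b4 : √(ℓ / N) ≤ r := Real.sqrt_le_sqrt (div_le_div_of_nonneg_right
      (le_mul_of_one_le_left hℓ.le htR) hN0.le)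
    rw [b1, b2, show (2 * lam * (N * √(l / N) + N * √(l / N)) + 4 * (4 * (lam + 1)) *
      (N * √(ℓ / N))) / N = 4 * lam * √(l / N) + 16 * (lam + 1) * √(ℓ / N) by field_simp; ring]
    nlinarith [mul_le_mul_of_nonneg_left b3 hlam, mul_le_mul_of_nonneg_left b4 hlam]
  have h4 : 4 * Real.exp (2 * lam) *
        (2 * lam * (l / √(l / N) + N * √(l / N)) + 4 * (4 * (lam + 1)) * √(N * ℓ)) / N
      ≤ 80 * Real.exp (3 * lam) * r := by
    rw [mul_div_assoc]
    refine (mul_le_mul_of_nonneg_left h3 (by positivity)).trans ?_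
    have c1 : lam + 1 ≤ Real.exp lam := Real.add_one_le_exp lam
    have c2 : Real.exp (3 * lam) = Real.exp (2 * lam) * Real.exp lam := by
      rw [← Real.exp_add]; ring_nf
    rw [c2]
    have c3 := mul_le_mul_of_nonneg_left c1
      (by positivity : 0 ≤ 80 * Real.exp (2 * lam) * r)
    linarith
  set y := 4 * Real.exp (2 * lam) *
        (2 * lam * (l / √(l / N) + N * √(l / N)) + 4 * (4 * (lam + 1)) * √(N * ℓ)) / N
  refine (abs_le_of_sq_le_sq' (b := ε / 4) ?_ (by positivity)).2
  have hy : √y ^ 2 ≤ 80 * Real.exp (3 * lam) * (ε ^ 2 / ((n : ℝ) ^ (2 * t) * K)) := by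
    rcases le_total 0 y with h | h
    · rw [Real.sq_sqrt h]
      exact h4.trans (mul_le_mul_of_nonneg_left hr1 (by positivity))
    · rw [Real.sqrt_eq_zero_of_nonpos h, zero_pow two_ne_zero]
      positivity
  have e2 : (3 / 2 * (n : ℝ) ^ t * (s ^ (t - 1) * Real.exp (2 * lam) ^ (t - 1) * √y)) ^ 2
      = 9 / 4 * (n : ℝ) ^ (2 * t) * (s ^ (2 * (t - 1)) * Real.exp (4 * lam * (t - 1 : ℕ)))
        * √y ^ 2 := by
    rw [← Real.exp_nat_mul, mul_pow, mul_pow, mul_pow, mul_pow, ← pow_mul, ← pow_mul,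
      ← Real.exp_nat_mul]
    rw [mul_comm t 2, mul_comm (t - 1) 2]
    push_cast
    rw [show (2 : ℝ) * (((t - 1 : ℕ) : ℝ) * (2 * lam)) = 4 * lam * ((t - 1 : ℕ) : ℝ) by ring]
    ring
  rw [e2]
  refine (mul_le_mul_of_nonneg_left hy (by positivity)).trans ?_
  have e3 : 9 / 4 * (n : ℝ) ^ (2 * t) * (s ^ (2 * (t - 1)) * Real.exp (4 * lam * (t - 1 : ℕ)))
        * (80 * Real.exp (3 * lam) * (ε ^ 2 / ((n : ℝ) ^ (2 * t) * K)))
      = 180 * (s ^ (2 * (t - 1)) * (Real.exp (4 * lam * (t - 1 : ℕ)) * Real.exp (3 * lam))) / K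
        * ε ^ 2 := by
    field_simp
    ring
  rw [e3]
  have h5 : 180 * (s ^ (2 * (t - 1)) * (Real.exp (4 * lam * (t - 1 : ℕ)) * Real.exp (3 * lam))) / K
      ≤ 1 / 16 := by
    rw [div_le_iff₀ hK0, hK, ← Real.exp_add]
    have d1 : Real.exp (4 * lam * (t - 1 : ℕ) + 3 * lam) ≤ Real.exp (4 * lam * t) := by
      refine Real.exp_le_exp.2 ?_
      rw [Nat.cast_sub ht]
      push_cast
      linarith
    have d2 : 2880 * s ^ (2 * (t - 1)) ≤ s ^ (14 * t) := by
      calc 2880 * s ^ (2 * (t - 1)) ≤ s ^ 12 * s ^ (2 * (t - 1)) := by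
            refine mul_le_mul_of_nonneg_right ?_ (by positivity)
            calc (2880 : ℝ) ≤ 2 ^ 12 := by norm_num
              _ ≤ s ^ 12 := pow_le_pow_left₀ (by norm_num) hs2 _
        _ = s ^ (12 + 2 * (t - 1)) := by rw [pow_add]
        _ ≤ s ^ (14 * t) := pow_le_pow_right₀ hs1 (by omega)
    have d3 := mul_le_mul d2 d1 (Real.exp_pos _).le (by positivity)
    linarith
  calc _ ≤ 1 / 16 * ε ^ 2 := mul_le_mul_of_nonneg_right h5 (by positivity)
    _ = (ε / 4) ^ 2 := by ring

/-- The learned polynomial has no constant term, so the exponents can agree only up to the constant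
`-ψ ∅`, which the normalization removes. -/
theorem abs_learnedPoly_eval_sub_le (q : ℕ) (η lam : ℝ) (Z : Fin N → Cube n)
    (ψ : MultilinearPoly n) (x : Cube n) :
    |(learnedPoly q η lam Z).eval x - ψ.eval x - (-ψ ∅)| ≤ (∑ i, (vertexPoly q η lam Z i
      - (2 : ℝ) • ψ.partialDeriv i : MultilinearPoly n).l1Norm) / 2 := by
  refine le_trans ?_ (sum_abs_learnedPoly_sub_le Z ψ)
  have h : (learnedPoly q η lam Z).eval x - ψ.eval x - (-ψ ∅)
      = ∑ I ∈ Finset.univ.filter (fun I : Finset (Fin n) => I.Nonempty),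
        (learnedPoly q η lam Z I - ψ I) * mono I x := by
    have e : Finset.univ.filter (fun I : Finset (Fin n) => I.Nonempty) = Finset.univ.erase ∅ := by
      ext I; simp [Finset.nonempty_iff_ne_empty]
    have e2 := Finset.add_sum_erase Finset.univ
      (fun I => (learnedPoly q η lam Z I - ψ I) * mono I x) (Finset.mem_univ ∅)
    simp only [learnedPoly_empty, mono_empty] at e2
    rw [e, MultilinearPoly.eval_eq, MultilinearPoly.eval_eq, ← Finset.sum_sub_distrib]
    simp only [← sub_mul]
    linarith
  rw [h]
  refine (Finset.abs_sum_le_sum_abs _ _).trans (Finset.sum_le_sum fun I _ => ?_)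
  rw [abs_mul, abs_mono, mul_one]

/-- Connects the product measure with the weighted finite sums in which the concentration bound is
stated. -/
theorem PMF.real_pi_toMeasure {α : Type*} [Fintype α] [MeasurableSpace α]
    [MeasurableSingletonClass α] (D : PMF α) (T : Set (Fin N → α)) [DecidablePred (· ∈ T)] :
    (Measure.pi fun _ : Fin N => D.toMeasure).real T
      = ∑ Z, (∏ j, (D (Z j)).toReal) * if Z ∈ T then 1 else 0 := by
  have h : ∀ Z : Fin N → α, (Measure.pi fun _ : Fin N => D.toMeasure).real {Z}
      = ∏ j, (D (Z j)).toReal := by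
    intro Z
    rw [measureReal_def, Measure.pi_singleton, ENNReal.toReal_prod]
    refine Finset.prod_congr rfl fun j _ => ?_
    rw [PMF.toMeasure_apply_singleton _ _ (measurableSet_singleton _)]
  have e : T = ((Finset.univ.filter (· ∈ T) : Finset (Fin N → α)) : Set (Fin N → α)) := by
    ext Z; simp
  conv_lhs => rw [e]
  rw [← sum_measureReal_singleton, Finset.sum_filter]
  exact Finset.sum_congr rfl fun Z _ => by rw [h]; split_ifs <;> simp

/-- The distribution with the learned factorization polynomial is close to the sampled Markov
random field, with high probability. -/
theorem learnedPoly_accurate {lam ε ρ : ℝ} {C : ℕ} (hC : 29 ≤ C) (hn : 1 ≤ n) (ht : 1 ≤ t)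
    (hlam : 0 ≤ lam) (hε : 0 < ε) (hε1 : ε < 1 / 2) (hρ : 0 < ρ) (hρ1 : ρ < 1 / 2)
    (hN : (2 * (t : ℝ)) ^ (C * t) * Real.exp (C * lam * t) / ε ^ 4 * (n : ℝ) ^ (4 * t)
            * Real.log ((n : ℝ) / (ρ * ε)) ≤ (N : ℝ))
    (h : IsMRF t G ψ D) (hψ : ∀ i : Fin n, (ψ.partialDeriv i).l1Norm ≤ lam)
    {D' : (Fin N → Cube n) → PMF (Cube n)} (hD' : ∀ Z, ∃ c : ℝ, 0 < c ∧ ∀ x,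
      (D' Z x).toReal = c * Real.exp ((learnedPoly (t - 1) (learningRate n t N) lam Z).eval x)) :
    ENNReal.ofReal (1 - ρ) ≤ (Measure.pi fun _ : Fin N => D.toMeasure)
      {Z | ∀ x : Cube n, (1 - ε) * (D' Z x).toReal ≤ (D x).toReal ∧
        (D x).toReal ≤ (1 + ε) * (D' Z x).toReal} := by
  classical
  have htR : (1 : ℝ) ≤ t := by exact_mod_cast ht
  have hnR : (1 : ℝ) ≤ n := by exact_mod_cast hn
  -- Then `exp (-ℓ) = ρ / n`, which suits a union bound over the vertices.
  set ℓ := Real.log (n / ρ) with hℓ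
  set l := Real.log (2 * (n ^ (t - 1) : ℕ)) with hl
  have hℓ2 : Real.log 2 + Real.log n ≤ ℓ := by
    rw [← Real.log_mul two_ne_zero (by positivity), hℓ]
    refine Real.log_le_log (by positivity) ?_
    rw [le_div_iff₀ hρ]
    nlinarith
  have hlog2 := Real.log_pos one_lt_two
  have hlogn : 0 ≤ Real.log n := Real.log_nonneg hnR
  have hℓ0 : 0 < ℓ := by linarith
  have hl_eq : l = Real.log 2 + (t - 1) * Real.log n := by
    rw [hl, Nat.cast_pow, Real.log_mul two_ne_zero (by positivity), Real.log_pow, Nat.cast_sub ht]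
    push_cast
    ring
  have hl0 : 0 < l := by
    rw [hl_eq]; nlinarith
  have hlℓ : l ≤ t * ℓ := by
    rw [hl_eq]; nlinarith
  have hN29 : (2 * (t : ℝ)) ^ (29 * t) * Real.exp (29 * lam * t) / ε ^ 4 * (n : ℝ) ^ (4 * t) * ℓ
      ≤ N := by
    refine le_trans ?_ hN
    have hCR : (29 : ℝ) ≤ C := by exact_mod_cast hC
    refine mul_le_mul (mul_le_mul_of_nonneg_right (div_le_div_of_nonneg_right (mul_le_mul
      (pow_le_pow_right₀ (by linarith) (Nat.mul_le_mul_right t hC)) (Real.exp_le_exp.2 ?_)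
      (Real.exp_pos _).le (by positivity)) (by positivity)) (by positivity)) ?_ hℓ0.le
      (by positivity)
    · exact mul_le_mul_of_nonneg_right (mul_le_mul_of_nonneg_right hCR hlam) (by positivity)
    · refine Real.log_le_log (by positivity) ?_
      refine div_le_div_of_nonneg_left (by positivity) (by positivity) ?_
      exact mul_le_of_le_one_right hρ.le (by linarith)
  obtain ⟨hNℓ, herr⟩ := error_le_of_sample_size hn ht hlam hε hε1 hℓ0 hl0 hlℓ hN29
  have hN0 : (0 : ℝ) < N := lt_of_lt_of_le (by positivity) hNℓ
  have hN0' : 0 < N := by exact_mod_cast hN0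
  set η := learningRate n t N with hη
  have hη_eq : η = √(l / N) := rfl
  have hη0 : 0 < η := Real.sqrt_pos.2 (by positivity)
  have hη1 : η ≤ 1 := by
    rw [hη_eq]
    exact Real.sqrt_le_iff.2 ⟨zero_le_one, by rw [one_pow, div_le_one hN0]; exact hlℓ.trans hNℓ⟩
  set dev : (Fin N → Cube n) → Fin n → ℝ := fun Z i =>
    ∑ j : Fin N, (∑ x, (D x).toReal * vertexExcess (t - 1) η lam i (ψ.partialDeriv i)
        (lossTable (t - 1) η lam Z j i) x - vertexExcess (t - 1) η lam i (ψ.partialDeriv i)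
        (lossTable (t - 1) η lam Z j i) (Z j)) with hdev
  set b := 4 * (4 * (lam + 1)) * √(N * ℓ) with hb
  set good := {Z | ∀ x : Cube n, (1 - ε) * (D' Z x).toReal ≤ (D x).toReal ∧
        (D x).toReal ≤ (1 + ε) * (D' Z x).toReal} with hgood
  -- small deviations suffice
  have hgood' : ∀ Z, (∀ i, dev Z i ≤ b) → Z ∈ good := by
    intro Z hZ
    have g1 : ∀ i, (vertexPoly (t - 1) η lam Z i
        - (2 : ℝ) • ψ.partialDeriv i : MultilinearPoly n).l1Norm ≤ 2 * ((ε / 4) / n) := by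
      intro i
      have k1 := sum_abs_vertexPoly_sub_le h hlam hη0 hη1 i (hψ i) Z hN0' (hZ i)
      refine (l1Norm_vertexPoly_sub_le h hlam ht hψ i Z k1).trans ?_
      rw [hη_eq, ← hl, hb]
      rw [mul_div_assoc', le_div_iff₀ (by positivity)]
      have k2 : (n : ℝ) ^ t = (n : ℝ) ^ (t - 1) * n := by
        rw [← pow_succ, Nat.sub_add_cancel ht]
      rw [k2] at herr
      linarith
    have g2 : ∀ x, |(learnedPoly (t - 1) η lam Z).eval x - ψ.eval x - (-ψ ∅)| ≤ ε / 4 := by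
      intro x
      refine (abs_learnedPoly_eval_sub_le _ _ _ _ _ _).trans ?_
      have := Finset.sum_le_sum fun i (_ : i ∈ Finset.univ) => g1 i
      rw [Finset.sum_const, Finset.card_univ, Fintype.card_fin, nsmul_eq_mul] at this
      have e : (n : ℝ) * (2 * (ε / 4 / n)) = 2 * (ε / 4) := by field_simp
      linarith
    obtain ⟨c', hc', hD'⟩ := hD' Z
    obtain ⟨S, ψI, -, -, -, c, hc, hD⟩ := h
    intro x
    have hp := PMF.sum_toReal_eq_one D
    have hp' := PMF.sum_toReal_eq_one (D' Z)
    have r1 := gibbs_le_of_abs_sub_le hp hp' hc hc' hD hD' g2 x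
    have r2 := gibbs_le_of_abs_sub_le hp' hp hc' hc hD' hD (a := -(-ψ ∅)) (τ := ε / 4)
      (fun x => by rw [← abs_neg]; convert g2 x using 2; ring) x
    have r3 : Real.exp (2 * (ε / 4)) ≤ 1 + ε := by
      have := exp_le_one_add_add_sq (x := 2 * (ε / 4)) (by rw [abs_of_pos (by positivity)]; linarith)
      nlinarith
    have p1 : 0 ≤ (D' Z x).toReal := ENNReal.toReal_nonneg
    have p2 : 0 ≤ (D x).toReal := ENNReal.toReal_nonneg
    refine ⟨?_, r1.trans (mul_le_mul_of_nonneg_right r3 p1)⟩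
    -- The lower bound comes from the comparison in the other direction and `(1 - ε) * (1 + ε) ≤ 1`.
    have r4 := mul_le_mul_of_nonneg_left (r2.trans (mul_le_mul_of_nonneg_right r3 p2))
      (by linarith : 0 ≤ 1 - ε)
    nlinarith [mul_nonneg (sq_nonneg ε) p2]
  -- the probability of a large deviation
  have hbad : ∀ i, ∑ Z : Fin N → Cube n, (∏ j, (D (Z j)).toReal) * (if b ≤ dev Z i then 1 else 0)
      ≤ ρ / n := by
    intro i
    have k := azuma_trajectory (N := N) (w := fun x => (D x).toReal) (fun _ => ENNReal.toReal_nonneg)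
      (PMF.sum_toReal_eq_one D) (vertexStep (t - 1) η lam i) 0
      (Q := vertexExcess (t - 1) η lam i (ψ.partialDeriv i)) (B := 4 * (lam + 1)) (ℓ := ℓ)
      (by positivity) (fun s a => abs_vertexExcess_le hlam i (hψ i) s a) hℓ0.le hN0'
      ((le_mul_of_one_le_left hℓ0.le htR).trans hNℓ)
    refine k.trans (le_of_eq ?_)
    rw [hℓ, ← Real.log_inv, Real.exp_log (by positivity), inv_div]
  have hcompl : (Measure.pi fun _ : Fin N => D.toMeasure).real goodᶜ ≤ ρ := by
    rw [PMF.real_pi_toMeasure]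
    calc ∑ Z, (∏ j, (D (Z j)).toReal) * (if Z ∈ goodᶜ then 1 else 0)
        ≤ ∑ Z, ∑ i : Fin n, (∏ j, (D (Z j)).toReal) * (if b ≤ dev Z i then 1 else 0) := by
          refine Finset.sum_le_sum fun Z _ => ?_
          rw [← Finset.mul_sum]
          refine mul_le_mul_of_nonneg_left ?_ (Finset.prod_nonneg fun _ _ => ENNReal.toReal_nonneg)
          split_ifs with hZ
          · obtain ⟨i, hi⟩ : ∃ i, b ≤ dev Z i := by
              by_contra! hc
              exact hZ (hgood' Z fun i => (hc i).le)
            refine le_trans (le_of_eq (if_pos hi).symm) (Finset.single_le_sum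
              (f := fun i => if b ≤ dev Z i then (1 : ℝ) else 0)
              (fun i _ => by positivity) (Finset.mem_univ i))
          · exact Finset.sum_nonneg fun i _ => by positivity
      _ = ∑ i : Fin n, ∑ Z : Fin N → Cube n, (∏ j, (D (Z j)).toReal) *
            (if b ≤ dev Z i then 1 else 0) := Finset.sum_comm
      _ ≤ ∑ i : Fin n, ρ / n := Finset.sum_le_sum fun i _ => hbad i
      _ = ρ := by
          rw [Finset.sum_const, Finset.card_univ, Fintype.card_fin, nsmul_eq_mul]
          field_simp
  have hmeas : MeasurableSet good := (Set.toFinite good).measurableSet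
  rw [ENNReal.ofReal_le_iff_le_toReal (measure_ne_top _ _), ← measureReal_def]
  have := probReal_compl_eq_one_sub (μ := Measure.pi fun _ : Fin N => D.toMeasure) hmeas
  linarith

end Accuracy

/-! ### Reasoning about programs -/

namespace RealRAM

namespace State

@[simp] theorem nats_setNat_self (s : State) (a i v : ℕ) :
    (s.setNat a i v).nats a = Function.update (s.nats a) i v := by simp [setNat]

@[simp] theorem nats_setNat_of_ne (s : State) {a b : ℕ} (h : b ≠ a) (i v : ℕ) :
    (s.setNat a i v).nats b = s.nats b := by simp [setNat, h]

@[simp] theorem reals_setNat (s : State) (a i v : ℕ) : (s.setNat a i v).reals = s.reals := rfl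

@[simp] theorem reals_setReal_self (s : State) (a i : ℕ) (v : ℝ) :
    (s.setReal a i v).reals a = Function.update (s.reals a) i v := by simp [setReal]

@[simp] theorem reals_setReal_of_ne (s : State) {a b : ℕ} (h : b ≠ a) (i : ℕ) (v : ℝ) :
    (s.setReal a i v).reals b = s.reals b := by simp [setReal, h]

@[simp] theorem nats_setReal (s : State) (a i : ℕ) (v : ℝ) : (s.setReal a i v).nats = s.nats := rfl

end State

/-- The word variable `a`: cell `0` of the word array `a`. -/
def word (a : ℕ) : NExpr := .get a (.lit 0)

/-- The real variable `a`: cell `0` of the real array `a`. -/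
def reg (a : ℕ) : RExpr := .get a (.lit 0)

/-- `for a = 0, …, b - 1 do p`. -/
def forLoop (a : ℕ) (b : NExpr) (p : Prog) : Prog :=
  .seq (.setNat a (.lit 0) (.lit 0)) (.while (.natLE (.add (word a) (.lit 1)) b)
    (.seq p (.setNat a (.lit 0) (.add (word a) (.lit 1)))))

/-- Started in `s`, the program `p` halts after at most `K` steps in a state that satisfies `Q`. -/
def Ends (W : ℕ) (p : Prog) (s : State) (K : ℕ) (Q : State → Prop) : Prop :=
  ∃ k s', Exec W p s k s' ∧ k ≤ K ∧ Q s'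

section Ends

variable {W K K₁ K₂ a : ℕ} {p q : Prog} {s : State} {Q R : State → Prop} {i : NExpr}

theorem Ends.mono (h : Ends W p s K₁ R) (hK : K₁ ≤ K₂) (hQ : ∀ s', R s' → Q s') :
    Ends W p s K₂ Q := by
  obtain ⟨k, s', he, hk, hR⟩ := h
  exact ⟨k, s', he, hk.trans hK, hQ s' hR⟩

theorem Ends.skip (hQ : Q s) : Ends W .skip s 1 Q := ⟨1, s, .skip s, le_rfl, hQ⟩

theorem Ends.seq (hp : Ends W p s K₁ R) (hq : ∀ s', R s' → Ends W q s' K₂ Q) :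
    Ends W (.seq p q) s (K₁ + K₂) Q := by
  obtain ⟨k, s', he, hk, hR⟩ := hp
  obtain ⟨l, s'', he', hl, hQ⟩ := hq s' hR
  exact ⟨k + l, s'', .seq he he', add_le_add hk hl, hQ⟩

theorem Ends.setNat {e : NExpr} {iv ev : ℕ} (hi : i.Fits W s) (he : e.Fits W s)
    (hiv : i.eval s = iv) (hev : e.eval s = ev) (hQ : Q (s.setNat a iv ev)) :
    Ends W (.setNat a i e) s (i.cost + e.cost + 1) Q := by
  subst hiv hev
  exact ⟨_, _, .setNat s a i e hi he, le_rfl, hQ⟩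

theorem Ends.setReal {e : RExpr} {iv : ℕ} {ev : ℝ} (hi : i.Fits W s) (he : e.Fits W s)
    (hiv : i.eval s = iv) (hev : e.eval s = ev) (hQ : Q (s.setReal a iv ev)) :
    Ends W (.setReal a i e) s (i.cost + e.cost + 1) Q := by
  subst hiv hev
  exact ⟨_, _, .setReal s a i e hi he, le_rfl, hQ⟩

theorem Ends.setNat_seq {e : NExpr} {iv ev : ℕ} (hi : i.Fits W s) (he : e.Fits W s)
    (hiv : i.eval s = iv) (hev : e.eval s = ev) (hq : Ends W q (s.setNat a iv ev) K Q) :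
    Ends W (.seq (.setNat a i e) q) s (i.cost + e.cost + 1 + K) Q :=
  Ends.seq (R := fun s' => s' = s.setNat a iv ev) (.setNat hi he hiv hev rfl)
    (by rintro _ rfl; exact hq)

theorem Ends.setReal_seq {e : RExpr} {iv : ℕ} {ev : ℝ} (hi : i.Fits W s) (he : e.Fits W s)
    (hiv : i.eval s = iv) (hev : e.eval s = ev) (hq : Ends W q (s.setReal a iv ev) K Q) :
    Ends W (.seq (.setReal a i e) q) s (i.cost + e.cost + 1 + K) Q :=
  Ends.seq (R := fun s' => s' = s.setReal a iv ev) (.setReal hi he hiv hev rfl)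
    (by rintro _ rfl; exact hq)

theorem Ends.ite {b : Test} (hf : b.Fits W s) (hp : b.Holds s → Ends W p s K Q)
    (hq : ¬ b.Holds s → Ends W q s K Q) : Ends W (.ite b p q) s (b.cost + K) Q := by
  by_cases hb : b.Holds s
  · obtain ⟨k, s', he, hk, hQ⟩ := hp hb
    exact ⟨_, s', .iteTrue hf hb he, Nat.add_le_add_left hk _, hQ⟩
  · obtain ⟨k, s', he, hk, hQ⟩ := hq hb
    exact ⟨_, s', .iteFalse hf hb he, Nat.add_le_add_left hk _, hQ⟩

/-- The invariant rule for loops. -/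
theorem Ends.forLoop {b : NExpr} {B : ℕ} (Inv : ℕ → State → Prop) (h0 : Inv 0 (s.setNat a 0 0))
    (hW : B + 1 ≤ W)
    (hb : ∀ j s', j ≤ B → Inv j s' → s'.nats a 0 = j → b.Fits W s' ∧ b.eval s' = B)
    (hp : ∀ j s', j < B → Inv j s' → s'.nats a 0 = j →
      Ends W p s' K fun s'' => s''.nats a 0 = j ∧ Inv (j + 1) (s''.setNat a 0 (j + 1)))
    (hQ : ∀ s', Inv B s' → Q s') :
    Ends W (forLoop a b p) s (B * (K + b.cost + 11) + b.cost + 8) Q := by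
  -- Induction on the number `d` of remaining rounds. Apart from `K` and the cost of `b`, a round
  -- takes `5` steps for the test and `6` for the increment.
  have hloop : ∀ d j s', j + d = B → Inv j s' → s'.nats a 0 = j →
      Ends W (.while (.natLE (.add (word a) (.lit 1)) b)
        (.seq p (.setNat a (.lit 0) (.add (word a) (.lit 1))))) s'
        (d * (K + b.cost + 11) + b.cost + 5) Q := by
    intro d
    induction d with
    | zero =>
      intro j s' hj hI hc
      obtain rfl : j = B := by omega
      obtain ⟨hbf, hbe⟩ := hb j s' le_rfl hI hc
      refine ⟨_, s', .whileFalse ?_ ?_, ?_, hQ s' hI⟩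
      · simp only [Test.Fits, NExpr.Fits, NExpr.eval, word, hc]
        exact ⟨⟨⟨by omega, by omega⟩, by omega, by omega⟩, hbf⟩
      · simp only [Test.Holds, NExpr.eval, word, hc, hbe]
        omega
      · simp only [Test.cost, NExpr.cost, word]
        omega
    | succ d ih =>
      intro j s' hj hI hc
      obtain ⟨hbf, hbe⟩ := hb j s' (by omega) hI hc
      obtain ⟨k, s'', he, hk, hc', hI'⟩ := hp j s' (by omega) hI hc
      obtain ⟨l, s''', he', hl, hR⟩ := ih (j + 1) _ (by omega) hI' (by simp)
      refine ⟨_, s''', .whileTrue ?_ ?_ (.seq he (.setNat _ _ _ _ ?_ ?_))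
        (by simp only [NExpr.eval, word, hc']; exact he'), ?_, hR⟩
      · simp only [Test.Fits, NExpr.Fits, NExpr.eval, word, hc]
        exact ⟨⟨⟨by omega, by omega⟩, by omega, by omega⟩, hbf⟩
      · simp only [Test.Holds, NExpr.eval, word, hc, hbe]
        omega
      · simp only [NExpr.Fits]; omega
      · simp only [NExpr.Fits, NExpr.eval, word, hc']; omega
      · simp only [Test.cost, NExpr.cost, word]
        rw [add_mul, one_mul]
        omega
  refine (Ends.setNat_seq (iv := 0) (ev := 0) ?_ ?_ rfl rfl
    (hloop B 0 _ (by omega) h0 (by simp))).mono ?_ fun _ h => h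
  · simp [NExpr.Fits]
  · simp [NExpr.Fits]
  · simp only [NExpr.cost]
    omega

end Ends

/-! ### The program -/

/-- `1` if `e` is positive and `0` otherwise. -/
def NExpr.sign (e : NExpr) : NExpr := .sub (.lit 1) (.sub (.lit 1) e)

/-- `e % f`. -/
def NExpr.mod (e f : NExpr) : NExpr := .sub e (.mul (.div e f) f)

/-- The variable that is selected by the digit `d` when the variable `i` is excluded. -/
def NExpr.select (d i : NExpr) : NExpr := .mul d (NExpr.sign (.add (.sub d i) (.sub i d)))

/-- `1 / e - e` -/
def RExpr.invSub (e : RExpr) : RExpr := .sub (.div (.ofNat (.lit 1)) e) e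

/-- `1 / e + e` -/
def RExpr.invAdd (e : RExpr) : RExpr := .add (.div (.ofNat (.lit 1)) e) e

section ExprLemmas

variable {W : ℕ} {s : State}

@[simp] theorem eval_word (a : ℕ) : (word a).eval s = s.nats a 0 := rfl

@[simp] theorem fits_word (a : ℕ) : (word a).Fits W s ↔ s.nats a 0 ≤ W := by
  simp [word, NExpr.Fits, NExpr.eval]

@[simp] theorem eval_reg (a : ℕ) : (reg a).eval s = s.reals a 0 := rfl

@[simp] theorem fits_reg (a : ℕ) : (reg a).Fits W s := by simp [reg, RExpr.Fits, NExpr.Fits]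

@[simp] theorem eval_sign (e : NExpr) : e.sign.eval s = min (e.eval s) 1 := by
  simp only [NExpr.sign, NExpr.eval]
  omega

@[simp] theorem fits_sign (e : NExpr) : e.sign.Fits W s ↔ 1 ≤ W ∧ e.Fits W s := by
  simp only [NExpr.sign, NExpr.Fits]
  tauto

@[simp] theorem eval_mod (e f : NExpr) : (e.mod f).eval s = e.eval s % f.eval s := by
  simp only [NExpr.mod, NExpr.eval]
  rw [Nat.mod_eq_sub_div_mul]

theorem fits_mod {e f : NExpr} (he : e.Fits W s) (hf : f.Fits W s) (h : e.eval s ≤ W) :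
    (e.mod f).Fits W s := by
  simp only [NExpr.mod, NExpr.Fits, NExpr.eval]
  exact ⟨he, ⟨he, hf⟩, hf, (Nat.div_mul_le_self _ _).trans h⟩

@[simp] theorem eval_select (d i : NExpr) :
    (NExpr.select d i).eval s = if d.eval s = i.eval s then 0 else d.eval s := by
  simp only [NExpr.select, NExpr.eval, eval_sign]
  by_cases h : d.eval s = i.eval s
  · simp [h]
  · rw [if_neg h, Nat.min_eq_right (by omega), mul_one]

theorem fits_select {d i : NExpr} (hd : d.Fits W s) (hi : i.Fits W s) (hd' : d.eval s ≤ W)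
    (hi' : i.eval s ≤ W) (hW : 1 ≤ W) : (NExpr.select d i).Fits W s := by
  simp only [NExpr.select, NExpr.Fits, NExpr.eval, fits_sign, eval_sign]
  refine ⟨hd, ⟨hW, ⟨hd, hi⟩, ⟨hi, hd⟩, by omega⟩, ?_⟩
  exact (Nat.mul_le_mul_left _ (Nat.min_le_right _ _)).trans (by rwa [mul_one])

@[simp] theorem eval_invSub (e : RExpr) : e.invSub.eval s = (e.eval s)⁻¹ - e.eval s := by
  simp [RExpr.invSub, RExpr.eval, NExpr.eval]

@[simp] theorem eval_invAdd (e : RExpr) : e.invAdd.eval s = (e.eval s)⁻¹ + e.eval s := by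
  simp [RExpr.invAdd, RExpr.eval, NExpr.eval]

@[simp] theorem fits_invSub (e : RExpr) : e.invSub.Fits W s ↔ 1 ≤ W ∧ e.Fits W s := by
  simp only [RExpr.invSub, RExpr.Fits, NExpr.Fits]
  tauto

@[simp] theorem fits_invAdd (e : RExpr) : e.invAdd.Fits W s ↔ 1 ≤ W ∧ e.Fits W s := by
  simp only [RExpr.invAdd, RExpr.Fits, NExpr.Fits]
  tauto

end ExprLemmas

end RealRAM

/-! ### The programs for initialization and for one sample. -/

namespace RealRAM

/-- The index `i * M + m` of the monomial `m` for the vertex `i`. -/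
def rowIndex : NExpr := .add (.mul (word 5) (word 4)) (word 6)

/-- Word array `4` receives the number of monomials, real array `6` the step size. -/
def initProg : Prog :=
  .seq (.setNat 4 (.lit 0) (.lit 1)) (.seq
    (forLoop 5 (.sub (.get 0 (.lit 1)) (.lit 1)) (.setNat 4 (.lit 0) (.mul (word 4) (word 0))))
    (.setReal 6 (.lit 0)
      (.sqrt (.div (.log (.ofNat (.mul (.lit 2) (word 4)))) (.get 0 (.lit 3))))))

/-- Compute the value of the monomial in real array `5`, and add its part of the prediction and
of the potential to the real variables `7` and `8`. -/
def predictBody : Prog :=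
  .seq (.setNat 7 (.lit 0) (.mod (word 6) (word 0))) (.seq
    (.setReal 5 (word 6) (.mul (.get 5 (.div (word 6) (word 0)))
      (.add (.mul (.ofNat (.sign (word 7))) (.get 1 (.select (word 7) (word 5))))
        (.sub (.ofNat (.lit 1)) (.ofNat (.sign (word 7))))))) (.seq
    (.setReal 9 (.lit 0) (.exp (.mul (reg 6) (.get 3 rowIndex)))) (.seq
    (.setReal 7 (.lit 0) (.add (reg 7) (.mul (.invSub (reg 9)) (.get 5 (word 6)))))
    (.setReal 8 (.lit 0) (.add (reg 8) (.invAdd (reg 9)))))))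

/-- Update real array `4`, the sums of the weights, and real array `3`, the cumulative losses. -/
def updateBody : Prog :=
  .seq (.setReal 9 (.lit 0) (.exp (.mul (reg 6) (.get 3 rowIndex)))) (.seq
    (.setReal 4 rowIndex (.add (.get 4 rowIndex) (.div (.invSub (reg 9)) (reg 8))))
    (.setReal 3 rowIndex (.add (.get 3 rowIndex) (.mul (reg 10) (.get 5 (word 6))))))

/-- The real variable `10` receives the difference of the predicted and the observed value. -/
def gradProg : Prog :=
  .setReal 10 (.lit 0) (.sub
    (.div (.ofNat (.lit 1)) (.add (.ofNat (.lit 1)) (.exp (.sub (.ofNat (.lit 0))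
      (.mul (.mul (.ofNat (.lit 2)) (reg 0)) (.div (reg 7) (reg 8)))))))
    (.div (.add (.get 1 (word 5)) (.ofNat (.lit 1))) (.ofNat (.lit 2))))

/-- Process the current sample for one vertex. -/
def vertexProg : Prog :=
  .seq (.setReal 7 (.lit 0) (.ofNat (.lit 0))) (.seq
    (.setReal 8 (.lit 0) (.ofNat (.lit 0))) (.seq
    (.setReal 5 (.lit 0) (.ofNat (.lit 1))) (.seq
    (forLoop 6 (word 4) predictBody) (.seq
    gradProg
    (forLoop 6 (word 4) updateBody)))))

/-- Process the current sample. -/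
def stepProg : Prog := forLoop 5 (word 0) vertexProg

/-- The states `s₀` and `s` agree on the parameters, the sample and the output. -/
structure SameInput (s₀ s : State) : Prop where
  nats0 : s.nats 0 = s₀.nats 0
  nats1 : s.nats 1 = s₀.nats 1
  nats2 : s.nats 2 = s₀.nats 2
  nats3 : s.nats 3 = s₀.nats 3
  nats4 : s.nats 4 = s₀.nats 4
  reals0 : s.reals 0 = s₀.reals 0
  reals1 : s.reals 1 = s₀.reals 1
  reals6 : s.reals 6 = s₀.reals 6

section Vertex

variable {n : ℕ}

theorem tupleSet_zero_right (i : Fin n) (q : ℕ) : tupleSet i q 0 = ∅ := by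
  induction q with
  | zero => rfl
  | succ q ih => simp [tupleSet, ih, digitSet_zero]

theorem mono_digitSet (i : Fin n) {d : ℕ} (hd : d < n) (x : Cube n) {y : ℕ → ℝ}
    (hy : ∀ j : Fin n, y j = ((x j : ℤ) : ℝ)) :
    mono (digitSet i d) x = ((min d 1 : ℕ) : ℝ) * y (if d = i then 0 else d)
      + (1 - ((min d 1 : ℕ) : ℝ)) := by
  rcases Nat.eq_zero_or_pos d with rfl | h0
  · simp [digitSet_zero, mono_empty]
  · have hj : (if d = i then 0 else d) < n := by split_ifs <;> omega
    rw [digitSet_eq_singleton (j := ⟨_, hj⟩) h0.ne' rfl, mono_singleton, Nat.min_eq_right h0, ← hy]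
    simp

variable {q W : ℕ} {η lam : ℝ} {s₀ : State} {i : Fin n} {x : Cube n} {L : ℕ → ℝ}

/-- One pass fills the table of monomials and accumulates both the potential and the unnormalized
prediction; dividing once afterwards avoids a second pass. -/
theorem predictLoop_ends (h0 : s₀.nats 0 0 = n) (h4 : s₀.nats 4 0 = n ^ q) (h5 : s₀.nats 5 0 = i)
    (hx : ∀ j : Fin n, s₀.reals 1 j = ((x j : ℤ) : ℝ)) (h6 : s₀.reals 6 0 = η)
    (hW : n * n ^ q + 1 ≤ W) (hL : ∀ m < n ^ q, s₀.reals 3 (i * n ^ q + m) = L m)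
    (hA : s₀.reals 7 0 = 0) (hS : s₀.reals 8 0 = 0) (hF : s₀.reals 5 0 = 1) :
    Ends W (forLoop 6 (word 4) predictBody) s₀ (n ^ q * 200 + 20) fun s =>
      SameInput s₀ s ∧ s.nats 5 = s₀.nats 5 ∧ s.reals 3 = s₀.reals 3 ∧ s.reals 4 = s₀.reals 4 ∧
      (∀ m < n ^ q, s.reals 5 m = mono (tupleSet i q m) x) ∧
      s.reals 8 0 = hedgePotential (n ^ q) η L ∧
      s.reals 7 0 = hedgePotential (n ^ q) η L *
        ∑ m ∈ Finset.range (n ^ q), hedgeWeight (n ^ q) η L m * mono (tupleSet i q m) x := by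
  have hn : 0 < n := i.pos
  have hM : 0 < n ^ q := Nat.pow_pos hn
  have hMW : n ^ q ≤ n * n ^ q := Nat.le_mul_of_pos_left _ hn
  have hnW : n ≤ n * n ^ q := Nat.le_mul_of_pos_right _ hM
  have hi1 : ((i : ℕ) + 1) * n ^ q ≤ n * n ^ q := Nat.mul_le_mul_right _ i.2
  rw [add_mul, one_mul] at hi1
  refine (Ends.forLoop (B := n ^ q) (K := 184) (fun j s =>
      SameInput s₀ s ∧ s.nats 5 = s₀.nats 5 ∧ s.reals 3 = s₀.reals 3 ∧ s.reals 4 = s₀.reals 4 ∧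
      s.reals 5 0 = 1 ∧ (∀ m < j, s.reals 5 m = mono (tupleSet i q m) x) ∧
      s.reals 8 0 = ∑ m ∈ Finset.range j, (Real.exp (-(η * L m)) + Real.exp (η * L m)) ∧
      s.reals 7 0 = ∑ m ∈ Finset.range j, (Real.exp (-(η * L m)) - Real.exp (η * L m))
        * mono (tupleSet i q m) x) ?_ ?_ ?_ ?_ ?_).mono ?_ fun _ h => h
  · refine ⟨⟨?_, ?_, ?_, ?_, ?_, ?_, ?_, ?_⟩, ?_⟩ <;> simp [hA, hS, hF]
  · omega
  · rintro j s' hj ⟨hin, -⟩ -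
    simp only [fits_word, eval_word, hin.nats4, h4, and_true]
    omega
  · rintro j s hj ⟨hin, hn5, hr3, hr4, hF0, hF, hS, hA⟩ hc
    have hd : j % n < n := Nat.mod_lt _ hn
    have hdiv : j / n ≤ j := Nat.div_le_self _ _
    have hi := i.2
    have hv : (if j % n = (i : ℕ) then 0 else j % n) ≤ n := by split_ifs <;> omega
    have hmod : j / n * n ≤ j := Nat.div_mul_le_self _ _
    -- For `j > 0` the entry `j / n` has been written already, since `n = 1` would leave only `j =
    -- 0`. For `j = 0` the entry is the cell initialized to `1`.
    have hprev : s.reals 5 (j / n) = mono (tupleSet i q (j / n)) x := by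
      rcases Nat.eq_zero_or_pos j with rfl | h
      · simp [hF0, tupleSet_zero_right, mono_empty]
      · refine hF _ (Nat.div_lt_self h ?_)
        by_contra hn1
        obtain rfl : n = 1 := by omega
        simp at hj
        omega
    have hFj : mono (tupleSet i q j) x = s.reals 5 (j / n) * (((min (j % n) 1 : ℕ) : ℝ) *
        s₀.reals 1 (if j % n = i then 0 else j % n) + (1 - ((min (j % n) 1 : ℕ) : ℝ))) := by
      rw [mono_tupleSet_eq i hj, mono_digitSet i hd x hx, hprev, mul_comm]
    refine Ends.mono (Ends.setNat_seq (iv := 0) (ev := j % n) ?_ ?_ rfl ?_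
      (Ends.setReal_seq (iv := j) (ev := mono (tupleSet i q j) x) ?_ ?_ ?_ ?_
      (Ends.setReal_seq (iv := 0) (ev := Real.exp (η * L j)) ?_ ?_ rfl ?_
      (Ends.setReal_seq (iv := 0) ?_ ?_ rfl rfl
      (Ends.setReal (iv := 0) ?_ ?_ rfl rfl ?post))))) ?cost (fun _ h => h)
    case post =>
      refine ⟨by simp [hc], ⟨?_, ?_, ?_, ?_, ?_, ?_, ?_, ?_⟩, ?_, ?_, ?_, ?_, ?_, ?_, ?_⟩
      · simp [hin.nats0]
      · simp [hin.nats1]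
      · simp [hin.nats2]
      · simp [hin.nats3]
      · simp [hin.nats4]
      · simp [hin.reals0]
      · simp [hin.reals1]
      · simp [hin.reals6]
      · simp [hn5]
      · simp [hr3]
      · simp [hr4]
      · rcases Nat.eq_zero_or_pos j with rfl | h
        · simp [tupleSet_zero_right, mono_empty]
        · simp [h.ne, hF0]
      · intro m hm
        rcases Nat.lt_succ_iff_lt_or_eq.1 hm with h | rfl
        · simp [h.ne, hF m h]
        · simp
      · rw [Finset.sum_range_succ, ← hS, Real.exp_neg]
        simp [RExpr.eval]
      · rw [Finset.sum_range_succ, ← hA, Real.exp_neg]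
        simp [RExpr.eval, hc]
    case cost =>
      simp only [NExpr.cost, RExpr.cost, word, reg, rowIndex, NExpr.mod, NExpr.sign, NExpr.select,
        RExpr.invSub, RExpr.invAdd]
      norm_num
    all_goals try simp [NExpr.Fits, RExpr.Fits, NExpr.eval, RExpr.eval, rowIndex, hc,
      hin.nats0, hin.nats4, hin.reals1, hin.reals6, hn5, hr3, h0, h4, h5, h6]
    · refine fits_mod ?_ ?_ ?_ <;> simp [hc, hin.nats0, h0] <;> omega
    · omega
    · refine ⟨by omega, ⟨⟨by omega, by omega⟩, fits_select ?_ ?_ ?_ ?_ ?_⟩, by omega, by omega⟩ <;>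
        first | omega | (simp [hn5, h5]; omega)
    · rw [hFj]
      push_cast
      ring
    · omega
    · exact Or.inl (hL j hj)
    · omega
    · omega
  · rintro s ⟨hin, hn5, hr3, hr4, hF0, hF, hS, hA⟩
    refine ⟨hin, hn5, hr3, hr4, hF, hS, ?_⟩
    rw [hA, Finset.mul_sum]
    refine Finset.sum_congr rfl fun m _ => ?_
    have := hedgePotential_pos hM η L
    rw [hedgeWeight]
    field_simp
  · simp only [NExpr.cost, word]
    omega

/-- The potential of the old losses stays in the real variable `8`, and each weight is recorded
before its own loss changes, so all recorded weights belong to the same old loss vector. -/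
theorem updateLoop_ends (h4 : s₀.nats 4 0 = n ^ q) (h5 : s₀.nats 5 0 = i)
    (h6 : s₀.reals 6 0 = η) (hW : n * n ^ q + 1 ≤ W) {g : ℝ} {f : ℕ → ℝ}
    (hL : ∀ m < n ^ q, s₀.reals 3 (i * n ^ q + m) = L m) (hF : ∀ m < n ^ q, s₀.reals 5 m = f m)
    (hS : s₀.reals 8 0 = hedgePotential (n ^ q) η L) (hg : s₀.reals 10 0 = g) :
    Ends W (forLoop 6 (word 4) updateBody) s₀ (n ^ q * 200 + 20) fun s =>
      SameInput s₀ s ∧ s.nats 5 = s₀.nats 5 ∧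
      (∀ m < n ^ q, s.reals 3 (i * n ^ q + m) = L m + g * f m ∧ s.reals 4 (i * n ^ q + m)
        = s₀.reals 4 (i * n ^ q + m) + hedgeWeight (n ^ q) η L m) ∧
      ∀ k, (∀ m < n ^ q, k ≠ i * n ^ q + m) →
        s.reals 3 k = s₀.reals 3 k ∧ s.reals 4 k = s₀.reals 4 k := by
  have hn : 0 < n := i.pos
  have hM : 0 < n ^ q := Nat.pow_pos hn
  have hMW : n ^ q ≤ n * n ^ q := Nat.le_mul_of_pos_left _ hn
  have hnW : n ≤ n * n ^ q := Nat.le_mul_of_pos_right _ hM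
  have hi := i.2
  have hi1 : ((i : ℕ) + 1) * n ^ q ≤ n * n ^ q := Nat.mul_le_mul_right _ i.2
  rw [add_mul, one_mul] at hi1
  refine (Ends.forLoop (B := n ^ q) (K := 184) (fun j s =>
      SameInput s₀ s ∧ s.nats 5 = s₀.nats 5 ∧ s.reals 5 = s₀.reals 5 ∧ s.reals 8 = s₀.reals 8 ∧
      s.reals 10 = s₀.reals 10 ∧
      (∀ m < n ^ q, s.reals 3 (i * n ^ q + m) = (if m < j then L m + g * f m else L m) ∧
        s.reals 4 (i * n ^ q + m) = s₀.reals 4 (i * n ^ q + m)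
          + if m < j then hedgeWeight (n ^ q) η L m else 0) ∧
      ∀ k, (∀ m < n ^ q, k ≠ i * n ^ q + m) →
        s.reals 3 k = s₀.reals 3 k ∧ s.reals 4 k = s₀.reals 4 k) ?_ ?_ ?_ ?_ ?_).mono ?_ fun _ h => h
  · refine ⟨⟨?_, ?_, ?_, ?_, ?_, ?_, ?_, ?_⟩, ?_, ?_, ?_, ?_, fun m hm => ⟨?_, ?_⟩, ?_⟩ <;>
      simp [*]
  · omega
  · rintro j s' hj ⟨hin, -⟩ -
    simp only [fits_word, eval_word, hin.nats4, h4, and_true]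
    omega
  · rintro j s hj ⟨hin, hn5, hr5, hr8, hr10, hrow, hk⟩ hc
    have h3j : s.reals 3 (i * n ^ q + j) = L j := by rw [(hrow j hj).1, if_neg (lt_irrefl j)]
    have h4j : s.reals 4 (i * n ^ q + j) = s₀.reals 4 (i * n ^ q + j) := by
      rw [(hrow j hj).2, if_neg (lt_irrefl j), add_zero]
    refine Ends.mono
      (Ends.setReal_seq (iv := 0) (ev := Real.exp (η * L j)) ?_ ?_ rfl ?_
      (Ends.setReal_seq (iv := i * n ^ q + j)
        (ev := s₀.reals 4 (i * n ^ q + j) + hedgeWeight (n ^ q) η L j) ?_ ?_ ?_ ?_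
      (Ends.setReal (iv := i * n ^ q + j) (ev := L j + g * f j) ?_ ?_ ?_ ?_ ?post)))
      ?cost (fun _ h => h)
    case post =>
      refine ⟨by simp [hc], ⟨?_, ?_, ?_, ?_, ?_, ?_, ?_, ?_⟩, ?_, ?_, ?_, ?_, ?_, ?_⟩
      · simp [hin.nats0]
      · simp [hin.nats1]
      · simp [hin.nats2]
      · simp [hin.nats3]
      · simp [hin.nats4]
      · simp [hin.reals0]
      · simp [hin.reals1]
      · simp [hin.reals6]
      · simp [hn5]
      · simp [hr5]
      · simp [hr8]
      · simp [hr10]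
      · intro m hm
        have hm' := hrow m hm
        rcases eq_or_ne m j with rfl | h
        · simp
        · have e : m < j + 1 ↔ m < j := by omega
          simp [h, e, hm'.1, hm'.2]
      · intro k hkm
        have := hkm j hj
        simp [this, hk k hkm]
    case cost =>
      simp only [NExpr.cost, RExpr.cost, word, reg, rowIndex, RExpr.invSub]
      norm_num
    all_goals try simp [NExpr.Fits, RExpr.Fits, NExpr.eval, RExpr.eval, rowIndex, hc,
      hin.nats4, hin.reals6, hn5, h4, h5, h6, h3j, h4j, hr5, hr8, hr10, hg,
      hF j hj, hS, hedgeWeight, Real.exp_neg]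
    all_goals omega
  · rintro s ⟨hin, hn5, hr5, hr8, hr10, hrow, hk⟩
    refine ⟨hin, hn5, fun m hm => ?_, hk⟩
    simpa [hm] using hrow m hm
  · simp only [NExpr.cost, word]
    omega

theorem SameInput.trans {s₁ s₂ : State} (h : SameInput s₀ s₁) (h' : SameInput s₁ s₂) :
    SameInput s₀ s₂ :=
  ⟨h'.1.trans h.1, h'.2.trans h.2, h'.3.trans h.3, h'.4.trans h.4, h'.5.trans h.5,
    h'.6.trans h.6, h'.7.trans h.7, h'.8.trans h.8⟩

theorem vertexProg_ends (h0 : s₀.nats 0 0 = n) (h4 : s₀.nats 4 0 = n ^ q) (h5 : s₀.nats 5 0 = i)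
    (hx : ∀ j : Fin n, s₀.reals 1 j = ((x j : ℤ) : ℝ)) (h6 : s₀.reals 6 0 = η)
    (hlam : s₀.reals 0 0 = lam)
    (hW : n * n ^ q + 2 ≤ W) (hL : ∀ m < n ^ q, s₀.reals 3 (i * n ^ q + m) = L m) :
    Ends W vertexProg s₀ (n ^ q * 600) fun s =>
      SameInput s₀ s ∧ s.nats 5 = s₀.nats 5 ∧
      (∀ m < n ^ q, s.reals 3 (i * n ^ q + m) = vertexStep q η lam i L x m ∧
        s.reals 4 (i * n ^ q + m)
          = s₀.reals 4 (i * n ^ q + m) + hedgeWeight (n ^ q) η L m) ∧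
      ∀ k, (∀ m < n ^ q, k ≠ i * n ^ q + m) →
        s.reals 3 k = s₀.reals 3 k ∧ s.reals 4 k = s₀.reals 4 k := by
  have hn : 0 < n := i.pos
  have hM : 0 < n ^ q := Nat.pow_pos hn
  have hnW : n ≤ n * n ^ q := Nat.le_mul_of_pos_right _ hM
  have hi := i.2
  refine Ends.mono
    (Ends.setReal_seq (iv := 0) (ev := 0) ?_ ?_ rfl ?_
    (Ends.setReal_seq (iv := 0) (ev := 0) ?_ ?_ rfl ?_
    (Ends.setReal_seq (iv := 0) (ev := 1) ?_ ?_ rfl ?_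
    (Ends.seq (K₂ := n ^ q * 200 + 100) (predictLoop_ends (q := q) (W := W) (η := η) (i := i) (x := x) (L := L)
      ?_ ?_ ?_ ?_ ?_ ?_ ?_ ?_ ?_ ?_) ?main)))) ?cost (fun _ h => h)
  case main =>
    rintro s ⟨hin, hn5, hr3, hr4, hF, hS, hA⟩
    have hpos := hedgePotential_pos hM η L
    refine (Ends.seq (K₂ := n ^ q * 200 + 20)
      (R := fun s' => s' = s.setReal 10 0 (vertexGrad q η lam i L x))
      (Ends.setReal (iv := 0) ?_ ?_ rfl ?_ rfl) ?_).mono ?_ fun _ h => h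
    · simp [NExpr.Fits]
    · simp [RExpr.Fits, NExpr.Fits, hn5, h5]
      omega
    · have e : s.reals 7 0 / s.reals 8 0 = ∑ m ∈ Finset.range (n ^ q),
          hedgeWeight (n ^ q) η L m * mono (tupleSet i q m) x := by
        rw [hA, hS, mul_div_cancel_left₀ _ hpos.ne']
      simp [RExpr.eval, NExpr.eval, e, hn5, h5, vertexGrad, vertexPred, logistic, hin.reals0,
        hin.reals1, hlam, hx]
    · rintro _ rfl
      refine (updateLoop_ends (q := q) (W := W) (η := η) (i := i) (L := L)
        (g := vertexGrad q η lam i L x) (f := fun m => mono (tupleSet i q m) x)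
        ?_ ?_ ?_ ?_ ?_ ?_ ?_ ?_).mono le_rfl ?_
      · simp [hin.nats4, h4]
      · simp [hn5, h5]
      · simp [hin.reals6, h6]
      · omega
      · intro m hm; simp [hr3, hL m hm]
      · intro m hm; simp [hF m hm]
      · simp [hS]
      · simp
      · rintro s' ⟨hin', hn5', hrow, hk⟩
        refine ⟨?_, ?_, ?_, ?_⟩
        · have e1 : SameInput s (s.setReal 10 0 (vertexGrad q η lam i L x)) := by
            constructor <;> simp
          have e2 := (hin.trans e1).trans hin'
          constructor
          · simpa using e2.nats0
          · simpa using e2.nats1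
          · simpa using e2.nats2
          · simpa using e2.nats3
          · simpa using e2.nats4
          · simpa using e2.reals0
          · simpa using e2.reals1
          · simpa using e2.reals6
        · simpa [hn5] using hn5'
        · intro m hm
          simpa [hr4, vertexStep] using hrow m hm
        · intro k hkm
          simpa [hr3, hr4] using hk k hkm
    · simp only [NExpr.cost, RExpr.cost, word, reg]
      omega
  case cost =>
    simp only [NExpr.cost, RExpr.cost]
    omega
  all_goals try simp [NExpr.Fits, RExpr.Fits, NExpr.eval, RExpr.eval, *]
  all_goals omega

/-- The memory during the processing of the stream: `L` and `V` are the cumulative losses and the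
sums of the weights. -/
structure Stores (n t q : ℕ) (lam NN η : ℝ) (L V : Fin n → ℕ → ℝ) (s : State) : Prop where
  n_eq : s.nats 0 0 = n
  t_eq : s.nats 0 1 = t
  M_eq : s.nats 4 0 = n ^ q
  out1 : s.nats 1 = 0
  out2 : s.nats 2 = 0
  out3 : s.nats 3 = 0
  lam_eq : s.reals 0 0 = lam
  N_eq : s.reals 0 3 = NN
  rate_eq : s.reals 6 0 = η
  loss_eq : ∀ i : Fin n, ∀ m < n ^ q, s.reals 3 (i * n ^ q + m) = L i m
  sum_eq : ∀ i : Fin n, ∀ m < n ^ q, s.reals 4 (i * n ^ q + m) = V i m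

theorem row_ne {M i i' m m' : ℕ} (h : i ≠ i') (hm : m < M) (hm' : m' < M) :
    i * M + m ≠ i' * M + m' := by
  rcases Nat.lt_or_gt_of_ne h with h | h
  · have : (i + 1) * M ≤ i' * M := Nat.mul_le_mul_right _ h
    rw [add_mul, one_mul] at this
    omega
  · have : (i' + 1) * M ≤ i * M := Nat.mul_le_mul_right _ h
    rw [add_mul, one_mul] at this
    omega

theorem stepProg_ends {t : ℕ} {NN : ℝ} {L V : Fin n → ℕ → ℝ} (hn : 0 < n)
    (hs : Stores n t q lam NN η L V s₀)
    (x : Cube n) (hW : n * n ^ q + 2 ≤ W) :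
    Ends W stepProg (s₀.load x) (n * n ^ q * 700)
      (Stores n t q lam NN η (fun i => vertexStep q η lam i (L i) x)
        fun i m => V i m + hedgeWeight (n ^ q) η (L i) m) := by
  have hM : 0 < n ^ q := Nat.pow_pos hn
  have hnW : n ≤ n * n ^ q := Nat.le_mul_of_pos_right _ hM
  refine (Ends.forLoop (B := n) (K := n ^ q * 600) (fun j s =>
      SameInput (s₀.load x) s ∧ ∀ i : Fin n, ∀ m < n ^ q,
        s.reals 3 (i * n ^ q + m) = (if (i : ℕ) < j then vertexStep q η lam i (L i) x m else L i m) ∧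
        s.reals 4 (i * n ^ q + m)
          = V i m + if (i : ℕ) < j then hedgeWeight (n ^ q) η (L i) m else 0)
      ?_ ?_ ?_ ?_ ?_).mono ?_ fun _ h => h
  · refine ⟨⟨?_, ?_, ?_, ?_, ?_, ?_, ?_, ?_⟩, fun i m hm => ⟨?_, ?_⟩⟩ <;>
      simp [State.load, hs.loss_eq, hs.sum_eq, *]
  · omega
  · rintro j s' hj ⟨hin, -⟩ -
    simp only [fits_word, eval_word, hin.nats0, State.load, hs.n_eq, and_true]
    omega
  · rintro j s hj ⟨hin, hrow⟩ hc
    refine (vertexProg_ends (q := q) (i := ⟨j, hj⟩) (x := x) (L := L ⟨j, hj⟩) (lam := lam) (η := η)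
      ?_ ?_ hc ?_ ?_ ?_ hW ?_).mono le_rfl ?_
    · simp [hin.nats0, State.load, hs.n_eq]
    · simp [hin.nats4, State.load, hs.M_eq]
    · intro j'; simp [hin.reals1, State.load]
    · simp [hin.reals6, State.load, hs.rate_eq]
    · simp [hin.reals0, State.load, hs.lam_eq]
    · intro m hm
      simpa using (hrow ⟨j, hj⟩ m hm).1
    · rintro s' ⟨hin', hn5, hrow', hk⟩
      refine ⟨by rw [hn5, hc], ?_, ?_⟩
      · have e1 : SameInput s' (s'.setNat 5 0 (j + 1)) := by
          constructor <;> simp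
        exact (hin.trans hin').trans e1
      · intro i m hm
        simp only [State.reals_setNat]
        by_cases hij : (i : ℕ) = j
        · subst hij
          have h1 := hrow' m hm
          have h2 := (hrow i m hm).2
          simp only [lt_irrefl, if_false, add_zero] at h2
          simp only [Fin.eta] at h1
          rw [h1.1, h1.2, h2, if_pos (Nat.lt_succ_self _), if_pos (Nat.lt_succ_self _)]
          exact ⟨rfl, rfl⟩
        · have h1 := hk (i * n ^ q + m) fun m' hm' => row_ne hij hm hm'
          rw [h1.1, h1.2]
          have e : (i : ℕ) < j + 1 ↔ (i : ℕ) < j := by omega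
          simpa only [e] using hrow i m hm
  · rintro s ⟨hin, hrow⟩
    constructor
    · simp [hin.nats0, State.load, hs.n_eq]
    · simp [hin.nats0, State.load, hs.t_eq]
    · simp [hin.nats4, State.load, hs.M_eq]
    · simp [hin.nats1, State.load, hs.out1]
    · simp [hin.nats2, State.load, hs.out2]
    · simp [hin.nats3, State.load, hs.out3]
    · simp [hin.reals0, State.load, hs.lam_eq]
    · simp [hin.reals0, State.load, hs.N_eq]
    · simp [hin.reals6, State.load, hs.rate_eq]
    · intro i m hm; simpa using (hrow i m hm).1
    · intro i m hm; simpa using (hrow i m hm).2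
  · simp only [NExpr.cost, word]
    have : n * (n ^ q * 600 + (1 + 1) + 11) = n * n ^ q * 600 + n * 13 := by ring
    omega

end Vertex

end RealRAM

/-! ### Correctness of the initialization; the program that writes the output. -/

namespace RealRAM

theorem initProg_ends {n t N W : ℕ} {lam ε ρ : ℝ} (hn : 0 < n) (htW : t ≤ W)
    (hW : n * n ^ (t - 1) + 2 ≤ W) (hW2 : 2 * n ^ (t - 1) ≤ W) :
    Ends W initProg (inputState n t lam ε ρ N) (t * 50 + 100)
      (Stores n t (t - 1) lam N (learningRate n t N) 0 0) := by
  have hM : 0 < n ^ (t - 1) := Nat.pow_pos hn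
  have hnW : n ≤ n * n ^ (t - 1) := Nat.le_mul_of_pos_right _ hM
  have hMW : n ^ (t - 1) ≤ n * n ^ (t - 1) := Nat.le_mul_of_pos_left _ hn
  refine (Ends.setNat_seq (iv := 0) (ev := 1) ?_ ?_ rfl rfl
    (Ends.seq (K₂ := 50) (R := fun s => s.reals = (inputState n t lam ε ρ N).reals ∧
        (∀ a < 4, s.nats a = (inputState n t lam ε ρ N).nats a) ∧ s.nats 4 0 = n ^ (t - 1))
      (Ends.forLoop (B := t - 1) (K := 20) (fun j s => s.reals = (inputState n t lam ε ρ N).reals ∧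
        (∀ a < 4, s.nats a = (inputState n t lam ε ρ N).nats a) ∧ s.nats 4 0 = n ^ j)
        ?_ ?_ ?_ ?_ ?_) ?_)).mono ?_ fun _ h => h
  · simp [NExpr.Fits]
  · simp [NExpr.Fits]; omega
  · refine ⟨by simp, fun a ha => ?_, by simp⟩
    rw [State.nats_setNat_of_ne _ (by omega), State.nats_setNat_of_ne _ (by omega)]
  · omega
  · rintro j s hj ⟨hr, hna, h4⟩ hc
    have h0 : s.nats 0 1 = t := by rw [hna 0 (by omega)]; simp [inputState]
    simp [NExpr.Fits, NExpr.eval, h0]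
    omega
  · rintro j s hj ⟨hr, hna, h4⟩ hc
    have h0 : s.nats 0 0 = n := by rw [hna 0 (by omega)]; simp [inputState]
    have hj1 : n ^ (j + 1) ≤ n ^ (t - 1) := Nat.pow_le_pow_right hn hj
    have hj2 : n ^ j ≤ n ^ (t - 1) := Nat.pow_le_pow_right hn hj.le
    refine (Ends.setNat (iv := 0) (ev := n ^ (j + 1)) ?_ ?_ rfl ?_ ?_).mono ?_ fun _ h => h
    · simp [NExpr.Fits]
    · simp only [NExpr.Fits, fits_word, eval_word, h0, h4, ← pow_succ]
      omega
    · simp only [NExpr.eval, eval_word, h0, h4, pow_succ]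
    · refine ⟨by simp [hc], by simp [hr], fun a ha => ?_, by simp⟩
      rw [State.nats_setNat_of_ne _ (by omega), State.nats_setNat_of_ne _ (by omega), hna a ha]
    · simp [NExpr.cost, word]
  · exact fun _ h => h
  · rintro s ⟨hr, hna, h4⟩
    refine (Ends.setReal (iv := 0) (ev := learningRate n t N) ?_ ?_ rfl ?_ ?_).mono ?_ fun _ h => h
    · simp [NExpr.Fits]
    · simp only [RExpr.Fits, NExpr.Fits, fits_word, NExpr.eval, eval_word, h4]
      omega
    · simp [RExpr.eval, NExpr.eval, h4, hr, inputState, learningRate]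
    · constructor
      · simp [hna, inputState]
      · simp [hna, inputState]
      · simp [h4]
      · simp only [State.nats_setReal, hna 1 (by omega)]; funext k; simp [inputState]
      · simp only [State.nats_setReal, hna 2 (by omega)]; funext k; simp [inputState]
      · simp only [State.nats_setReal, hna 3 (by omega)]; funext k; simp [inputState]
      · simp [hr, inputState]
      · simp [hr, inputState]
      · simp
      · intro i m _; simp [hr, inputState]
      · intro i m _; simp [hr, inputState]
    · simp [NExpr.cost, RExpr.cost, word]
  · simp only [NExpr.cost]
    omega

/-- The flag of the variable `e` in the row of the current term. -/
def flagIndex (e : NExpr) : NExpr := .add (.mul (word 8) (word 0)) e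

/-- Split off the lowest digit of the word variable `9` and toggle the flag of its variable. -/
def digitBody : Prog :=
  .seq (.setNat 7 (.lit 0) (.mod (word 9) (word 0))) (.seq
    (.setNat 9 (.lit 0) (.div (word 9) (word 0)))
    (.setNat 2 (flagIndex (.select (word 7) (word 5))) (.add
      (.sub (.sign (word 7)) (.get 2 (flagIndex (.select (word 7) (word 5)))))
      (.sub (.get 2 (flagIndex (.select (word 7) (word 5)))) (.sign (word 7))))))

/-- Mark the edge between the variables `10` and `12` if they occur in the current term. -/
def edgeBody : Prog :=
  .setNat 3 (.add (.mul (word 10) (word 0)) (word 12)) (.sub (.lit 1) (.mul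
    (.sub (.lit 1) (.get 3 (.add (.mul (word 10) (word 0)) (word 12))))
    (.sub (.lit 1) (.mul (.get 2 (flagIndex (word 10))) (.get 2 (flagIndex (word 12)))))))

/-- Mark the edges of the current term. -/
def edgeProg : Prog := forLoop 10 (word 0) (forLoop 12 (word 0) edgeBody)

/-- Write the term of the vertex `5` and the monomial `6`. -/
def termProg : Prog :=
  .seq (.setNat 8 (.lit 0) rowIndex) (.seq
    (.setNat 9 (.lit 0) (word 6)) (.seq
    (forLoop 10 (.sub (.get 0 (.lit 1)) (.lit 1)) digitBody) (.seq
    (.setNat 2 (flagIndex (word 5)) (.lit 1)) (.seq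
    (.setNat 11 (.lit 0) (.lit 0)) (.seq
    (forLoop 10 (word 0) (.setNat 11 (.lit 0) (.add (word 11) (.get 2 (flagIndex (word 10)))))) (.seq
    (.setReal 2 (word 8) (.div (.div (.mul (reg 0) (.get 4 (word 8))) (.get 0 (.lit 3)))
      (.ofNat (word 11))))
    (.ite (.realLE (.mul (.get 2 (word 8)) (.get 2 (word 8))) (.ofNat (.lit 0))) .skip
      edgeProg)))))))

/-- Write the output. -/
def finishProg : Prog :=
  .seq (.setNat 1 (.lit 0) (.mul (word 0) (word 4)))
    (forLoop 5 (word 0) (forLoop 6 (word 4) termProg))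

section Term

variable {n q k W : ℕ} {s₀ : State} {i : Fin n}

/-- The flags in the row `k` mark the set `I`. -/
def RowMarks (k : ℕ) (I : Finset (Fin n)) (s : State) : Prop :=
  ∀ a : Fin n, s.nats 2 (k * n + a) = if a ∈ I then 1 else 0

/-- The invariant is that the marked set `P` and the set of the digits not yet read have the
symmetric difference `tupleSet i q m`. Toggling flags is symmetric difference. -/
theorem digitLoop_ends {m : ℕ} (hn : 0 < n) (h0 : s₀.nats 0 0 = n) (h1 : s₀.nats 0 1 - 1 = q)
    (h1W : s₀.nats 0 1 ≤ W)
    (h5 : s₀.nats 5 0 = i) (h8 : s₀.nats 8 0 = k) (h9 : s₀.nats 9 0 = m) (hmW : m ≤ W)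
    (hkW : k * n + n ≤ W) (hqW : q + 1 ≤ W) (hrow : RowMarks k (∅ : Finset (Fin n)) s₀) :
    Ends W (forLoop 10 (.sub (.get 0 (.lit 1)) (.lit 1)) digitBody) s₀ (q * 200 + 20) fun s =>
      s.reals = s₀.reals ∧ (∀ a, a ≠ 2 → a ≠ 7 → a ≠ 9 → a ≠ 10 → s.nats a = s₀.nats a) ∧
      (∀ l, (∀ a < n, l ≠ k * n + a) → s.nats 2 l = s₀.nats 2 l) ∧
      RowMarks k (tupleSet i q m) s := by
  have hi := i.2
  have hnW : n ≤ W := le_trans (Nat.le_add_left _ _) hkW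
  have hk : k ≤ k * n := Nat.le_mul_of_pos_right _ hn
  refine (Ends.forLoop (B := q) (K := 180) (fun j s =>
      s.reals = s₀.reals ∧ (∀ a, a ≠ 2 → a ≠ 7 → a ≠ 9 → a ≠ 10 → s.nats a = s₀.nats a) ∧
      (∀ l, (∀ a < n, l ≠ k * n + a) → s.nats 2 l = s₀.nats 2 l) ∧
      ∃ P c, s.nats 9 0 = c ∧ c ≤ W ∧ RowMarks k P s ∧
        symmDiff P (tupleSet i (q - j) c) = tupleSet i q m) ?_ ?_ ?_ ?_ ?_).mono ?_ fun _ h => h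
  · refine ⟨by simp, fun a _ _ _ h => by simp [h], fun l _ => by simp, ∅, m, by simp [h9], hmW,
      ?_, ?_⟩
    · intro a
      simpa using hrow a
    · rw [Nat.sub_zero]
      exact bot_symmDiff _
  · omega
  · rintro j s hj ⟨-, hna, -⟩ hc
    simp only [NExpr.Fits, NExpr.eval, hna 0 (by omega) (by omega) (by omega) (by omega)]
    omega
  · rintro j s hj ⟨hr, hna, hl, P, c, h9', hcW, hP, hT⟩ hc
    have e0 := hna 0 (by omega) (by omega) (by omega) (by omega)
    have e5 := hna 5 (by omega) (by omega) (by omega) (by omega)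
    have e8 := hna 8 (by omega) (by omega) (by omega) (by omega)
    have hd : c % n < n := Nat.mod_lt _ hn
    have hdc : c / n ≤ c := Nat.div_le_self _ _
    obtain ⟨v, hv⟩ : ∃ v : Fin n, (v : ℕ) = if c % n = i then 0 else c % n :=
      ⟨⟨if c % n = i then 0 else c % n, by split_ifs <;> omega⟩, rfl⟩
    have hvn := v.2
    have hf : s.nats 2 (k * n + v) = if v ∈ P then 1 else 0 := hP v
    have hf1 : s.nats 2 (k * n + v) ≤ 1 := by rw [hf]; split_ifs <;> omega
    refine Ends.mono
      (Ends.setNat_seq (iv := 0) (ev := c % n) ?_ ?_ rfl ?_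
      (Ends.setNat_seq (iv := 0) (ev := c / n) ?_ ?_ rfl ?_
      (Ends.setNat (iv := k * n + v) (ev := (min (c % n) 1 - s.nats 2 (k * n + v))
        + (s.nats 2 (k * n + v) - min (c % n) 1)) ?_ ?_ ?_ ?_ ?post)))
      ?cost (fun _ h => h)
    case post =>
      refine ⟨by simp [hc], by simp [hr], fun a h2 h7 h9 h10 => ?_, fun l hlk => ?_,
        symmDiff (digitSet i (c % n)) P, c / n, by simp, by omega, fun a => ?_, ?_⟩
      · simp [h2, h7, h9, h10, hna a h2 h7 h9 h10]
      · simp [hlk v v.2, hl l hlk]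
      -- The digit `0` addresses the flag of the variable `0` but toggles it by `0`, so no branch is
      -- needed in the program.
      · by_cases h0 : c % n = 0
        · have e : symmDiff (digitSet i (c % n)) P = P := by
            rw [h0, digitSet_zero]; exact bot_symmDiff _
          rw [e]
          by_cases hav : a = v
          · subst hav
            simp [h0, ← hP a]
          · have : (a : ℕ) ≠ v := fun h => hav (Fin.ext h)
            simp [this, hP a]
        · have hm1 : min (c % n) 1 = 1 := Nat.min_eq_right (by omega)
          rw [digitSet_eq_singleton h0 hv, hm1]
          by_cases hav : a = v
          · subst hav
            by_cases haP : a ∈ P <;> simp [Finset.mem_symmDiff, haP, hf]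
          · have : (a : ℕ) ≠ v := fun h => hav (Fin.ext h)
            simp [this, hP a, Finset.mem_symmDiff, hav]
      · obtain ⟨r, hr⟩ : ∃ r, q - j = r + 1 := ⟨q - j - 1, by omega⟩
        rw [show q - (j + 1) = r by omega, ← hT, hr, tupleSet, symmDiff_comm _ P, symmDiff_assoc]
    case cost =>
      simp [NExpr.cost, word, NExpr.mod, NExpr.sign, NExpr.select, flagIndex]
    · simp [NExpr.Fits]
    · refine fits_mod ?_ ?_ ?_ <;> simp [h9', e0, h0] <;> omega
    · simp [h9', e0, h0]
    · simp [NExpr.Fits]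
    · simp [NExpr.Fits, h9', e0, h0]
      omega
    · simp [NExpr.eval, h9', e0, h0]
    · simp only [flagIndex, NExpr.Fits, NExpr.eval, eval_word, fits_word, eval_select]
      simp [e8, h8, e0, h0, e5, h5, ← hv]
      refine ⟨⟨by omega, by omega, by omega⟩, fits_select ?_ ?_ ?_ ?_ ?_, by omega⟩ <;>
        first | omega | (simp [e5, h5]; omega)
    · have hsel : (NExpr.select (word 7) (word 5)).Fits W
          ((s.setNat 7 0 (c % n)).setNat 9 0 (c / n)) := by
        refine fits_select ?_ ?_ ?_ ?_ ?_ <;> first | omega | (simp [e5, h5]; omega)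
      simp only [flagIndex, NExpr.Fits, NExpr.eval, eval_word, fits_word, eval_select, fits_sign,
        eval_sign, hsel]
      simp [e8, h8, e0, h0, e5, h5, ← hv]
      omega
    · simp [flagIndex, NExpr.eval, e8, h8, e0, h0, e5, h5, ← hv]
    · simp [flagIndex, NExpr.eval, e8, h8, e0, h0, e5, h5, ← hv]
  · rintro s ⟨hr, hna, hl, P, c, -, -, hP, hT⟩
    rw [Nat.sub_self, tupleSet] at hT
    have : P = tupleSet i q m := by rw [← hT]; exact (symmDiff_bot P).symm
    exact ⟨hr, hna, hl, this ▸ hP⟩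
  · simp only [NExpr.cost]
    omega

theorem countLoop_ends (h0 : s₀.nats 0 0 = n) (h8 : s₀.nats 8 0 = k) (h11 : s₀.nats 11 0 = 0)
    (hkW : k * n + n ≤ W) (hnW : n + 1 ≤ W) {I : Finset (Fin n)} (hrow : RowMarks k I s₀) :
    Ends W (forLoop 10 (word 0) (.setNat 11 (.lit 0) (.add (word 11)
      (.get 2 (flagIndex (word 10)))))) s₀ (n * 40 + 20) fun s =>
      s.reals = s₀.reals ∧ (∀ a, a ≠ 10 → a ≠ 11 → s.nats a = s₀.nats a) ∧
      s.nats 11 0 = I.card := by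
  refine (Ends.forLoop (B := n) (K := 20) (fun j s =>
      s.reals = s₀.reals ∧ (∀ a, a ≠ 10 → a ≠ 11 → s.nats a = s₀.nats a) ∧
      s.nats 11 0 = ∑ a ∈ Finset.range j, s₀.nats 2 (k * n + a)) ?_ ?_ ?_ ?_ ?_).mono ?_ fun _ h => h
  · refine ⟨by simp, fun a h _ => by simp [h], by simp [h11]⟩
  · omega
  · rintro j s hj ⟨-, hna, -⟩ hc
    simp only [fits_word, eval_word, hna 0 (by omega) (by omega), h0, and_true]
    omega
  · rintro j s hj ⟨hr, hna, hs⟩ hc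
    have e0 := hna 0 (by omega) (by omega)
    have e2 := hna 2 (by omega) (by omega)
    have e8 := hna 8 (by omega) (by omega)
    have hle : ∀ a < n, s₀.nats 2 (k * n + a) ≤ 1 := by
      intro a ha
      have := hrow ⟨a, ha⟩
      simp only at this
      rw [this]; split_ifs <;> omega
    have hsum : ∑ a ∈ Finset.range j, s₀.nats 2 (k * n + a) ≤ j := by
      calc _ ≤ ∑ a ∈ Finset.range j, 1 := Finset.sum_le_sum fun a ha =>
            hle a ((Finset.mem_range.1 ha).trans hj)
        _ = j := by simp
    have := hle j hj
    have hk : k ≤ k * n := Nat.le_mul_of_pos_right _ (by omega)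
    refine (Ends.setNat (iv := 0) (ev := ∑ a ∈ Finset.range (j + 1), s₀.nats 2 (k * n + a))
      ?_ ?_ rfl ?_ ?_).mono ?_ fun _ h => h
    · simp [NExpr.Fits]
    · simp only [NExpr.Fits, NExpr.eval, flagIndex, fits_word, eval_word, hs, e8, h8, e0, h0, e2, hc]
      omega
    · simp [NExpr.eval, flagIndex, hs, e8, h8, e0, h0, e2, hc, Finset.sum_range_succ]
    · exact ⟨by simp [hc], by simp [hr], fun a h h' => by simp [h, h', hna a h h'], by simp⟩
    · simp [NExpr.cost, flagIndex, word]
  · rintro s ⟨hr, hna, hs⟩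
    refine ⟨hr, hna, ?_⟩
    rw [hs, Finset.sum_range]
    simp only [hrow _]
    simp
  · simp only [NExpr.cost, word]
    omega

/-- The assignment `1 - (1 - e) * (1 - a * b)` is the Boolean "`e` or (`a` and `b`)". All flags
being at most `1` keeps this faithful under truncated subtraction and keeps the words small. -/
theorem edgeLoop_ends (h0 : s₀.nats 0 0 = n) (h8 : s₀.nats 8 0 = k) (hkW : k * n + n ≤ W)
    (hW : n * n + n + 1 ≤ W) (h2 : ∀ a < n, s₀.nats 2 (k * n + a) ≤ 1)
    (h3 : ∀ l, s₀.nats 3 l ≤ 1) :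
    Ends W edgeProg s₀ (n * (n * 80 + 50) + 20) fun s =>
      s.reals = s₀.reals ∧ (∀ a, a ≠ 3 → a ≠ 10 → a ≠ 12 → s.nats a = s₀.nats a) ∧
      (∀ l, s.nats 3 l ≤ 1) ∧ (∀ l, s₀.nats 3 l ≠ 0 → s.nats 3 l ≠ 0) ∧
      ∀ a < n, ∀ b < n, s₀.nats 2 (k * n + a) ≠ 0 → s₀.nats 2 (k * n + b) ≠ 0 →
        s.nats 3 (a * n + b) ≠ 0 := by
  refine (Ends.forLoop (B := n) (K := n * 80 + 20) (fun j s =>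
      s.reals = s₀.reals ∧ (∀ a, a ≠ 3 → a ≠ 10 → a ≠ 12 → s.nats a = s₀.nats a) ∧
      (∀ l, s.nats 3 l ≤ 1) ∧ (∀ l, s₀.nats 3 l ≠ 0 → s.nats 3 l ≠ 0) ∧
      ∀ a < j, ∀ b < n, s₀.nats 2 (k * n + a) ≠ 0 → s₀.nats 2 (k * n + b) ≠ 0 →
        s.nats 3 (a * n + b) ≠ 0) ?_ ?_ ?_ ?_ ?_).mono ?_ fun _ h => h
  · exact ⟨by simp, fun a _ h _ => by simp [h], by simpa using h3, by simp, by simp⟩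
  · omega
  · rintro j s hj ⟨-, hna, -⟩ hc
    simp only [fits_word, eval_word, hna 0 (by omega) (by omega) (by omega), h0, and_true]
    omega
  · rintro j s hj ⟨hr, hna, hle, hmono, hedge⟩ hc
    refine (Ends.forLoop (B := n) (K := 60) (fun r s =>
      s.nats 10 0 = j ∧ s.reals = s₀.reals ∧
      (∀ a, a ≠ 3 → a ≠ 10 → a ≠ 12 → s.nats a = s₀.nats a) ∧
      (∀ l, s.nats 3 l ≤ 1) ∧ (∀ l, s₀.nats 3 l ≠ 0 → s.nats 3 l ≠ 0) ∧
      ∀ a b, (a < j ∧ b < n) ∨ (a = j ∧ b < r) → s₀.nats 2 (k * n + a) ≠ 0 →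
        s₀.nats 2 (k * n + b) ≠ 0 → s.nats 3 (a * n + b) ≠ 0) ?_ ?_ ?_ ?_ ?_).mono ?_ fun _ h => h
    · refine ⟨by simp [hc], by simp [hr], fun a h h' h'' => by simp [h'', hna a h h' h''],
        by simpa using hle, by simpa using hmono, ?_⟩
      rintro a b (⟨ha, hb⟩ | ⟨-, hb⟩)
      · simpa using hedge a ha b hb
      · omega
    · omega
    · rintro r s' hr' ⟨-, -, hna', -⟩ -
      simp only [fits_word, eval_word, hna' 0 (by omega) (by omega) (by omega), h0, and_true]
      omega
    · rintro r s' hr' ⟨hc', hr, hna', hle', hmono', hedge'⟩ hcr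
      have e0 := hna' 0 (by omega) (by omega) (by omega)
      have e2 := hna' 2 (by omega) (by omega) (by omega)
      have e8 := hna' 8 (by omega) (by omega) (by omega)
      have hjn : (j + 1) * n ≤ n * n := Nat.mul_le_mul_right _ hj
      rw [add_mul, one_mul] at hjn
      have hk : k ≤ k * n := Nat.le_mul_of_pos_right _ (by omega)
      have f1 := h2 j hj
      have f2 := h2 r hr'
      have f3 := hle' (j * n + r)
      have f4 : s₀.nats 2 (k * n + j) * s₀.nats 2 (k * n + r) ≤ 1 :=
        (Nat.mul_le_mul f1 f2).trans (by norm_num)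
      have f5 : (1 - s'.nats 3 (j * n + r)) * (1 - s₀.nats 2 (k * n + j) * s₀.nats 2 (k * n + r))
          ≤ 1 := (Nat.mul_le_mul (Nat.sub_le _ _) (Nat.sub_le _ _)).trans (by norm_num)
      refine (Ends.setNat (iv := j * n + r) (ev := 1 - (1 - s'.nats 3 (j * n + r)) *
        (1 - s₀.nats 2 (k * n + j) * s₀.nats 2 (k * n + r))) ?_ ?_ ?_ ?_ ?_).mono ?_ fun _ h => h
      · simp only [NExpr.Fits, NExpr.eval, fits_word, eval_word, hc', hcr, e0, h0]
        omega
      · simp only [NExpr.Fits, NExpr.eval, flagIndex, fits_word, eval_word, hc', hcr, e0, h0, e2,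
          e8, h8]
        omega
      · simp [NExpr.eval, hc', hcr, e0, h0]
      · simp [NExpr.eval, flagIndex, hc', hcr, e0, h0, e2, e8, h8]
      · refine ⟨by simp [hcr], by simp [hc'], by simp [hr],
          fun a h h' h'' => by simp [h, h'', hna' a h h' h''], fun l => ?_, fun l h => ?_, ?_⟩
        · by_cases h : l = j * n + r
          · subst h; simp
          · simpa [h] using hle' l
        · by_cases hl : l = j * n + r
          · subst hl
            have := hmono' _ h
            have e : s'.nats 3 (j * n + r) = 1 := by omega
            simp [e]
          · simpa [hl] using hmono' l h
        · intro a b hab ha hb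
          by_cases hl : a * n + b = j * n + r
          · have hb' : b < n := by omega
            have haj : a = j := by
              by_contra h
              exact row_ne h hb' hr' hl
            subst haj
            obtain rfl : b = r := by omega
            have e1 : s₀.nats 2 (k * n + a) = 1 := by omega
            have e2 : s₀.nats 2 (k * n + b) = 1 := by omega
            simp [e1, e2]
          · have : (a < j ∧ b < n) ∨ (a = j ∧ b < r) := by
              rcases hab with h | ⟨rfl, h⟩
              · exact Or.inl h
              · refine Or.inr ⟨rfl, ?_⟩
                have : b ≠ r := fun e => hl (by rw [e])
                omega
            simpa [hl] using hedge' a b this ha hb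
      · simp [NExpr.cost, flagIndex, word]
    · rintro s' ⟨hc', hr, hna', hle', hmono', hedge'⟩
      refine ⟨hc', by simp [hr], fun a h h' h'' => by simp [h', hna' a h h' h''],
        by simpa using hle', by simpa using hmono', fun a ha b hb => ?_⟩
      simpa using hedge' a b (by omega)
    · simp only [NExpr.cost, word]
      omega
  · exact fun _ h => h
  · simp only [NExpr.cost, word]
    have : n * (n * 80 + 20 + (1 + 1) + 11) = n * (n * 80) + n * 33 := by ring
    have : n * (n * 80 + 50) = n * (n * 80) + n * 50 := by ring
    omega

end Term

end RealRAM

namespace RealRAM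

/-! ### Correctness of the output program. -/

section Finish

variable {n q W : ℕ} {s₀ : State} {i : Fin n}

/-- The term of the vertex `i` and the monomial `m` has been written. -/
structure TermDone (n q : ℕ) (lam NN : ℝ) (V : Fin n → ℕ → ℝ) (i : Fin n) (m : ℕ) (s : State) :
    Prop where
  row : RowMarks (i * n ^ q + m) (insert i (tupleSet i q m)) s
  coeff : s.reals 2 (i * n ^ q + m)
    = lam * V i m / NN / ((insert i (tupleSet i q m)).card : ℝ)
  edge : s.reals 2 (i * n ^ q + m) ≠ 0 → ∀ a ∈ insert i (tupleSet i q m),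
    ∀ b ∈ insert i (tupleSet i q m), s.nats 3 (a * n + b) ≠ 0

theorem RowMarks.insert_self {k : ℕ} {I : Finset (Fin n)} {s : State} (h : RowMarks k I s) :
    RowMarks k (insert i I) (s.setNat 2 (k * n + i) 1) := by
  intro a
  by_cases ha : a = i
  · subst ha; simp
  · have : (a : ℕ) ≠ i := fun e => ha (Fin.ext e)
    simp [this, h a, ha]

theorem RowMarks.le_one {k : ℕ} {I : Finset (Fin n)} {s : State} (h : RowMarks k I s) :
    ∀ a < n, s.nats 2 (k * n + a) ≤ 1 := by
  intro a ha
  have := h ⟨a, ha⟩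
  simp only at this
  rw [this]; split_ifs <;> omega

theorem termProg_ends {m : ℕ} {lam NN : ℝ} {V : Fin n → ℕ → ℝ} (h0 : s₀.nats 0 0 = n)
    (h1 : s₀.nats 0 1 - 1 = q)
    (h1W : s₀.nats 0 1 + 2 ≤ W) (h4 : s₀.nats 4 0 = n ^ q) (h5 : s₀.nats 5 0 = i)
    (h6 : s₀.nats 6 0 = m) (hm : m < n ^ q) (hlam : s₀.reals 0 0 = lam) (hN : s₀.reals 0 3 = NN)
    (hV : s₀.reals 4 (i * n ^ q + m) = V i m)
    (hW : n * n ^ q * n + n * n + n + 2 ≤ W) (hrow : RowMarks (i * n ^ q + m) (∅ : Finset (Fin n)) s₀)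
    (hle : ∀ l, s₀.nats 3 l ≤ 1) :
    Ends W termProg s₀ ((q + n * n) * 1000) fun s =>
      (∀ a < 7, a ≠ 2 → a ≠ 3 → s.nats a = s₀.nats a) ∧ (∀ a, a ≠ 2 → s.reals a = s₀.reals a) ∧
      (∀ l, (∀ a < n, l ≠ (i * n ^ q + m) * n + a) → s.nats 2 l = s₀.nats 2 l) ∧
      (∀ l, l ≠ i * n ^ q + m → s.reals 2 l = s₀.reals 2 l) ∧
      (∀ l, s.nats 3 l ≤ 1) ∧ (∀ l, s₀.nats 3 l ≠ 0 → s.nats 3 l ≠ 0) ∧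
      TermDone n q lam NN V i m s := by
  have hn : 0 < n := i.pos
  have hi := i.2
  have hi1 : ((i : ℕ) + 1) * n ^ q ≤ n * n ^ q := Nat.mul_le_mul_right _ i.2
  rw [add_mul, one_mul] at hi1
  set k := (i : ℕ) * n ^ q + m with hk
  have hk1 : (k + 1) * n ≤ n * n ^ q * n := Nat.mul_le_mul_right _ (by omega)
  rw [add_mul, one_mul] at hk1
  have hkn : k ≤ k * n := Nat.le_mul_of_pos_right _ hn
  have hMn : n * n ^ q ≤ n * n ^ q * n := Nat.le_mul_of_pos_right _ hn
  have hnn : n ≤ n * n := Nat.le_mul_of_pos_right _ hn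
  have hiM : (i : ℕ) * n ^ q ≤ k := Nat.le_add_right _ _
  have hMW : n ^ q ≤ n * n ^ q := Nat.le_mul_of_pos_left _ hn
  set I := insert i (tupleSet i q m) with hI
  have hIc : I.card ≤ n := by simpa using Finset.card_le_univ I
  set coef := lam * V i m / NN / (I.card : ℝ) with hcoef
  refine Ends.mono
    (Ends.setNat_seq (iv := 0) (ev := k) ?_ ?_ rfl ?_
    (Ends.setNat_seq (iv := 0) (ev := m) ?_ ?_ rfl ?_
    (Ends.seq (K₂ := n * 60 + n * (n * 80 + 50) + 300)
      (digitLoop_ends (q := q) (k := k) (i := i) (m := m) (W := W)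
      hn ?_ ?_ ?_ ?_ ?_ ?_ ?_ ?_ ?_ ?_) ?digits))) ?cost (fun _ h => h)
  case cost =>
    simp only [NExpr.cost, rowIndex, word]
    have : n * (n * 80 + 50) = n * n * 80 + n * 50 := by ring
    have : (q + n * n) * 1000 = q * 1000 + n * n * 1000 := by ring
    omega
  case digits =>
    rintro s₁ ⟨hr₁, hna₁, hl₁, hrow₁⟩
    have e0 : s₁.nats 0 0 = n := by
      rw [hna₁ 0 (by omega) (by omega) (by omega) (by omega)]; simpa using h0
    have e5 : s₁.nats 5 0 = i := by
      rw [hna₁ 5 (by omega) (by omega) (by omega) (by omega)]; simpa using h5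
    have e8 : s₁.nats 8 0 = k := by
      rw [hna₁ 8 (by omega) (by omega) (by omega) (by omega)]; simp
    have hrow₂ := hrow₁.insert_self (i := i)
    rw [← hI] at hrow₂
    refine Ends.mono
      (Ends.setNat_seq (iv := k * n + i) (ev := 1) ?_ ?_ ?_ rfl
      (Ends.setNat_seq (iv := 0) (ev := 0) ?_ ?_ rfl rfl
      (Ends.seq (K₂ := n * (n * 80 + 50) + 200)
        (countLoop_ends (n := n) (k := k) (W := W) (I := I) ?_ ?_ ?_ ?_ ?_ ?_) ?count)))
        ?cost (fun _ h => h)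
    case cost =>
      simp only [NExpr.cost, flagIndex, word]
      omega
    case count =>
      rintro s₃ ⟨hr₃, hna₃, hcard⟩
      have g0 : s₃.nats 0 0 = n := by
        rw [hna₃ 0 (by omega) (by omega)]; simpa using e0
      have g8 : s₃.nats 8 0 = k := by
        rw [hna₃ 8 (by omega) (by omega)]; simpa using e8
      have g2 : RowMarks k I s₃ := by
        intro a
        rw [hna₃ 2 (by omega) (by omega)]
        simpa using hrow₂ a
      have gr : s₃.reals = s₀.reals := by rw [hr₃]; simp [hr₁]
      have gna : ∀ a < 7, a ≠ 2 → s₃.nats a = s₀.nats a := by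
        intro a ha h2
        rw [hna₃ a (by omega) (by omega), State.nats_setNat_of_ne _ (by omega),
          State.nats_setNat_of_ne _ (by omega), hna₁ a (by omega) (by omega) (by omega) (by omega),
          State.nats_setNat_of_ne _ (by omega), State.nats_setNat_of_ne _ (by omega)]
      have gl : ∀ l, (∀ a < n, l ≠ k * n + a) → s₃.nats 2 l = s₀.nats 2 l := by
        intro l hl
        rw [hna₃ 2 (by omega) (by omega)]
        simpa [hl i i.2] using hl₁ l hl
      refine (Ends.setReal_seq (iv := k) (ev := coef) ?_ ?_ ?_ ?_ (K := n * (n * 80 + 50) + 100)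
        ?_).mono ?_ fun _ h => h
      · simp [g8]; omega
      · simp [RExpr.Fits, NExpr.Fits, g8, hcard]; omega
      · simp [g8]
      · simp [RExpr.eval, NExpr.eval, g8, hcard, gr, hlam, hN, hV, coef]
      · refine (Ends.ite (K := n * (n * 80 + 50) + 50) ?_ ?_ ?_).mono ?_ fun _ h => h
        · simp [Test.Fits, RExpr.Fits, NExpr.Fits, g8]; omega
        · intro hb
          -- The only comparison of reals is `≤`, so vanishing is tested as `coef * coef ≤ 0`.
          have hz : coef = 0 := by
            simp only [Test.Holds, RExpr.eval, NExpr.eval, eval_word, State.nats_setReal, g8,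
              State.reals_setReal_self, Function.update_self, Nat.cast_zero] at hb
            exact mul_self_eq_zero.1 (le_antisymm hb (mul_self_nonneg _))
          refine (Ends.skip ?_).mono (by omega) fun _ h => h
          refine ⟨fun a ha h2 _ => by simp [gna a ha h2], fun a ha => by simp [ha, gr],
            fun l hl => by simp [gl l hl], fun l hl => by simp [hl, gr], ?_, ?_, ⟨?_, ?_, ?_⟩⟩
          · simpa [gna 3 (by omega) (by omega)] using hle
          · simp [gna 3 (by omega) (by omega)]
          · intro a; exact g2 a
          · simp [k, coef, I]
          · intro h; exact absurd hz (by simpa [k] using h)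
        · intro _
          refine (edgeLoop_ends (n := n) (k := k) (W := W) ?_ ?_ ?_ ?_ ?_ ?_).mono (by omega) ?_
          · simp [g0]
          · simp [g8]
          · omega
          · omega
          · simpa using g2.le_one
          · simpa [gna 3 (by omega) (by omega)] using hle
          · rintro s₅ ⟨hr₅, hna₅, hle₅, hmono₅, hedge₅⟩
            refine ⟨fun a ha h2 h3 => ?_, fun a ha => ?_, fun l hl => ?_, fun l hl => ?_, hle₅,
              fun l h => hmono₅ l ?_, ⟨?_, ?_, ?_⟩⟩
            · rw [hna₅ a h3 (by omega) (by omega)]; simp [gna a ha h2]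
            · rw [hr₅]; simp [ha, gr]
            · rw [hna₅ 2 (by omega) (by omega) (by omega)]; simp [gl l hl]
            · rw [hr₅]; simp [hl, gr]
            · simpa [gna 3 (by omega) (by omega)] using h
            · intro a
              rw [hna₅ 2 (by omega) (by omega) (by omega)]
              exact g2 a
            · rw [hr₅]; simp [k, coef, I]
            · intro _ a ha b hb
              refine hedge₅ a a.2 b b.2 ?_ ?_
              · simp [g2 a, hI, ha]
              · simp [g2 b, hI, hb]
        · simp only [Test.cost, RExpr.cost, NExpr.cost, word]
          omega
      · simp only [RExpr.cost, NExpr.cost, word, reg]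
        omega
    · simp [flagIndex, NExpr.Fits, NExpr.eval, e0, e5, e8]; omega
    · simp [NExpr.Fits]; omega
    · simp [flagIndex, NExpr.eval, e0, e5, e8]
    · simp [NExpr.Fits]
    · simp [NExpr.Fits]
    · simp [e0]
    · simp [e8]
    · simp
    · omega
    · omega
    · intro a; simpa using hrow₂ a
  · simp [NExpr.Fits]
  · simp [rowIndex, NExpr.Fits, NExpr.eval, h4, h5, h6]; omega
  · simp [rowIndex, NExpr.eval, h4, h5, h6, hk]
  · simp [NExpr.Fits]
  · simp [h6]; omega
  · simp [h6]
  · simp [h0]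
  · simp [h1]
  · simp; omega
  · simp [h5]
  · simp
  · simp
  · omega
  · omega
  · omega
  · intro a; simpa using hrow a

theorem finishProg_ends {t : ℕ} {lam NN η : ℝ} {L V : Fin n → ℕ → ℝ} (hn : 0 < n)
    (hs : Stores n t (t - 1) lam NN η L V s₀) (htW : t + 2 ≤ W)
    (hW : n * n ^ (t - 1) * n + n * n + n + 2 ≤ W) :
    Ends W finishProg s₀ (n * n ^ (t - 1) * ((t + n * n) * 1100) + 100) fun s =>
      s.nats 1 0 = n * n ^ (t - 1) ∧
      ∀ i : Fin n, ∀ m < n ^ (t - 1), TermDone n (t - 1) lam NN V i m s := by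
  set q := t - 1 with hq
  have hM : 0 < n ^ q := Nat.pow_pos hn
  have hMn : n * n ^ q ≤ n * n ^ q * n := Nat.le_mul_of_pos_right _ hn
  have hMW : n ^ q ≤ n * n ^ q := Nat.le_mul_of_pos_left _ hn
  -- Terms are written in lexicographic order up to `(j, r)`. Later rows must be blank, because the
  -- digits of a term toggle flags instead of setting them.
  set Inv : ℕ → ℕ → State → Prop := fun j r s =>
    s.nats 0 = s₀.nats 0 ∧ s.nats 1 0 = n * n ^ q ∧ s.nats 4 = s₀.nats 4 ∧
    s.reals 0 = s₀.reals 0 ∧ s.reals 4 = s₀.reals 4 ∧ (∀ l, s.nats 3 l ≤ 1) ∧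
    (∀ i : Fin n, ∀ m < n ^ q, ((i : ℕ) < j ∨ ((i : ℕ) = j ∧ m < r)) →
      TermDone n q lam NN V i m s) ∧
    (∀ i : Fin n, ∀ m < n ^ q, ¬((i : ℕ) < j ∨ ((i : ℕ) = j ∧ m < r)) →
      RowMarks (i * n ^ q + m) (∅ : Finset (Fin n)) s) with hInv
  have hset : ∀ {j r s a v}, a ≠ 0 → a ≠ 1 → a ≠ 2 → a ≠ 3 → a ≠ 4 → Inv j r s →
      Inv j r (s.setNat a 0 v) := by
    rintro j r s a v h0 h1 h2 h3 h4 ⟨i0, i1, i4, r0, r4, i3, hd, hu⟩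
    refine ⟨?_, ?_, ?_, r0, r4, ?_, fun i m hm h => ?_, fun i m hm h => ?_⟩
    · rwa [State.nats_setNat_of_ne _ h0.symm]
    · rwa [State.nats_setNat_of_ne _ h1.symm]
    · rwa [State.nats_setNat_of_ne _ h4.symm]
    · rwa [State.nats_setNat_of_ne _ h3.symm]
    · obtain ⟨d1, d2, d3⟩ := hd i m hm h
      refine ⟨fun b => ?_, d2, fun hc b hb c hc' => ?_⟩
      · rw [State.nats_setNat_of_ne _ h2.symm]; exact d1 b
      · rw [State.nats_setNat_of_ne _ h3.symm]; exact d3 hc b hb c hc'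
    · intro b
      rw [State.nats_setNat_of_ne _ h2.symm]; exact hu i m hm h b
  have hmono : ∀ {j r j' r' s}, (∀ i m : ℕ, i < n → m < n ^ q →
      ((i < j ∨ (i = j ∧ m < r)) ↔ (i < j' ∨ (i = j' ∧ m < r')))) → Inv j r s → Inv j' r' s := by
    rintro j r j' r' s h ⟨i0, i1, i4, r0, r4, i3, hd, hu⟩
    exact ⟨i0, i1, i4, r0, r4, i3, fun i m hm h' => hd i m hm ((h i m i.2 hm).2 h'),
      fun i m hm h' => hu i m hm fun h'' => h' ((h i m i.2 hm).1 h'')⟩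
  refine (Ends.setNat_seq (iv := 0) (ev := n * n ^ q) ?_ ?_ rfl ?_
    (Ends.forLoop (B := n) (K := n ^ q * ((t + n * n) * 1000 + 20) + 20) (fun j s => Inv j 0 s)
      ?_ ?_ ?_ ?_ ?_)).mono ?_ fun _ h => h
  · simp [NExpr.Fits]
  · simp [NExpr.Fits, hs.n_eq, hs.M_eq]; omega
  · simp [NExpr.eval, hs.n_eq, hs.M_eq]
  · refine ⟨by simp, by simp, by simp, by simp, by simp, ?_, ?_, ?_⟩
    · simp [hs.out3]
    · intro i m _ h; omega
    · intro i m _ _ a; simp [hs.out2]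
  · omega
  · rintro j s hj ⟨i0, -⟩ -
    simp only [fits_word, eval_word, i0, hs.n_eq, and_true]
    omega
  · rintro j s hj hI hc
    refine (Ends.forLoop (B := n ^ q) (K := (t + n * n) * 1000) (fun r s =>
      s.nats 5 0 = j ∧ Inv j r s) ?_ ?_ ?_ ?_ ?_).mono ?_ fun _ h => h
    · exact ⟨by simp [hc], hset (by omega) (by omega) (by omega) (by omega) (by omega) hI⟩
    · omega
    · rintro r s hr ⟨-, -, -, i4, -⟩ -
      simp only [fits_word, eval_word, i4, hs.M_eq, and_true]
      omega
    · rintro r s hr ⟨hc, i0, i1, i4, r0, r4, i3, hd, hu⟩ hcr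
      refine (termProg_ends (q := q) (W := W) (i := ⟨j, hj⟩) (m := r) (lam := lam) (NN := NN)
        (V := V) ?_ ?_ ?_ ?_ hc hcr hr ?_ ?_ ?_ hW ?_ i3).mono ?_ ?_
      · rw [i0, hs.n_eq]
      · rw [i0, hs.t_eq]
      · rw [i0, hs.t_eq]; omega
      · rw [i4, hs.M_eq]
      · rw [r0, hs.lam_eq]
      · rw [r0, hs.N_eq]
      · rw [r4]; exact hs.sum_eq ⟨j, hj⟩ r hr
      · exact hu ⟨j, hj⟩ r hr (by simp)
      · exact Nat.mul_le_mul_right _ (by omega)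
      · rintro s' ⟨hna, hre, hrow, hco, hle, hed, hdone⟩
        refine ⟨by rw [hna 6 (by omega) (by omega) (by omega), hcr], ?_, ?_⟩
        · rw [State.nats_setNat_of_ne _ (by omega), hna 5 (by omega) (by omega) (by omega), hc]
        · refine hset (by omega) (by omega) (by omega) (by omega) (by omega) ?_
          have hne : ∀ i : Fin n, ∀ m < n ^ q, ¬((i : ℕ) = j ∧ m = r) →
              (i : ℕ) * n ^ q + m ≠ j * n ^ q + r := by
            intro i m hm h e
            by_cases hij : (i : ℕ) = j
            · rw [hij] at e
              exact h ⟨hij, by omega⟩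
            · exact row_ne hij hm hr e
          have hflag : ∀ i : Fin n, ∀ m < n ^ q, ¬((i : ℕ) = j ∧ m = r) → ∀ b : Fin n,
              s'.nats 2 ((i * n ^ q + m) * n + b) = s.nats 2 ((i * n ^ q + m) * n + b) :=
            fun i m hm h b => hrow _ fun a ha => row_ne (hne i m hm h) b.2 ha
          refine ⟨?_, ?_, ?_, ?_, ?_, hle, ?_, ?_⟩
          · rw [hna 0 (by omega) (by omega) (by omega), i0]
          · rw [hna 1 (by omega) (by omega) (by omega), i1]
          · rw [hna 4 (by omega) (by omega) (by omega), i4]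
          · rw [hre 0 (by omega), r0]
          · rw [hre 4 (by omega), r4]
          · intro i m hm h
            by_cases him : (i : ℕ) = j ∧ m = r
            · obtain ⟨rfl, rfl⟩ := him
              exact hdone
            · obtain ⟨d1, d2, d3⟩ := hd i m hm (by omega)
              refine ⟨fun b => ?_, ?_, fun hc' b hb c hc => ?_⟩
              · rw [hflag i m hm him b]; exact d1 b
              · rw [hco _ (hne i m hm him)]; exact d2
              · rw [hco _ (hne i m hm him)] at hc'
                exact hed _ (d3 hc' b hb c hc)
          · intro i m hm h b
            rw [hflag i m hm (by omega) b]
            exact hu i m hm (by omega) b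
    · rintro s ⟨hc', hI⟩
      refine ⟨hc', hset (by omega) (by omega) (by omega) (by omega) (by omega) (hmono ?_ hI)⟩
      intro i m hi hm
      omega
    · simp only [NExpr.cost, word]
      have : n ^ q * ((t + n * n) * 1000 + (1 + 1) + 11)
          = n ^ q * ((t + n * n) * 1000) + n ^ q * 13 := by ring
      have : n ^ q * ((t + n * n) * 1000 + 20) = n ^ q * ((t + n * n) * 1000) + n ^ q * 20 := by
        ring
      omega
  · rintro s ⟨-, i1, -, -, -, -, hd, -⟩
    exact ⟨i1, fun i m hm => hd i m hm (Or.inl i.2)⟩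
  · simp only [NExpr.cost, word]
    have e1 : n * (n ^ q * ((t + n * n) * 1000 + 20) + 20 + (1 + 1) + 11)
        = n * n ^ q * ((t + n * n) * 1000) + n * n ^ q * 20 + n * 33 := by ring
    have e2 : n * n ^ q * ((t + n * n) * 1100)
        = n * n ^ q * ((t + n * n) * 1000) + n * n ^ q * ((t + n * n) * 100) := by ring
    have e3 : n * n ^ q * 53 ≤ n * n ^ q * ((t + n * n) * 100) := by
      refine Nat.mul_le_mul_left _ ?_
      have : 0 < n * n := Nat.mul_pos hn hn
      omega
    have e4 : n ≤ n * n ^ q := Nat.le_mul_of_pos_right _ hM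
    omega

end Finish

end RealRAM

namespace RealRAM

/-! ### The output memory read as a polynomial and a graph. -/

section Output

variable {n q : ℕ} {s : State} {lam NN : ℝ} {V : Fin n → ℕ → ℝ}

theorem outputMonomial_eq {k : ℕ} {I : Finset (Fin n)} (h : RowMarks k I s) :
    outputMonomial n s k = I := by
  ext a
  simp [outputMonomial, h a]

theorem sum_range_mul_eq (n M : ℕ) (f : ℕ → ℝ) :
    ∑ k ∈ Finset.range (n * M), f k = ∑ i : Fin n, ∑ m ∈ Finset.range M, f (i * M + m) := by
  rw [← Finset.sum_range (fun i => ∑ m ∈ Finset.range M, f (i * M + m))]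
  induction n with
  | zero => simp
  | succ n ih => rw [Finset.sum_range_succ, ← ih, add_mul, one_mul, Finset.sum_range_add]

/-- A monomial may be listed many times, from several vertices and tuples; its coefficients add up.
-/
theorem outputPoly_eq (h1 : s.nats 1 0 = n * n ^ q)
    (h : ∀ i : Fin n, ∀ m < n ^ q, TermDone n q lam NN V i m s) (I : Finset (Fin n)) :
    outputPoly n s I = ∑ i : Fin n, ∑ m ∈ Finset.range (n ^ q),
      if insert i (tupleSet i q m) = I then s.reals 2 (i * n ^ q + m) else 0 := by
  rw [outputPoly, h1, Finset.sum_filter, sum_range_mul_eq]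
  refine Finset.sum_congr rfl fun i _ => Finset.sum_congr rfl fun m hm => ?_
  rw [outputMonomial_eq (h i m (Finset.mem_range.1 hm)).row]

theorem outputPoly_eq_learnedPoly {N : ℕ} {η : ℝ} {Z : Fin N → Cube n}
    (h1 : s.nats 1 0 = n * n ^ q)
    (h : ∀ i : Fin n, ∀ m < n ^ q, TermDone n q lam N (weightSum q η lam Z N) i m s) :
    outputPoly n s = learnedPoly q η lam Z := by
  funext I
  rw [outputPoly_eq h1 h, learnedPoly]
  refine Finset.sum_congr rfl fun i _ => Finset.sum_congr rfl fun m hm => ?_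
  rw [(h i m (Finset.mem_range.1 hm)).coeff]

/-- A nonzero total coefficient forces some nonzero term with this monomial, and the edges of such a
term were marked. -/
theorem outputPoly_isClique (h1 : s.nats 1 0 = n * n ^ q)
    (h : ∀ i : Fin n, ∀ m < n ^ q, TermDone n q lam NN V i m s) {I : Finset (Fin n)}
    (hI : outputPoly n s I ≠ 0) :
    (outputGraph n s).IsClique (I : Set (Fin n)) ∧ I.card ≤ q + 1 := by
  rw [outputPoly_eq h1 h] at hI
  obtain ⟨i, -, hi⟩ := Finset.exists_ne_zero_of_sum_ne_zero hI
  obtain ⟨m, hm, hc⟩ := Finset.exists_ne_zero_of_sum_ne_zero hi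
  have hT := h i m (Finset.mem_range.1 hm)
  rw [ne_eq, ite_eq_right_iff, Classical.not_imp] at hc
  obtain ⟨rfl, hc⟩ := hc
  refine ⟨fun a ha b hb hab => ?_, ?_⟩
  · rw [outputGraph, SimpleGraph.fromRel_adj]
    exact ⟨hab, Or.inl (hT.edge hc a ha b hb)⟩
  · exact (Finset.card_insert_le _ _).trans (Nat.succ_le_succ (card_tupleSet_le i q m))

end Output

end RealRAM

/-! ### Gibbs distributions of polynomials. -/

/-- The probability distribution with weights proportional to `exp (f x)`. -/
noncomputable def gibbs {α : Type*} [Fintype α] [Nonempty α] (f : α → ℝ) : PMF α :=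
  PMF.ofFintype (fun x => ENNReal.ofReal (Real.exp (f x) / ∑ y, Real.exp (f y))) (by
    have h : 0 < ∑ y, Real.exp (f y) :=
      Finset.sum_pos (fun _ _ => Real.exp_pos _) Finset.univ_nonempty
    rw [← ENNReal.ofReal_sum_of_nonneg fun x _ => by positivity, ← Finset.sum_div, div_self h.ne',
      ENNReal.ofReal_one])

theorem exists_gibbs_eq {α : Type*} [Fintype α] [Nonempty α] (f : α → ℝ) :
    ∃ c : ℝ, 0 < c ∧ ∀ x, (gibbs f x).toReal = c * Real.exp (f x) := by
  have h : 0 < ∑ y, Real.exp (f y) :=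
    Finset.sum_pos (fun _ _ => Real.exp_pos _) Finset.univ_nonempty
  refine ⟨(∑ y, Real.exp (f y))⁻¹, inv_pos.2 h, fun x => ?_⟩
  rw [gibbs, PMF.ofFintype_apply, ENNReal.toReal_ofReal (by positivity), div_eq_inv_mul]

/-- The monomials with nonzero coefficient serve as the factors. -/
theorem isMRF_gibbs {n t : ℕ} {G : SimpleGraph (Fin n)} {φ : MultilinearPoly n}
    (h : ∀ I, φ I ≠ 0 → G.IsClique (I : Set (Fin n)) ∧ I.card ≤ t) :
    IsMRF t G φ (gibbs φ.eval) := by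
  classical
  refine ⟨Finset.univ.filter fun I => φ I ≠ 0, fun I x => φ I * mono I x,
    fun I hI => h I (Finset.mem_filter.1 hI).2, fun I _ x y hxy => ?_, fun x => ?_,
    exists_gibbs_eq φ.eval⟩
  · simp only [mono]
    congr 1
    exact Finset.prod_congr rfl fun i hi => by rw [hxy i hi]
  · rw [MultilinearPoly.eval_eq, Finset.sum_filter]
    refine Finset.sum_congr rfl fun I _ => ?_
    split_ifs with hI
    · rfl
    · rw [not_ne_iff.1 hI, zero_mul]

/-! ### The complete run and the main theorem. -/

namespace RealRAM

/-- The learning algorithm. -/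
def learner : OnlineAlgorithm := ⟨initProg, stepProg, finishProg⟩

theorem exists_run {W K n N : ℕ} {p : Prog} {Z : Fin N → Cube n} {P : ℕ → State → Prop}
    {s₀ : State} (h0 : P 0 s₀)
    (hstep : ∀ (j : Fin N) s, P j s → Ends W p (s.load (Z j)) K (P (j + 1))) :
    ∃ (s : ℕ → State) (c : ℕ → ℕ), s 0 = s₀ ∧
      (∀ j : Fin N, Exec W p ((s j).load (Z j)) (c j) (s (j + 1)) ∧ c j ≤ K) ∧ P N (s N) := by
  have key : ∀ M ≤ N, ∃ (s : ℕ → State) (c : ℕ → ℕ), s 0 = s₀ ∧ (∀ j : Fin N, (j : ℕ) < M →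
      Exec W p ((s j).load (Z j)) (c j) (s (j + 1)) ∧ c j ≤ K) ∧ P M (s M) := by
    intro M
    induction M with
    | zero => exact fun _ => ⟨fun _ => s₀, fun _ => 0, rfl, fun j hj => by omega, h0⟩
    | succ M ih =>
      intro hM
      obtain ⟨s, c, hs0, hs, hP⟩ := ih (by omega)
      obtain ⟨k, s', he, hk, hP'⟩ := hstep ⟨M, hM⟩ (s M) hP
      refine ⟨fun j => if j ≤ M then s j else s', fun j => if j < M then c j else k, by simp [hs0],
        fun j hj => ?_, by simpa using hP'⟩
      rcases Nat.lt_succ_iff_lt_or_eq.1 hj with h | h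
      · simpa [h.le, Nat.succ_le_iff.2 h, h] using hs j h
      · obtain rfl : j = ⟨M, hM⟩ := Fin.ext h
        simpa using ⟨he, hk⟩
  obtain ⟨s, c, hs0, hs, hP⟩ := key N le_rfl
  exact ⟨s, c, hs0, fun j => hs j j.2, hP⟩

theorem learner_runs {n t N C : ℕ} {lam ε ρ : ℝ} (hC : 5000 ≤ C) (hn : 1 ≤ n) (ht : 1 ≤ t)
    (hN : 2 * t * (n * n) ≤ N) (Z : Fin N → Cube n) :
    ∃ out, learner.Runs ((2 * t * n) ^ (C * t)) (C * n ^ t) (C * (N * n ^ t)) t lam ε ρ Z out ∧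
      out.nats 1 0 = n * n ^ (t - 1) ∧ ∀ i : Fin n, ∀ m < n ^ (t - 1),
        TermDone n (t - 1) lam N (weightSum (t - 1) (learningRate n t N) lam Z N) i m out := by
  set W := (2 * t * n) ^ (C * t) with hW
  set q := t - 1 with hq
  have hpow : n * n ^ q = n ^ t := by rw [← pow_succ', hq, Nat.sub_add_cancel ht]
  -- The largest addresses are those of the flags, of order `n ^ (t + 1)`; with the words `t` and `n
  -- * n` they all fit below this bound.
  have hW1 : 16 * n ^ (4 * t) * t ≤ W := by
    have a1 : (2 * t * n) ^ (5 * t) ≤ W :=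
      Nat.pow_le_pow_right (by positivity) (Nat.mul_le_mul_right t (by omega))
    refine le_trans ?_ a1
    have a2 : (2 * t * n) ^ (5 * t) = (2 * n) ^ (4 * t) * t ^ (4 * t) * (2 * t * n) ^ t := by
      rw [← mul_pow, show 2 * n * t = 2 * t * n by ring, ← pow_add]
      congr 1; ring
    rw [a2]
    refine Nat.mul_le_mul ((Nat.mul_le_mul ?_ (Nat.one_le_pow _ _ ht)).trans' (mul_one _).ge) ?_
    · rw [mul_pow]
      refine Nat.mul_le_mul_right _ ?_
      calc 16 = 2 ^ 4 := by norm_num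
        _ ≤ 2 ^ (4 * t) := Nat.pow_le_pow_right (by norm_num) (by omega)
    · calc t ≤ 2 * t * n := by nlinarith
        _ ≤ (2 * t * n) ^ t := Nat.le_self_pow (by omega) _
  have hp : ∀ e ≤ 4 * t, n ^ e ≤ n ^ (4 * t) := fun e he => Nat.pow_le_pow_right hn he
  have hb1 := hp 0 (by omega)
  have hb2 := hp 1 (by omega)
  have hb3 := hp 2 (by omega)
  have hb4 := hp t (by omega)
  have hb5 := hp (t + 1) (by omega)
  have hb6 := hp q (by omega)
  rw [pow_zero] at hb1
  rw [pow_one] at hb2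
  rw [pow_two] at hb3
  rw [pow_succ] at hb5
  have hW2 : 16 * n ^ (4 * t) ≤ W := le_trans (Nat.le_mul_of_pos_right _ ht) hW1
  have hW3 : 16 * t ≤ W := by
    refine le_trans (Nat.mul_le_mul_right t ?_) hW1
    omega
  obtain ⟨c₀, s₀, he₀, hc₀, hs₀⟩ := initProg_ends (N := N) (W := W) (lam := lam) (ε := ε) (ρ := ρ)
    (n := n) (t := t) hn (by omega) (by rw [hpow]; omega) (by rw [← hq]; omega)
  obtain ⟨s, c, hs0, hs, hP⟩ := exists_run (W := W) (K := n * n ^ q * 700) (p := stepProg) (Z := Z)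
    (P := fun j => Stores n t q lam N (learningRate n t N)
      (lossTable q (learningRate n t N) lam Z j) (weightSum q (learningRate n t N) lam Z j))
    (s₀ := s₀)
    (by
      convert hs₀ using 1
      · rfl
      · funext i m
        simp [weightSum])
    (by
      intro j s hs
      refine (stepProg_ends hn hs (Z j) (by rw [hpow]; omega)).mono le_rfl fun s' h' => ?_
      convert h' using 1
      · funext i
        exact trajectory_succ _ _ Z j
      · funext i m
        exact Finset.sum_range_succ _ _)
  obtain ⟨c₁, out, he₁, hc₁, h1, hterm⟩ := finishProg_ends (W := W) hn hP (by omega)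
    (by rw [← hq, hpow]; omega)
  refine ⟨out, ⟨s, c, c₀, c₁, by rw [hs0]; exact he₀, fun j => ⟨(hs j).1, (hs j).2.trans ?_⟩, he₁,
    ?_⟩, h1, hterm⟩
  · rw [hpow, mul_comm]
    exact Nat.mul_le_mul_right _ (by omega)
  · rw [← hq, hpow] at hc₁
    have b1 : ∑ j ∈ Finset.range N, c j ≤ N * (n ^ t * 700) := by
      calc _ ≤ ∑ j ∈ Finset.range N, n ^ t * 700 :=
            Finset.sum_le_sum fun j hj => hpow ▸ (hs ⟨j, Finset.mem_range.1 hj⟩).2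
        _ = N * (n ^ t * 700) := by simp
    have hnt : 1 ≤ n ^ t := Nat.one_le_pow _ _ hn
    have hnn : 1 ≤ n * n := Nat.mul_pos hn hn
    -- Writing the output takes `O(n ^ t * (t + n ^ 2))` steps, which the many samples pay for.
    have b2 : t + n * n ≤ N := by
      have : t * 1 ≤ t * (n * n) := Nat.mul_le_mul_left _ hnn
      have : 1 * (n * n) ≤ t * (n * n) := Nat.mul_le_mul_right _ ht
      have : 2 * t * (n * n) = 2 * (t * (n * n)) := by ring
      omega
    have b3 : N ≤ N * n ^ t := Nat.le_mul_of_pos_right _ hnt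
    have b4 : n ^ t * ((t + n * n) * 1100) ≤ N * n ^ t * 1100 := by
      rw [← mul_assoc, mul_comm (n ^ t)]
      exact Nat.mul_le_mul_right _ (Nat.mul_le_mul_right _ b2)
    have b5 : N * (n ^ t * 700) = N * n ^ t * 700 := by ring
    have b6 : 5000 * (N * n ^ t) ≤ C * (N * n ^ t) := Nat.mul_le_mul_right _ hC
    omega

end RealRAM

theorem mainTheorem6 :
    ∃ (A : RealRAM.OnlineAlgorithm) (C : ℕ),
      ∀ (n t N : ℕ) (lam ε ρ : ℝ), 1 ≤ n → 1 ≤ t → 0 ≤ lam →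
        0 < ε → ε < 1 / 2 → 0 < ρ → ρ < 1 / 2 →
        (2 * (t : ℝ)) ^ (C * t) * Real.exp (C * lam * t) / ε ^ 4 * (n : ℝ) ^ (4 * t)
            * Real.log ((n : ℝ) / (ρ * ε)) ≤ (N : ℝ) →
        ∃ (out : (Fin N → Cube n) → RealRAM.State) (D' : (Fin N → Cube n) → PMF (Cube n)),
          (∀ Z : Fin N → Cube n,
            A.Runs ((2 * t * n) ^ (C * t)) (C * n ^ t) (C * (N * n ^ t)) t lam ε ρ Z (out Z) ∧
            IsMRF t (RealRAM.outputGraph n (out Z)) (RealRAM.outputPoly n (out Z)) (D' Z)) ∧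
          ∀ (G : SimpleGraph (Fin n)) (ψ : MultilinearPoly n) (D : PMF (Cube n)),
            IsMRF t G ψ D → (∀ i : Fin n, (ψ.partialDeriv i).l1Norm ≤ lam) →
            ENNReal.ofReal (1 - ρ) ≤ (Measure.pi fun _ : Fin N => D.toMeasure)
              {Z | ∀ x : Cube n,
                (1 - ε) * (D' Z x).toReal ≤ (D x).toReal ∧
                (D x).toReal ≤ (1 + ε) * (D' Z x).toReal} := by
  refine ⟨RealRAM.learner, 5000, ?_⟩
  -- Accuracy needs only `29 ≤ C`; the value `5000` covers the step counts.
  generalize hC : (5000 : ℕ) = C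
  intro n t N lam ε ρ hn ht hlam hε hε1 hρ hρ1 hN
  have hN' : 2 * t * (n * n) ≤ N := by
    have htR : (1 : ℝ) ≤ t := by exact_mod_cast ht
    have hnR : (1 : ℝ) ≤ n := by exact_mod_cast hn
    have h1 : (2 * t : ℝ) ≤ (2 * (t : ℝ)) ^ (C * t) :=
      le_self_pow₀ (by linarith) (Nat.mul_ne_zero (by omega) (by omega))
    have h2 : 1 ≤ Real.exp (C * lam * t) := Real.one_le_exp (by positivity)
    have h3 : ε ^ 4 ≤ 1 := pow_le_one₀ hε.le (by linarith)
    have h4 : (n * n : ℝ) ≤ (n : ℝ) ^ (4 * t) := by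
      rw [← sq]; exact pow_le_pow_right₀ hnR (by omega)
    -- The quotient exceeds `4 > exp 1`, as `ρ` and `ε` are below `1/2`.
    have h5 : 1 ≤ Real.log ((n : ℝ) / (ρ * ε)) := by
      rw [Real.le_log_iff_exp_le (by positivity)]
      have := Real.exp_one_lt_d9
      refine (this.le.trans (by norm_num : (2.7182818286 : ℝ) ≤ 4)).trans ?_
      rw [le_div_iff₀ (by positivity)]
      nlinarith
    have h6 : (2 * t : ℝ) ≤ (2 * (t : ℝ)) ^ (C * t) * Real.exp (C * lam * t) / ε ^ 4 := by
      rw [le_div_iff₀ (by positivity)]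
      calc (2 * t : ℝ) * ε ^ 4 ≤ 2 * t * 1 := mul_le_mul_of_nonneg_left h3 (by positivity)
        _ ≤ _ := mul_le_mul h1 h2 zero_le_one (by positivity)
    have h7 : (2 * t * (n * n) : ℝ) ≤ N := by
      refine le_trans ?_ hN
      rw [← mul_one (2 * t * (n * n) : ℝ)]
      exact mul_le_mul (mul_le_mul h6 h4 (by positivity) (by positivity)) h5 zero_le_one
        (by positivity)
    exact_mod_cast h7
  choose out hruns hone hterm using fun Z : Fin N → Cube n =>
    RealRAM.learner_runs (C := C) (lam := lam) (ε := ε) (ρ := ρ) hC.le hn ht hN' Z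
  have hpoly : ∀ Z, RealRAM.outputPoly n (out Z)
      = learnedPoly (t - 1) (learningRate n t N) lam Z :=
    fun Z => RealRAM.outputPoly_eq_learnedPoly (hone Z) (hterm Z)
  refine ⟨out, fun Z => gibbs (RealRAM.outputPoly n (out Z)).eval, fun Z => ⟨hruns Z,
    isMRF_gibbs fun I hI => ?_⟩, fun G ψ D h hψ => ?_⟩
  · have := RealRAM.outputPoly_isClique (hone Z) (hterm Z) hI
    rwa [Nat.sub_add_cancel ht] at this
  · refine learnedPoly_accurate (C := C) (by omega) hn ht hlam hε hε1 hρ hρ1 hN h hψ fun Z => ?_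
    rw [← hpoly]
    exact exists_gibbs_eq _
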